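/- All algebras are unital complex algebras, $\otimes=\otimes_{\mathbb C}$, and $^*$ is always antilinear. **Setting.** Let $H$ be a Hopf $*$-algebra: a Hopf algebra over $\mathbb C$ that is a $*$-algebra, with $\Delta,\varepsilon$ compatible with $*$ and $(S\circ *)^2=\mathrm{id}$; assume its antipode $S$ is bijective. Let $P$ be a $*$-algebra and a right $H$-comodule algebra, with an algebra map $\delta(p)=p_{(0)}\otimes p_{(1)}$ as coaction, and suppose that the coaction is unitary: $\delta(p^*)=p_{(0)}{}^*\otimes p_{(1)}{}^*$. Let $B=P^{co H}=\{b\in P:\delta(b)=b\otimes 1\}$. Suppose that $B\subseteq P$ is $H$-Galois, i.e. $\chi:P\otimes_BP\to P\otimes H$, $q\otimes_B p\mapsto qp_{(0)}\otimes p_{(1)}$, is bijective, and that $P$ is faithfully flat as a left $B$-module, i.e. $-\otimes_BP$ preserves injections of right $B$-modules and kills no nonzero right $B$-module. Let $\tau(h)=\chi^{-1}(1\otimes h)=\tau^1(h)\otimes_B\tau^2(h)$. **Bialgebroids.** A left bialgebroid $\mathcal L$ over an algebra $A$ is an algebra with an algebra map $s_L:A\to\mathcal L$ and an anti-algebra map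 $t_L:A\to\mathcal L$ with commuting images, and with an $A$-coring structure $\Delta_L:\mathcal L\to\mathcal L\otimes_A\mathcal L$, $X\mapsto X_{(1)}\otimes X_{(2)}$, $\varepsilon_L:\mathcal L\to A$ for the bimodule structure $a.X.b=s_L(a)t_L(b)X$, such that $X_{(1)}t_L(a)\otimes X_{(2)}=X_{(1)}\otimes X_{(2)}s_L(a)$, $\Delta_L$ is a unital algebra map, $\varepsilon_L(1)=1$ and $\varepsilon_L(XY)=\varepsilon_L(Xs_L(\varepsilon_L(Y)))=\varepsilon_L(Xt_L(\varepsilon_L(Y)))$. A right bialgebroid $\mathcal R$ over $A$ is defined in the same way, with $a.X.b=Xt_R(a)s_R(b)$, $s_R(a)X_{(1)}\otimes X_{(2)}=X_{(1)}\otimes t_R(a)X_{(2)}$, $\varepsilon_R(1)=1$ and $\varepsilon_R(XY)=\varepsilon_R(s_R(\varepsilon_R(X))Y)=\varepsilon_R(t_R(\varepsilon_R(X))Y)$. If $\mathcal L$ is a left bialgebroid over $A$, then $\mathcal L^{op}$ is the right bialgebroid over $A$ on the opposite algebra with $s_R=t_L$, $t_R=s_L$ and the same coproduct and counit. $\mathcal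 L$ is a *left Hopf algebroid* if $X\otimes Y\mapsto X_{(1)}\otimes_A X_{(2)}Y$ is a bijection onto $\mathcal L\otimes_A\mathcal L$ from the tensor product $\mathcal L\otimes\mathcal L$ modulo $Xt_L(a)\otimes Y=X\otimes t_L(a)Y$, and an *anti-left Hopf algebroid* if $X\otimes Y\mapsto Y_{(1)}X\otimes_A Y_{(2)}$ is a bijection onto $\mathcal L\otimes_A\mathcal L$ from $\mathcal L\otimes\mathcal L$ modulo $s_L(a)X\otimes Y=X\otimes Ys_L(a)$. **Pairs.** Let $A$ be a $*$-algebra, and $\mathcal L$, $\mathcal R$ a left and a right bialgebroid over $A$. The pair $(\mathcal L,\mathcal R)$ is a *$*$-Hopf algebroid pair* with respect to $\circledast,\Phi$ if 1. $\circledast:\mathcal L\to\mathcal R$ is an antilinear bijective unital anti-algebra map with $s_R(a^*)=s_L(a)^\circledast$, $t_R(a^*)=t_L(a)^\circledast$, $\Delta_R(X^\circledast)=X_{(2)}{}^\circledast\otimes X_{(1)}{}^\circledast$ and $\varepsilon_R(X^\circledast)=\varepsilon_L(X)^*$; 2. $\Phi:\mathcal L\to\mathcal R$ is a linear bijective unital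 anti-algebra map with $\Phi\circ s_L=t_R$, $\Phi\circ t_L=s_R$, $\Delta_R(\Phi(X))=\Phi(X_{(1)})\otimes\Phi(X_{(2)})$ and $\varepsilon_R\circ\Phi=\varepsilon_L$; 3. $\Phi^{-1}\circ\circledast=\circledast^{-1}\circ\Phi$; 4. $\mathcal L$ is a left and an anti-left Hopf algebroid. **Statement.** Let $$\mathcal L(P,H)=\{p\otimes q\in P\otimes P:\ p_{(0)}\otimes q_{(0)}\otimes p_{(1)}q_{(1)}=p\otimes q\otimes 1\}$$ (sums suppressed), with product $(p\otimes q)(r\otimes u)=pr\otimes uq$. There is exactly one left bialgebroid structure over $B$ on this algebra (the Ehresmann–Schauenburg one) with $$s_L(b)=b\otimes 1,\quad t_L(b)=1\otimes b,\quad \varepsilon_L(p\otimes q)=pq,\quad \Delta_L(p\otimes q)=p_{(0)}\otimes\tau^1(p_{(1)})\otimes_B\tau^2(p_{(1)})\otimes q,$$ the last formula being read in $P\otimes(P\otimes_BP)\otimes P$. For this structure $(\mathcal L(P,H),\mathcal L(P,H)^{op})$ is a $*$-Hopf algebroid pair over the $*$-algebra $B$, with $$(p\otimes q)^\circledast=q^*\otimes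 p^*,\qquad \Phi=\mathrm{id}.$$ -/

import Mathlib

open scoped TensorProduct
open MulOpposite

universe u v w

noncomputable section

namespace HopfPair

/-! ## Balanced tensor products

All modules are complex vector spaces.  If `a ∈ A` acts on `M` by `ρ a` and on `N` by `σ a`, the
balanced tensor product is the quotient of `M ⊗ N` by the span of all `ρ a m ⊗ n - m ⊗ σ a n`. -/

section Balanced

variable {A M N Q : Type*} [AddCommGroup M] [Module ℂ M] [AddCommGroup N] [Module ℂ N]
  [AddCommGroup Q] [Module ℂ Q]

/-- The relations `ρ a m ⊗ n = m ⊗ σ a n`. -/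
def balancedRel (ρ : A → M →ₗ[ℂ] M) (σ : A → N →ₗ[ℂ] N) : Submodule ℂ (M ⊗[ℂ] N) :=
  Submodule.span ℂ {z | ∃ a m n, z = ρ a m ⊗ₜ[ℂ] n - m ⊗ₜ[ℂ] σ a n}

/-- The tensor product of `M` and `N` balanced over `A`. -/
abbrev BalancedTensor (ρ : A → M →ₗ[ℂ] M) (σ : A → N →ₗ[ℂ] N) : Type _ :=
  (M ⊗[ℂ] N) ⧸ balancedRel ρ σ

/-- The class of an element of `M ⊗ N`. -/
abbrev BalancedTensor.mk (ρ : A → M →ₗ[ℂ] M) (σ : A → N →ₗ[ℂ] N) :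
    M ⊗[ℂ] N →ₗ[ℂ] BalancedTensor ρ σ :=
  (balancedRel ρ σ).mkQ

theorem balancedRel_le_ker {ρ : A → M →ₗ[ℂ] M} {σ : A → N →ₗ[ℂ] N} (f : M ⊗[ℂ] N →ₗ[ℂ] Q)
    (h : ∀ a m n, f (ρ a m ⊗ₜ n) = f (m ⊗ₜ σ a n)) :
    balancedRel ρ σ ≤ LinearMap.ker f := by
  refine Submodule.span_le.2 ?_
  rintro _ ⟨a, m, n, rfl⟩
  simp [h]

/-- A linear map out of `M ⊗ N` that respects the relations descends. -/
def BalancedTensor.lift {ρ : A → M →ₗ[ℂ] M} {σ : A → N →ₗ[ℂ] N} (f : M ⊗[ℂ] N →ₗ[ℂ] Q)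
    (h : ∀ a m n, f (ρ a m ⊗ₜ n) = f (m ⊗ₜ σ a n)) : BalancedTensor ρ σ →ₗ[ℂ] Q :=
  (balancedRel ρ σ).liftQ f (balancedRel_le_ker f h)

@[simp]
theorem BalancedTensor.lift_mk {ρ : A → M →ₗ[ℂ] M} {σ : A → N →ₗ[ℂ] N} (f : M ⊗[ℂ] N →ₗ[ℂ] Q)
    (h : ∀ a m n, f (ρ a m ⊗ₜ n) = f (m ⊗ₜ σ a n)) (z : M ⊗[ℂ] N) :
    BalancedTensor.lift f h (BalancedTensor.mk ρ σ z) = f z := rfl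

theorem balancedMk_eq (ρ : A → M →ₗ[ℂ] M) (σ : A → N →ₗ[ℂ] N) (a : A) (m : M) (n : N) :
    BalancedTensor.mk ρ σ (ρ a m ⊗ₜ n) = BalancedTensor.mk ρ σ (m ⊗ₜ σ a n) := by
  rw [Submodule.mkQ_apply, Submodule.mkQ_apply, Submodule.Quotient.eq]
  exact Submodule.subset_span ⟨a, m, n, rfl⟩

/-- The triple product `L ⊗_A L ⊗_A L`, where the left factor of each `⊗_A` is acted on through
`ρ` and the right factor through `σ`. -/
abbrev BalancedTensor₃ (ρ σ : A → M →ₗ[ℂ] M) : Type _ :=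
  (M ⊗[ℂ] (M ⊗[ℂ] M)) ⧸
    (Submodule.span ℂ {z : M ⊗[ℂ] (M ⊗[ℂ] M) |
        ∃ a x y w, z = ρ a x ⊗ₜ[ℂ] (y ⊗ₜ[ℂ] w) - x ⊗ₜ[ℂ] (σ a y ⊗ₜ[ℂ] w)} ⊔
      Submodule.span ℂ {z : M ⊗[ℂ] (M ⊗[ℂ] M) |
        ∃ a x y w, z = x ⊗ₜ[ℂ] (ρ a y ⊗ₜ[ℂ] w) - x ⊗ₜ[ℂ] (y ⊗ₜ[ℂ] σ a w)})

/-- The class of an element of `M ⊗ (M ⊗ M)`. -/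
abbrev BalancedTensor₃.mk (ρ σ : A → M →ₗ[ℂ] M) :
    M ⊗[ℂ] (M ⊗[ℂ] M) →ₗ[ℂ] BalancedTensor₃ ρ σ :=
  Submodule.mkQ _

theorem balanced₃Mk_eq_left (ρ σ : A → M →ₗ[ℂ] M) (a : A) (x y w : M) :
    BalancedTensor₃.mk ρ σ (ρ a x ⊗ₜ (y ⊗ₜ w)) = BalancedTensor₃.mk ρ σ (x ⊗ₜ (σ a y ⊗ₜ w)) := by
  rw [Submodule.mkQ_apply, Submodule.mkQ_apply, Submodule.Quotient.eq]
  exact Submodule.mem_sup_left (Submodule.subset_span ⟨a, x, y, w, rfl⟩)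

theorem balanced₃Mk_eq_right (ρ σ : A → M →ₗ[ℂ] M) (a : A) (x y w : M) :
    BalancedTensor₃.mk ρ σ (x ⊗ₜ (ρ a y ⊗ₜ w)) = BalancedTensor₃.mk ρ σ (x ⊗ₜ (y ⊗ₜ σ a w)) := by
  rw [Submodule.mkQ_apply, Submodule.mkQ_apply, Submodule.Quotient.eq]
  exact Submodule.mem_sup_right (Submodule.subset_span ⟨a, x, y, w, rfl⟩)

/-- `(x ⊗ y, w) ↦ x ⊗ y ⊗ w` as a map on `(L ⊗_A L) × L`. -/
def joinLeft (ρ σ : A → M →ₗ[ℂ] M) :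
    BalancedTensor ρ σ →ₗ[ℂ] M →ₗ[ℂ] BalancedTensor₃ ρ σ :=
  BalancedTensor.lift
    (TensorProduct.curry (BalancedTensor₃.mk ρ σ ∘ₗ (TensorProduct.assoc ℂ M M M).toLinearMap))
    (fun a x y => LinearMap.ext fun w => balanced₃Mk_eq_left ρ σ a x y w)

/-- `(y ⊗ w, x) ↦ x ⊗ y ⊗ w` as a map on `(L ⊗_A L) × L`. -/
def joinRight (ρ σ : A → M →ₗ[ℂ] M) :
    BalancedTensor ρ σ →ₗ[ℂ] M →ₗ[ℂ] BalancedTensor₃ ρ σ :=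
  BalancedTensor.lift (TensorProduct.curry (BalancedTensor₃.mk ρ σ)).flip
    (fun a y w => LinearMap.ext fun x => balanced₃Mk_eq_right ρ σ a x y w)

/-- `x ⊗ w ↦ Δ(x) ⊗ w`, with values in the triple balanced product. -/
def comulTensorId {ρ σ : A → M →ₗ[ℂ] M} (Δ : M →ₗ[ℂ] BalancedTensor ρ σ) :
    M ⊗[ℂ] M →ₗ[ℂ] BalancedTensor₃ ρ σ :=
  TensorProduct.lift (joinLeft ρ σ ∘ₗ Δ)

/-- `x ⊗ w ↦ x ⊗ Δ(w)`, with values in the triple balanced product. -/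
def idTensorComul {ρ σ : A → M →ₗ[ℂ] M} (Δ : M →ₗ[ℂ] BalancedTensor ρ σ) :
    M ⊗[ℂ] M →ₗ[ℂ] BalancedTensor₃ ρ σ :=
  TensorProduct.lift (joinRight ρ σ ∘ₗ Δ).flip

end Balanced

/-! ## Left and right bialgebroids

The axioms involving `Δ(X) = X₁ ⊗ X₂` are written for every representative `d ∈ L ⊗ L` of the
class `Δ(X) ∈ L ⊗_B L`; each side depends only on the class of `d`. -/

/-- A left bialgebroid `L` over `B`.  The `B`-bimodule structure of `L` is
`a . X . b = s a * t b * X`, and `L ⊗_B L` is formed with respect to it. -/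
@[ext]
structure LeftBialgebroid (B : Type*) (L : Type*) [Ring B] [Algebra ℂ B] [Ring L] [Algebra ℂ L]
    where
  /-- the source map, an algebra map -/
  s : B →ₐ[ℂ] L
  /-- the target map, an anti-algebra map -/
  t : B →ₗ[ℂ] L
  t_one : t 1 = 1
  t_mul : ∀ a b, t (a * b) = t b * t a
  s_comm_t : ∀ a b, s a * t b = t b * s a
  /-- the coproduct `L → L ⊗_B L` -/
  comul : L →ₗ[ℂ] BalancedTensor (fun a : B => LinearMap.mulLeft ℂ (t a))
    (fun a : B => LinearMap.mulLeft ℂ (s a))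
  /-- the counit `L → B` -/
  counit : L →ₗ[ℂ] B
  /-- `Δ` and `ε` are maps of `B`-bimodules -/
  comul_source : ∀ a X d, BalancedTensor.mk _ _ d = comul X →
    comul (s a * X) = BalancedTensor.mk _ _ ((s a ⊗ₜ 1) * d)
  comul_target : ∀ a X d, BalancedTensor.mk _ _ d = comul X →
    comul (t a * X) = BalancedTensor.mk _ _ ((1 ⊗ₜ t a) * d)
  counit_source : ∀ a X, counit (s a * X) = a * counit X
  counit_target : ∀ a X, counit (t a * X) = counit X * a
  /-- coassociativity, in `L ⊗_B L ⊗_B L` -/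
  coassoc : ∀ X d, BalancedTensor.mk _ _ d = comul X →
    comulTensorId comul d = idTensorComul comul d
  /-- `s (ε X₁) * X₂ = X` -/
  counit_comul : ∀ X d, BalancedTensor.mk _ _ d = comul X →
    LinearMap.mul' ℂ L (TensorProduct.map (s.toLinearMap ∘ₗ counit) LinearMap.id d) = X
  /-- `t (ε X₂) * X₁ = X` -/
  comul_counit : ∀ X d, BalancedTensor.mk _ _ d = comul X →
    LinearMap.mul' ℂ L (TensorProduct.map (t ∘ₗ counit) LinearMap.id
      (TensorProduct.comm ℂ L L d)) = X
  /-- `Δ` has its image in the Takeuchi product: `X₁ * t a ⊗ X₂ = X₁ ⊗ X₂ * s a` -/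
  comul_takeuchi : ∀ a X d, BalancedTensor.mk _ _ d = comul X →
    BalancedTensor.mk (fun a : B => LinearMap.mulLeft ℂ (t a))
      (fun a : B => LinearMap.mulLeft ℂ (s a)) (d * (t a ⊗ₜ 1)) =
    BalancedTensor.mk _ _ (d * (1 ⊗ₜ s a))
  /-- `Δ` is an algebra map -/
  comul_one : comul 1 = BalancedTensor.mk _ _ (1 ⊗ₜ 1)
  comul_mul : ∀ X Y d e, BalancedTensor.mk _ _ d = comul X → BalancedTensor.mk _ _ e = comul Y →
    comul (X * Y) = BalancedTensor.mk _ _ (d * e)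
  counit_one : counit 1 = 1
  counit_mul_source : ∀ X Y, counit (X * Y) = counit (X * s (counit Y))
  counit_mul_target : ∀ X Y, counit (X * Y) = counit (X * t (counit Y))

/-- A right bialgebroid `R` over `A`.  The `A`-bimodule structure of `R` is
`a . X . b = X * t a * s b`, and `R ⊗_A R` is formed with respect to it. -/
@[ext]
structure RightBialgebroid (A : Type*) (R : Type*) [Ring A] [Algebra ℂ A] [Ring R] [Algebra ℂ R]
    where
  /-- the source map, an algebra map -/
  s : A →ₐ[ℂ] R
  /-- the target map, an anti-algebra map -/
  t : A →ₗ[ℂ] R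
  t_one : t 1 = 1
  t_mul : ∀ a b, t (a * b) = t b * t a
  s_comm_t : ∀ a b, s a * t b = t b * s a
  /-- the coproduct `R → R ⊗_A R` -/
  comul : R →ₗ[ℂ] BalancedTensor (fun a : A => LinearMap.mulRight ℂ (s a))
    (fun a : A => LinearMap.mulRight ℂ (t a))
  /-- the counit `R → A` -/
  counit : R →ₗ[ℂ] A
  /-- `Δ` and `ε` are maps of `A`-bimodules -/
  comul_source : ∀ a X d, BalancedTensor.mk _ _ d = comul X →
    comul (X * s a) = BalancedTensor.mk _ _ (d * (1 ⊗ₜ s a))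
  comul_target : ∀ a X d, BalancedTensor.mk _ _ d = comul X →
    comul (X * t a) = BalancedTensor.mk _ _ (d * (t a ⊗ₜ 1))
  counit_source : ∀ a X, counit (X * s a) = counit X * a
  counit_target : ∀ a X, counit (X * t a) = a * counit X
  /-- coassociativity, in `R ⊗_A R ⊗_A R` -/
  coassoc : ∀ X d, BalancedTensor.mk _ _ d = comul X →
    comulTensorId comul d = idTensorComul comul d
  /-- `X₂ * t (ε X₁) = X` -/
  counit_comul : ∀ X d, BalancedTensor.mk _ _ d = comul X →
    LinearMap.mul' ℂ R (TensorProduct.map LinearMap.id (t ∘ₗ counit)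
      (TensorProduct.comm ℂ R R d)) = X
  /-- `X₁ * s (ε X₂) = X` -/
  comul_counit : ∀ X d, BalancedTensor.mk _ _ d = comul X →
    LinearMap.mul' ℂ R (TensorProduct.map LinearMap.id (s.toLinearMap ∘ₗ counit) d) = X
  /-- `Δ` has its image in the Takeuchi product: `s a * X₁ ⊗ X₂ = X₁ ⊗ t a * X₂` -/
  comul_takeuchi : ∀ a X d, BalancedTensor.mk _ _ d = comul X →
    BalancedTensor.mk (fun a : A => LinearMap.mulRight ℂ (s a))
      (fun a : A => LinearMap.mulRight ℂ (t a)) ((s a ⊗ₜ 1) * d) =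
    BalancedTensor.mk _ _ ((1 ⊗ₜ t a) * d)
  /-- `Δ` is an algebra map -/
  comul_one : comul 1 = BalancedTensor.mk _ _ (1 ⊗ₜ 1)
  comul_mul : ∀ X Y d e, BalancedTensor.mk _ _ d = comul X → BalancedTensor.mk _ _ e = comul Y →
    comul (X * Y) = BalancedTensor.mk _ _ (d * e)
  counit_one : counit 1 = 1
  counit_mul_source : ∀ X Y, counit (X * Y) = counit (s (counit X) * Y)
  counit_mul_target : ∀ X Y, counit (X * Y) = counit (t (counit X) * Y)

/-! ## The opposite of a left bialgebroid -/

section Op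

variable {B L : Type*} [Ring B] [Algebra ℂ B] [Ring L] [Algebra ℂ L]

/-- `x ⊗ y ↦ op x ⊗ op y`. -/
abbrev opTensor (L : Type*) [Ring L] [Algebra ℂ L] : L ⊗[ℂ] L ≃ₗ[ℂ] Lᵐᵒᵖ ⊗[ℂ] Lᵐᵒᵖ :=
  TensorProduct.congr (opLinearEquiv ℂ) (opLinearEquiv ℂ)

theorem opTensor_mul (d e : L ⊗[ℂ] L) :
    opTensor L (d * e) = opTensor L e * opTensor L d := by
  induction d with
  | zero => simp
  | add x y hx hy => simp only [add_mul, mul_add, map_add, hx, hy]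
  | tmul x y =>
    induction e with
    | zero => simp
    | add x y hx hy => simp only [add_mul, mul_add, map_add, hx, hy]
    | tmul z w => simp

namespace LeftBialgebroid

variable (𝓛 : LeftBialgebroid B L)

/-- `L ⊗_B L → L^op ⊗_B L^op`, the class of `x ⊗ y` going to that of `op x ⊗ op y`. -/
def opBalanced : BalancedTensor (fun a : B => LinearMap.mulLeft ℂ (𝓛.t a))
      (fun a : B => LinearMap.mulLeft ℂ (𝓛.s a)) →ₗ[ℂ]
    BalancedTensor (fun a : B => LinearMap.mulRight ℂ (op (𝓛.t a)))
      (fun a : B => LinearMap.mulRight ℂ (op (𝓛.s a))) :=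
  BalancedTensor.lift (BalancedTensor.mk _ _ ∘ₗ (opTensor L).toLinearMap)
    (fun a m n => balancedMk_eq (fun a : B => LinearMap.mulRight ℂ (op (𝓛.t a)))
      (fun a : B => LinearMap.mulRight ℂ (op (𝓛.s a))) a (op m) (op n))

/-- The inverse of `opBalanced`. -/
def unopBalanced : BalancedTensor (fun a : B => LinearMap.mulRight ℂ (op (𝓛.t a)))
      (fun a : B => LinearMap.mulRight ℂ (op (𝓛.s a))) →ₗ[ℂ]
    BalancedTensor (fun a : B => LinearMap.mulLeft ℂ (𝓛.t a))
      (fun a : B => LinearMap.mulLeft ℂ (𝓛.s a)) :=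
  BalancedTensor.lift (BalancedTensor.mk _ _ ∘ₗ (opTensor L).symm.toLinearMap)
    (fun a m n => balancedMk_eq (fun a : B => LinearMap.mulLeft ℂ (𝓛.t a))
      (fun a : B => LinearMap.mulLeft ℂ (𝓛.s a)) a (unop m) (unop n))

theorem opBalanced_mk (d : L ⊗[ℂ] L) :
    𝓛.opBalanced (BalancedTensor.mk _ _ d) = BalancedTensor.mk _ _ (opTensor L d) := rfl

theorem rep_of_op {X : L} {d : Lᵐᵒᵖ ⊗[ℂ] Lᵐᵒᵖ}
    (h : BalancedTensor.mk _ _ d = 𝓛.opBalanced (𝓛.comul X)) :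
    BalancedTensor.mk _ _ ((opTensor L).symm d) = 𝓛.comul X := by
  have h2 := congrArg 𝓛.unopBalanced h
  obtain ⟨e, he⟩ := Submodule.mkQ_surjective _ (𝓛.comul X)
  rw [← he] at h2 ⊢
  refine h2.trans ?_
  change BalancedTensor.mk _ _ ((opTensor L).symm (opTensor L e)) = _
  rw [LinearEquiv.symm_apply_apply]

/-- `L ⊗_B L ⊗_B L → L^op ⊗_B L^op ⊗_B L^op`. -/
def opBalanced₃ : BalancedTensor₃ (fun a : B => LinearMap.mulLeft ℂ (𝓛.t a))
      (fun a : B => LinearMap.mulLeft ℂ (𝓛.s a)) →ₗ[ℂ]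
    BalancedTensor₃ (fun a : B => LinearMap.mulRight ℂ (op (𝓛.t a)))
      (fun a : B => LinearMap.mulRight ℂ (op (𝓛.s a))) :=
  Submodule.liftQ _ (BalancedTensor₃.mk _ _ ∘ₗ
      (TensorProduct.congr (opLinearEquiv ℂ) (opTensor L)).toLinearMap) (by
    refine sup_le (Submodule.span_le.2 ?_) (Submodule.span_le.2 ?_)
    · rintro _ ⟨a, x, y, w, rfl⟩
      have := balanced₃Mk_eq_left (fun a : B => LinearMap.mulRight ℂ (op (𝓛.t a)))
        (fun a : B => LinearMap.mulRight ℂ (op (𝓛.s a))) a (op x) (op y) (op w)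
      exact (map_sub _ _ _).trans (sub_eq_zero.2 this)
    · rintro _ ⟨a, x, y, w, rfl⟩
      have := balanced₃Mk_eq_right (fun a : B => LinearMap.mulRight ℂ (op (𝓛.t a)))
        (fun a : B => LinearMap.mulRight ℂ (op (𝓛.s a))) a (op x) (op y) (op w)
      exact (map_sub _ _ _).trans (sub_eq_zero.2 this))

theorem comulTensorId_op (d : L ⊗[ℂ] L) :
    comulTensorId (𝓛.opBalanced ∘ₗ 𝓛.comul ∘ₗ (opLinearEquiv ℂ).symm.toLinearMap) (opTensor L d) =
      𝓛.opBalanced₃ (comulTensorId 𝓛.comul d) := by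
  induction d with
  | zero => simp
  | add x y hx hy => simp only [map_add, hx, hy]
  | tmul x y =>
    obtain ⟨e, he⟩ := Submodule.mkQ_surjective _ (𝓛.comul x)
    change joinLeft _ _ (𝓛.opBalanced (𝓛.comul x)) (op y) =
      𝓛.opBalanced₃ (joinLeft _ _ (𝓛.comul x) y)
    rw [← he]
    clear he
    induction e with
    | zero => simp
    | add x y hx hy => simp only [map_add, LinearMap.add_apply, hx, hy]
    | tmul p q => rfl

theorem idTensorComul_op (d : L ⊗[ℂ] L) :
    idTensorComul (𝓛.opBalanced ∘ₗ 𝓛.comul ∘ₗ (opLinearEquiv ℂ).symm.toLinearMap) (opTensor L d) =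
      𝓛.opBalanced₃ (idTensorComul 𝓛.comul d) := by
  induction d with
  | zero => simp
  | add x y hx hy => simp only [map_add, hx, hy]
  | tmul x y =>
    obtain ⟨e, he⟩ := Submodule.mkQ_surjective _ (𝓛.comul y)
    change joinRight _ _ (𝓛.opBalanced (𝓛.comul y)) (op x) =
      𝓛.opBalanced₃ (joinRight _ _ (𝓛.comul y) x)
    rw [← he]
    clear he
    induction e with
    | zero => simp
    | add x y hx hy => simp only [map_add, LinearMap.add_apply, hx, hy]
    | tmul p q => rfl

/-- The right bialgebroid `L^op` over `B`: the opposite algebra, with source `t`, target `s`, and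
with the coproduct and counit of `L`. -/
protected def op : RightBialgebroid B Lᵐᵒᵖ where
  s := AlgHom.ofLinearMap ((opLinearEquiv ℂ).toLinearMap ∘ₗ 𝓛.t)
    (congrArg op 𝓛.t_one) (fun a b => congrArg op (𝓛.t_mul a b))
  t := (opLinearEquiv ℂ).toLinearMap ∘ₗ 𝓛.s.toLinearMap
  t_one := congrArg op (map_one 𝓛.s)
  t_mul a b := congrArg op (map_mul 𝓛.s a b)
  s_comm_t a b := congrArg op (𝓛.s_comm_t b a)
  comul := 𝓛.opBalanced ∘ₗ 𝓛.comul ∘ₗ (opLinearEquiv ℂ).symm.toLinearMap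
  counit := 𝓛.counit ∘ₗ (opLinearEquiv ℂ).symm.toLinearMap
  comul_source a X d h := by
    have h1 := 𝓛.comul_target a (unop X) _ (𝓛.rep_of_op h)
    refine (congrArg 𝓛.opBalanced h1).trans ?_
    rw [opBalanced_mk, opTensor_mul, LinearEquiv.apply_symm_apply]
    rfl
  comul_target a X d h := by
    have h1 := 𝓛.comul_source a (unop X) _ (𝓛.rep_of_op h)
    refine (congrArg 𝓛.opBalanced h1).trans ?_
    rw [opBalanced_mk, opTensor_mul, LinearEquiv.apply_symm_apply]
    rfl
  counit_source a X := 𝓛.counit_target a (unop X)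
  counit_target a X := 𝓛.counit_source a (unop X)
  coassoc X d h := by
    have h1 := congrArg 𝓛.opBalanced₃ (𝓛.coassoc (unop X) _ (𝓛.rep_of_op h))
    rw [← comulTensorId_op, ← idTensorComul_op, LinearEquiv.apply_symm_apply] at h1
    exact h1
  counit_comul X d h := by
    have h1 := congrArg op (𝓛.counit_comul (unop X) _ (𝓛.rep_of_op h))
    refine Eq.trans ?_ h1
    clear h h1
    induction d with
    | zero => simp
    | add x y hx hy => simp only [map_add, op_add, hx, hy]
    | tmul p q => rfl
  comul_counit X d h := by
    have h1 := congrArg op (𝓛.comul_counit (unop X) _ (𝓛.rep_of_op h))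
    refine Eq.trans ?_ h1
    clear h h1
    induction d with
    | zero => simp
    | add x y hx hy => simp only [map_add, op_add, hx, hy]
    | tmul p q => rfl
  comul_takeuchi a X d h := by
    have h1 := congrArg 𝓛.opBalanced (𝓛.comul_takeuchi a (unop X) _ (𝓛.rep_of_op h))
    rw [opBalanced_mk, opBalanced_mk, opTensor_mul, opTensor_mul,
      LinearEquiv.apply_symm_apply] at h1
    exact h1
  comul_one := congrArg 𝓛.opBalanced 𝓛.comul_one
  comul_mul X Y d e hd he := by
    have h1 := 𝓛.comul_mul (unop Y) (unop X) _ _ (𝓛.rep_of_op he) (𝓛.rep_of_op hd)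
    refine (congrArg 𝓛.opBalanced h1).trans ?_
    rw [opBalanced_mk, opTensor_mul, LinearEquiv.apply_symm_apply, LinearEquiv.apply_symm_apply]
    rfl
  counit_one := 𝓛.counit_one
  counit_mul_source X Y := 𝓛.counit_mul_target (unop Y) (unop X)
  counit_mul_target X Y := 𝓛.counit_mul_source (unop Y) (unop X)

/-! ## Left and anti-left Hopf algebroids -/

/-- `x ⊗ y ↦ x * V ⊗ y * Y` on `L ⊗_B L`. -/
def mulBoth (V Y : L) : BalancedTensor (fun a : B => LinearMap.mulLeft ℂ (𝓛.t a))
      (fun a : B => LinearMap.mulLeft ℂ (𝓛.s a)) →ₗ[ℂ]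
    BalancedTensor (fun a : B => LinearMap.mulLeft ℂ (𝓛.t a))
      (fun a : B => LinearMap.mulLeft ℂ (𝓛.s a)) :=
  BalancedTensor.lift (BalancedTensor.mk _ _ ∘ₗ
      TensorProduct.map (LinearMap.mulRight ℂ V) (LinearMap.mulRight ℂ Y)) (by
    intro a m n
    have := balancedMk_eq (fun a : B => LinearMap.mulLeft ℂ (𝓛.t a))
      (fun a : B => LinearMap.mulLeft ℂ (𝓛.s a)) a (m * V) (n * Y)
    simpa [mul_assoc] using this)

theorem mulBoth_mk (V Y : L) (d : L ⊗[ℂ] L) :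
    𝓛.mulBoth V Y (BalancedTensor.mk _ _ d) = BalancedTensor.mk _ _ (d * (V ⊗ₜ Y)) := by
  change BalancedTensor.mk _ _ (TensorProduct.map (LinearMap.mulRight ℂ V)
    (LinearMap.mulRight ℂ Y) d) = _
  congr 1
  induction d with
  | zero => simp
  | add x y hx hy => simp only [map_add, add_mul, hx, hy]
  | tmul p q => simp

theorem comul_mul_target (X : L) (a : B) : 𝓛.comul (X * 𝓛.t a) = 𝓛.mulBoth 1 (𝓛.t a) (𝓛.comul X) := by
  obtain ⟨d, hd⟩ := Submodule.mkQ_surjective _ (𝓛.comul X)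
  have h1 := 𝓛.comul_target a 1 _ 𝓛.comul_one.symm
  rw [mul_one] at h1
  rw [𝓛.comul_mul X _ d _ hd h1.symm, ← hd, mulBoth_mk]
  simp

theorem comul_mul_source (X : L) (a : B) : 𝓛.comul (X * 𝓛.s a) = 𝓛.mulBoth (𝓛.s a) 1 (𝓛.comul X) := by
  obtain ⟨d, hd⟩ := Submodule.mkQ_surjective _ (𝓛.comul X)
  have h1 := 𝓛.comul_source a 1 _ 𝓛.comul_one.symm
  rw [mul_one] at h1
  rw [𝓛.comul_mul X _ d _ hd h1.symm, ← hd, mulBoth_mk]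
  simp

theorem mulBoth_mulBoth (V Y V' Y' : L) (z) :
    𝓛.mulBoth V' Y' (𝓛.mulBoth V Y z) = 𝓛.mulBoth (V * V') (Y * Y') z := by
  obtain ⟨d, rfl⟩ := Submodule.mkQ_surjective _ z
  simp only [mulBoth_mk, mul_assoc, Algebra.TensorProduct.tmul_mul_tmul]

/-- `X ⊗ Y ↦ X₁ ⊗ X₂ * Y` on `L ⊗ L`. -/
def preLambda : L ⊗[ℂ] L →ₗ[ℂ] BalancedTensor (fun a : B => LinearMap.mulLeft ℂ (𝓛.t a))
      (fun a : B => LinearMap.mulLeft ℂ (𝓛.s a)) :=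
  TensorProduct.lift (LinearMap.mk₂ ℂ (fun X Y => 𝓛.mulBoth 1 Y (𝓛.comul X))
    (fun X X' Y => by simp) (fun c X Y => by simp)
    (fun X Y Y' => by
      obtain ⟨d, hd⟩ := Submodule.mkQ_surjective _ (𝓛.comul X)
      simp only [← hd, mulBoth_mk, TensorProduct.tmul_add, mul_add, map_add])
    (fun c X Y => by
      obtain ⟨d, hd⟩ := Submodule.mkQ_surjective _ (𝓛.comul X)
      simp only [← hd, mulBoth_mk, TensorProduct.tmul_smul, mul_smul_comm, map_smul]))

/-- `X ⊗ Y ↦ Y₁ * X ⊗ Y₂` on `L ⊗ L`. -/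
def preMu : L ⊗[ℂ] L →ₗ[ℂ] BalancedTensor (fun a : B => LinearMap.mulLeft ℂ (𝓛.t a))
      (fun a : B => LinearMap.mulLeft ℂ (𝓛.s a)) :=
  TensorProduct.lift (LinearMap.mk₂ ℂ (fun X Y => 𝓛.mulBoth X 1 (𝓛.comul Y))
    (fun X X' Y => by
      obtain ⟨d, hd⟩ := Submodule.mkQ_surjective _ (𝓛.comul Y)
      simp only [← hd, mulBoth_mk, TensorProduct.add_tmul, mul_add, map_add])
    (fun c X Y => by
      obtain ⟨d, hd⟩ := Submodule.mkQ_surjective _ (𝓛.comul Y)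
      simp only [← hd, mulBoth_mk, ← TensorProduct.smul_tmul', mul_smul_comm, map_smul])
    (fun X Y Y' => by simp) (fun c X Y => by simp))

/-- The Galois map `λ : L ⊗_{B^op} L → L ⊗_B L`, `X ⊗ Y ↦ X₁ ⊗ X₂ * Y`, where
`X * t a ⊗ Y = X ⊗ t a * Y` in the source. -/
def galoisLambda : BalancedTensor (fun a : B => LinearMap.mulRight ℂ (𝓛.t a))
      (fun a : B => LinearMap.mulLeft ℂ (𝓛.t a)) →ₗ[ℂ]
    BalancedTensor (fun a : B => LinearMap.mulLeft ℂ (𝓛.t a))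
      (fun a : B => LinearMap.mulLeft ℂ (𝓛.s a)) :=
  BalancedTensor.lift 𝓛.preLambda (by
    intro a X Y
    change 𝓛.mulBoth 1 Y (𝓛.comul (X * 𝓛.t a)) = 𝓛.mulBoth 1 (𝓛.t a * Y) (𝓛.comul X)
    rw [comul_mul_target, mulBoth_mulBoth, one_mul])

/-- The Galois map `μ : L ⊗^B L → L ⊗_B L`, `X ⊗ Y ↦ Y₁ * X ⊗ Y₂`, where
`s a * X ⊗ Y = X ⊗ Y * s a` in the source. -/
def galoisMu : BalancedTensor (fun a : B => LinearMap.mulLeft ℂ (𝓛.s a))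
      (fun a : B => LinearMap.mulRight ℂ (𝓛.s a)) →ₗ[ℂ]
    BalancedTensor (fun a : B => LinearMap.mulLeft ℂ (𝓛.t a))
      (fun a : B => LinearMap.mulLeft ℂ (𝓛.s a)) :=
  BalancedTensor.lift 𝓛.preMu (by
    intro a X Y
    change 𝓛.mulBoth (𝓛.s a * X) 1 (𝓛.comul Y) = 𝓛.mulBoth X 1 (𝓛.comul (Y * 𝓛.s a))
    rw [comul_mul_source, mulBoth_mulBoth, one_mul])

/-- `L` is a left Hopf algebroid. -/
def IsLeftHopf : Prop := Function.Bijective 𝓛.galoisLambda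

/-- `L` is an anti-left Hopf algebroid. -/
def IsAntiLeftHopf : Prop := Function.Bijective 𝓛.galoisMu

end LeftBialgebroid

end Op

/-! ## `*`-Hopf algebroid pairs -/

section Pairs

variable {A L R : Type*} [Ring A] [Algebra ℂ A] [StarRing A] [StarModule ℂ A]
  [Ring L] [Algebra ℂ L] [Ring R] [Algebra ℂ R]

/-- `(L, R)` are `*`-related by the bijective antilinear map `circ`. -/
structure IsStarRelated (𝓛 : LeftBialgebroid A L) (𝓡 : RightBialgebroid A R)
    (circ : L ≃ₛₗ[starRingEnd ℂ] R) : Prop where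
  map_one : circ 1 = 1
  map_mul : ∀ X Y, circ (X * Y) = circ Y * circ X
  source : ∀ a, 𝓡.s (star a) = circ (𝓛.s a)
  target : ∀ a, 𝓡.t (star a) = circ (𝓛.t a)
  /-- `flip ((circ ⊗ circ) (Δ X)) = Δ (circ X)` -/
  comul : ∀ X d, BalancedTensor.mk _ _ d = 𝓛.comul X →
    BalancedTensor.mk _ _ (TensorProduct.comm ℂ R R
      (TensorProduct.map (circ : L →ₛₗ[starRingEnd ℂ] R) (circ : L →ₛₗ[starRingEnd ℂ] R) d)) =
    𝓡.comul (circ X)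
  counit : ∀ X, 𝓡.counit (circ X) = star (𝓛.counit X)

/-- `(L, R)` is reflexive by the bijective linear map `Φ`, which is an anti-algebra map and a
coalgebra map that exchanges sources and targets. -/
structure IsReflexive (𝓛 : LeftBialgebroid A L) (𝓡 : RightBialgebroid A R)
    (Φ : L ≃ₗ[ℂ] R) : Prop where
  map_one : Φ 1 = 1
  map_mul : ∀ X Y, Φ (X * Y) = Φ Y * Φ X
  source : ∀ a, Φ (𝓛.s a) = 𝓡.t a
  target : ∀ a, Φ (𝓛.t a) = 𝓡.s a
  /-- `(Φ ⊗ Φ) (Δ X) = Δ (Φ X)` -/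
  comul : ∀ X d, BalancedTensor.mk _ _ d = 𝓛.comul X →
    BalancedTensor.mk _ _ (TensorProduct.map Φ.toLinearMap Φ.toLinearMap d) = 𝓡.comul (Φ X)
  counit : ∀ X, 𝓡.counit (Φ X) = 𝓛.counit X

/-- `*`-bialgebroid pairs. -/
structure IsStarBialgebroidPair (𝓛 : LeftBialgebroid A L) (𝓡 : RightBialgebroid A R)
    (circ : L ≃ₛₗ[starRingEnd ℂ] R) (Φ : L ≃ₗ[ℂ] R) : Prop where
  starRelated : IsStarRelated 𝓛 𝓡 circ
  reflexive : IsReflexive 𝓛 𝓡 Φ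
  /-- `Φ⁻¹ ∘ circ = circ⁻¹ ∘ Φ` -/
  compat : ∀ X, Φ.symm (circ X) = circ.symm (Φ X)

/-- `*`-Hopf algebroid pairs. -/
structure IsStarHopfAlgebroidPair (𝓛 : LeftBialgebroid A L) (𝓡 : RightBialgebroid A R)
    (circ : L ≃ₛₗ[starRingEnd ℂ] R) (Φ : L ≃ₗ[ℂ] R) : Prop extends
    IsStarBialgebroidPair 𝓛 𝓡 circ Φ where
  leftHopf : 𝓛.IsLeftHopf
  antiLeftHopf : 𝓛.IsAntiLeftHopf

end Pairs

/-! ## Hopf `*`-algebras, comodule algebras, Hopf-Galois extensions -/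

/-- A Hopf `*`-algebra: a complex Hopf algebra that is a `*`-algebra, with `Δ` and `ε`
`*`-preserving and `(S ∘ *)² = id`. -/
class IsHopfStarAlgebra (H : Type*) [Ring H] [HopfAlgebra ℂ H] [StarRing H] [StarModule ℂ H] :
    Prop where
  comul_star : ∀ h : H, Coalgebra.comul (R := ℂ) (star h) = star (Coalgebra.comul (R := ℂ) h)
  counit_star : ∀ h : H, Coalgebra.counit (R := ℂ) (star h) = star (Coalgebra.counit (R := ℂ) h)
  antipode_star : ∀ h : H,
    HopfAlgebra.antipode ℂ (star (HopfAlgebra.antipode ℂ (star h))) = h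

/-- `P` is a right `H`-comodule algebra. -/
class ComoduleAlgebra (H P : Type*) [Ring H] [HopfAlgebra ℂ H] [Ring P] [Algebra ℂ P] where
  /-- the coaction `p ↦ p₀ ⊗ p₁`, an algebra map -/
  coact : P →ₐ[ℂ] P ⊗[ℂ] H
  coact_coassoc : ∀ p, TensorProduct.assoc ℂ P H H (coact.toLinearMap.rTensor H (coact p)) =
    (Coalgebra.comul (R := ℂ) (A := H)).lTensor P (coact p)
  coact_counit : ∀ p, TensorProduct.rid ℂ P
    ((Coalgebra.counit (R := ℂ) (A := H)).lTensor P (coact p)) = p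

/-- The coaction is unitary: `(p*)₀ ⊗ (p*)₁ = (p₀)* ⊗ (p₁)*`. -/
class IsUnitaryCoaction (H P : Type*) [Ring H] [HopfAlgebra ℂ H] [StarRing H] [StarModule ℂ H]
    [Ring P] [Algebra ℂ P] [StarRing P] [StarModule ℂ P] [ComoduleAlgebra H P] : Prop where
  coact_star : ∀ p : P, ComoduleAlgebra.coact (H := H) (star p) =
    star (ComoduleAlgebra.coact (H := H) p)

section FaithfullyFlat

variable (B : Type*) [Ring B] [Algebra ℂ B]

/-- `M ⊗_B P` for a right `B`-module `M` and a left `B`-module `P`. -/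
abbrev ModuleTensor (M : Type*) [AddCommGroup M] [Module ℂ M] [Module Bᵐᵒᵖ M]
    [IsScalarTower ℂ Bᵐᵒᵖ M] (P : Type*) [AddCommGroup P] [Module ℂ P] [Module B P]
    [IsScalarTower ℂ B P] : Type _ :=
  BalancedTensor (fun b : B => Algebra.lsmul ℂ ℂ M (op b)) (fun b : B => Algebra.lsmul ℂ ℂ P b)

/-- `f ⊗_B id : M ⊗_B P → N ⊗_B P`. -/
def ModuleTensor.rTensor {M N : Type*} [AddCommGroup M] [Module ℂ M] [Module Bᵐᵒᵖ M]
    [IsScalarTower ℂ Bᵐᵒᵖ M] [AddCommGroup N] [Module ℂ N] [Module Bᵐᵒᵖ N]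
    [IsScalarTower ℂ Bᵐᵒᵖ N] (P : Type*) [AddCommGroup P] [Module ℂ P] [Module B P]
    [IsScalarTower ℂ B P] (f : M →ₗ[Bᵐᵒᵖ] N) : ModuleTensor B M P →ₗ[ℂ] ModuleTensor B N P :=
  BalancedTensor.lift (BalancedTensor.mk _ _ ∘ₗ (f.restrictScalars ℂ).rTensor P) (by
    intro b m p
    have := balancedMk_eq (fun b : B => Algebra.lsmul ℂ ℂ N (op b))
      (fun b : B => (Algebra.lsmul ℂ ℂ P b : P →ₗ[ℂ] P)) b (f m) p
    simpa using this)

/-- `P` is faithfully flat as a left `B`-module: `- ⊗_B P` preserves injections of right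
`B`-modules and does not kill any nonzero right `B`-module. -/
def IsFaithfullyFlat (P : Type*) [AddCommGroup P] [Module ℂ P] [Module B P]
    [IsScalarTower ℂ B P] : Prop :=
  (∀ (M N : Type w) [AddCommGroup M] [Module ℂ M] [Module Bᵐᵒᵖ M] [IsScalarTower ℂ Bᵐᵒᵖ M]
    [AddCommGroup N] [Module ℂ N] [Module Bᵐᵒᵖ N] [IsScalarTower ℂ Bᵐᵒᵖ N] (f : M →ₗ[Bᵐᵒᵖ] N),
    Function.Injective f → Function.Injective (ModuleTensor.rTensor B P f)) ∧
  (∀ (M : Type w) [AddCommGroup M] [Module ℂ M] [Module Bᵐᵒᵖ M] [IsScalarTower ℂ Bᵐᵒᵖ M],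
    Nontrivial M → Nontrivial (ModuleTensor B M P))

end FaithfullyFlat

section Galois

variable (H : Type v) (P : Type u) [Ring H] [HopfAlgebra ℂ H] [Ring P] [Algebra ℂ P]
  [ComoduleAlgebra H P]

/-- The coinvariant subalgebra `B = P^{co H}`. -/
def coinvariants : Subalgebra ℂ P :=
  AlgHom.equalizer (ComoduleAlgebra.coact (H := H) (P := P)) Algebra.TensorProduct.includeLeft

theorem mem_coinvariants {p : P} :
    p ∈ coinvariants H P ↔ ComoduleAlgebra.coact (H := H) p = p ⊗ₜ 1 := Iff.rfl

/-- `P ⊗_B P` for `B = P^{co H}`: `p * b ⊗ q = p ⊗ b * q`. -/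
abbrev GaloisTensor : Type _ :=
  BalancedTensor (fun b : coinvariants H P => LinearMap.mulRight ℂ (b : P))
    (fun b : coinvariants H P => LinearMap.mulLeft ℂ (b : P))

/-- The canonical map `χ : P ⊗_B P → P ⊗ H`, `q ⊗ p ↦ q * p₀ ⊗ p₁`. -/
def canonicalMap : GaloisTensor H P →ₗ[ℂ] P ⊗[ℂ] H :=
  BalancedTensor.lift
    (LinearMap.mul' ℂ (P ⊗[ℂ] H) ∘ₗ TensorProduct.map
      (Algebra.TensorProduct.includeLeft : P →ₐ[ℂ] P ⊗[ℂ] H).toLinearMap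
      (ComoduleAlgebra.coact (H := H) (P := P)).toLinearMap)
    (by
      intro b q p
      have hb := (mem_coinvariants H P).1 b.2
      simp [hb, ← mul_assoc])

/-- `P^{co H} ⊆ P` is an `H`-Galois extension. -/
def IsHopfGalois : Prop := Function.Bijective (canonicalMap H P)

variable {H P}

/-- The translation map `τ(h) = χ⁻¹(1 ⊗ h)`. -/
def translationMap (hG : IsHopfGalois H P) : H →ₗ[ℂ] GaloisTensor H P :=
  (LinearEquiv.ofBijective (canonicalMap H P) hG).symm.toLinearMap ∘ₗ TensorProduct.mk ℂ P H 1

end Galois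

section StarCoinvariants

variable (H : Type v) (P : Type u) [Ring H] [HopfAlgebra ℂ H] [StarRing H] [StarModule ℂ H]
  [Ring P] [Algebra ℂ P] [StarRing P] [StarModule ℂ P] [ComoduleAlgebra H P]
  [IsUnitaryCoaction H P]

/-- For a unitary coaction, `P^{co H}` is a `*`-subalgebra of `P`. -/
instance : StarRing (coinvariants H P) where
  star b := ⟨star (b : P), by
    rw [mem_coinvariants, IsUnitaryCoaction.coact_star, (mem_coinvariants H P).1 b.2]
    simp⟩
  star_involutive b := Subtype.ext (star_star (b : P))
  star_mul a b := Subtype.ext (star_mul (a : P) (b : P))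
  star_add a b := Subtype.ext (star_add (a : P) (b : P))

instance : StarModule ℂ (coinvariants H P) where
  star_smul c b := Subtype.ext (star_smul c (b : P))

end StarCoinvariants

/-! ## The Ehresmann-Schauenburg bialgebroid

`P ⊗ P` with the product `(p ⊗ q) (r ⊗ u) = p r ⊗ u q` is `P ⊗ Pᵐᵒᵖ`; the element `p ⊗ q` is
written `p ⊗ₜ op q`. -/

section EhresmannSchauenburg

set_option linter.unusedSectionVars false

variable (H : Type v) (P : Type u) [Ring H] [HopfAlgebra ℂ H] [Ring P] [Algebra ℂ P]
  [ComoduleAlgebra H P]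

/-- `(p₀ ⊗ p₁) ⊗ (q₀ ⊗ q₁) ↦ (p₀ ⊗ q₀) ⊗ p₁ * q₁`. -/
def diagonalMul : (P ⊗[ℂ] H) ⊗[ℂ] (P ⊗[ℂ] H) →ₗ[ℂ] (P ⊗[ℂ] Pᵐᵒᵖ) ⊗[ℂ] H :=
  TensorProduct.map (TensorProduct.map LinearMap.id (opLinearEquiv ℂ).toLinearMap)
      (LinearMap.mul' ℂ H) ∘ₗ
    (TensorProduct.tensorTensorTensorComm ℂ P H P H).toLinearMap

/-- The diagonal coaction `p ⊗ q ↦ p₀ ⊗ q₀ ⊗ p₁ * q₁`. -/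
def diagonalCoact : P ⊗[ℂ] Pᵐᵒᵖ →ₗ[ℂ] (P ⊗[ℂ] Pᵐᵒᵖ) ⊗[ℂ] H :=
  diagonalMul H P ∘ₗ
    TensorProduct.map (ComoduleAlgebra.coact (H := H)).toLinearMap
      ((ComoduleAlgebra.coact (H := H)).toLinearMap ∘ₗ (opLinearEquiv ℂ).symm.toLinearMap)


/-- For `u = p ⊗ h` and `v = q ⊗ k`, the map `x ⊗ l ↦ (p ⊗ q) x ⊗ h l k`. -/
def sandwich : (P ⊗[ℂ] H) ⊗[ℂ] (P ⊗[ℂ] H) →ₗ[ℂ] Module.End ℂ ((P ⊗[ℂ] Pᵐᵒᵖ) ⊗[ℂ] H) :=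
  TensorProduct.homTensorHomMap (RingHom.id ℂ) _ _ _ _ ∘ₗ
    TensorProduct.map (LinearMap.mul ℂ (P ⊗[ℂ] Pᵐᵒᵖ)) (AlgHom.mulLeftRight ℂ H).toLinearMap ∘ₗ
    TensorProduct.map (TensorProduct.map LinearMap.id (opLinearEquiv ℂ).toLinearMap)
      (TensorProduct.map LinearMap.id (opLinearEquiv ℂ).toLinearMap) ∘ₗ
    (TensorProduct.tensorTensorTensorComm ℂ P H P H).toLinearMap

theorem sandwich_diagonalMul (u v u' v' : P ⊗[ℂ] H) :
    sandwich H P (u ⊗ₜ v) (diagonalMul H P (u' ⊗ₜ v')) =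
      diagonalMul H P ((u * u') ⊗ₜ (v' * v)) := by
  induction u with
  | zero => simp
  | add x y hx hy => simp only [TensorProduct.add_tmul, map_add, LinearMap.add_apply, add_mul, hx, hy]
  | tmul p h =>
  induction v with
  | zero => simp
  | add x y hx hy =>
    simp only [TensorProduct.tmul_add, map_add, LinearMap.add_apply, mul_add, hx, hy]
  | tmul q k =>
  induction u' with
  | zero => simp
  | add x y hx hy => simp only [TensorProduct.add_tmul, map_add, mul_add, hx, hy]
  | tmul p' h' =>
  induction v' with
  | zero => simp
  | add x y hx hy => simp only [TensorProduct.tmul_add, map_add, add_mul, hx, hy]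
  | tmul q' k' => simp [sandwich, diagonalMul, mul_assoc]

theorem sandwich_tmul_one (z : (P ⊗[ℂ] H) ⊗[ℂ] (P ⊗[ℂ] H)) (w : P ⊗[ℂ] Pᵐᵒᵖ) :
    sandwich H P z (w ⊗ₜ 1) =
      LinearMap.rTensor H (LinearMap.mulRight ℂ w) (diagonalMul H P z) := by
  induction z with
  | zero => simp
  | add x y hx hy => simp only [map_add, LinearMap.add_apply, hx, hy]
  | tmul u v =>
  induction u with
  | zero => simp
  | add x y hx hy => simp only [TensorProduct.add_tmul, map_add, LinearMap.add_apply, hx, hy]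
  | tmul p h =>
  induction v with
  | zero => simp
  | add x y hx hy => simp only [TensorProduct.tmul_add, map_add, LinearMap.add_apply, hx, hy]
  | tmul q k => simp [sandwich, diagonalMul]

theorem diagonalCoact_tmul (p : P) (q : Pᵐᵒᵖ) :
    diagonalCoact H P (p ⊗ₜ q) = diagonalMul H P
      (ComoduleAlgebra.coact (H := H) p ⊗ₜ ComoduleAlgebra.coact (H := H) (unop q)) := rfl

theorem diagonalCoact_tmul_mul (p : P) (q : Pᵐᵒᵖ) (w : P ⊗[ℂ] Pᵐᵒᵖ) :
    diagonalCoact H P ((p ⊗ₜ q) * w) = sandwich H P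
      (ComoduleAlgebra.coact (H := H) p ⊗ₜ ComoduleAlgebra.coact (H := H) (unop q))
      (diagonalCoact H P w) := by
  induction w with
  | zero => simp
  | add x y hx hy => simp only [mul_add, map_add, hx, hy]
  | tmul r u =>
    rw [Algebra.TensorProduct.tmul_mul_tmul, diagonalCoact_tmul, diagonalCoact_tmul,
      sandwich_diagonalMul, unop_mul, map_mul, map_mul]

theorem diagonalCoact_mul (z w : P ⊗[ℂ] Pᵐᵒᵖ) (hw : diagonalCoact H P w = w ⊗ₜ 1) :
    diagonalCoact H P (z * w) = LinearMap.rTensor H (LinearMap.mulRight ℂ w)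
      (diagonalCoact H P z) := by
  induction z with
  | zero => simp
  | add x y hx hy => simp only [add_mul, map_add, hx, hy]
  | tmul p q => rw [diagonalCoact_tmul_mul, hw, sandwich_tmul_one, diagonalCoact_tmul]

/-- The algebra `𝓛(P, H) = (P ⊗ P)^{co H}`, a subalgebra of `P ⊗ Pᵐᵒᵖ`. -/
def ehresmannSchauenburg : Subalgebra ℂ (P ⊗[ℂ] Pᵐᵒᵖ) where
  carrier := {X | diagonalCoact H P X = X ⊗ₜ 1}
  mul_mem' {z w} hz hw := by
    have hz' : diagonalCoact H P z = z ⊗ₜ 1 := hz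
    change diagonalCoact H P (z * w) = _
    rw [diagonalCoact_mul H P z w hw, hz', LinearMap.rTensor_tmul, LinearMap.mulRight_apply]
  add_mem' {z w} hz hw := by
    have hz' : diagonalCoact H P z = z ⊗ₜ 1 := hz
    have hw' : diagonalCoact H P w = w ⊗ₜ 1 := hw
    change diagonalCoact H P (z + w) = _
    rw [map_add, hz', hw', TensorProduct.add_tmul]
  algebraMap_mem' c := by
    change diagonalCoact H P _ = _
    rw [Algebra.algebraMap_eq_smul_one, map_smul, Algebra.TensorProduct.one_def,
      diagonalCoact_tmul, unop_one, map_one, Algebra.TensorProduct.one_def]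
    simp [diagonalMul, TensorProduct.smul_tmul']

/-- `(p ⊗ q) ⊗ (r ⊗ u) ↦ p ⊗ [q ⊗ r] ⊗ u`, with `[q ⊗ r]` the class in `P ⊗_B P`. -/
def joinMiddle : (P ⊗[ℂ] Pᵐᵒᵖ) ⊗[ℂ] (P ⊗[ℂ] Pᵐᵒᵖ) →ₗ[ℂ] P ⊗[ℂ] (GaloisTensor H P ⊗[ℂ] Pᵐᵒᵖ) :=
  LinearMap.lTensor P
      (LinearMap.rTensor Pᵐᵒᵖ
          (BalancedTensor.mk _ _ ∘ₗ LinearMap.rTensor P (opLinearEquiv ℂ).symm.toLinearMap) ∘ₗ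
        (TensorProduct.assoc ℂ Pᵐᵒᵖ P Pᵐᵒᵖ).symm.toLinearMap) ∘ₗ
    (TensorProduct.assoc ℂ P Pᵐᵒᵖ (P ⊗[ℂ] Pᵐᵒᵖ)).toLinearMap

variable {H P}

/-- `p ⊗ q ↦ p₀ ⊗ τ(p₁) ⊗ q`. -/
def coproductFormula (hG : IsHopfGalois H P) :
    P ⊗[ℂ] Pᵐᵒᵖ →ₗ[ℂ] P ⊗[ℂ] (GaloisTensor H P ⊗[ℂ] Pᵐᵒᵖ) :=
  (TensorProduct.assoc ℂ P (GaloisTensor H P) Pᵐᵒᵖ).toLinearMap ∘ₗ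
    LinearMap.rTensor Pᵐᵒᵖ (LinearMap.lTensor P (translationMap hG) ∘ₗ
      (ComoduleAlgebra.coact (H := H)).toLinearMap)

variable (P) in
/-- `p ⊗ q ↦ p * q`. -/
def counitFormula : P ⊗[ℂ] Pᵐᵒᵖ →ₗ[ℂ] P :=
  LinearMap.mul' ℂ P ∘ₗ LinearMap.lTensor P (opLinearEquiv ℂ).symm.toLinearMap

/-- The left bialgebroid structure `𝓛` on `(P ⊗ P)^{co H}` is the Ehresmann-Schauenburg one:
`s b = b ⊗ 1`, `t b = 1 ⊗ b`, `ε(p ⊗ q) = p q` and `Δ(p ⊗ q) = p₀ ⊗ τ(p₁) ⊗ q`. -/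
structure IsEhresmannSchauenburg (hG : IsHopfGalois H P)
    (𝓛 : LeftBialgebroid (coinvariants H P) (ehresmannSchauenburg H P)) : Prop where
  source : ∀ b, (𝓛.s b : P ⊗[ℂ] Pᵐᵒᵖ) = (b : P) ⊗ₜ 1
  target : ∀ b, (𝓛.t b : P ⊗[ℂ] Pᵐᵒᵖ) = 1 ⊗ₜ op (b : P)
  counit : ∀ X, (𝓛.counit X : P) = counitFormula P X
  /-- the image of `Δ(X) ∈ L ⊗_B L` in `P ⊗ (P ⊗_B P) ⊗ P` is given by the formula -/
  comul : ∀ X d, BalancedTensor.mk _ _ d = 𝓛.comul X →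
    joinMiddle H P (TensorProduct.map (ehresmannSchauenburg H P).val.toLinearMap
      (ehresmannSchauenburg H P).val.toLinearMap d) = coproductFormula hG X

end EhresmannSchauenburg

/-- The antilinear map `p ⊗ q ↦ q* ⊗ p*`. -/
def starFlip (P : Type u) [Ring P] [Algebra ℂ P] [StarRing P] [StarModule ℂ P] :
    P ⊗[ℂ] Pᵐᵒᵖ →ₛₗ[starRingEnd ℂ] P ⊗[ℂ] Pᵐᵒᵖ :=
  (TensorProduct.map (opLinearEquiv ℂ).symm.toLinearMap (opLinearEquiv ℂ).toLinearMap ∘ₗ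
    (TensorProduct.comm ℂ P Pᵐᵒᵖ).toLinearMap).comp
    (TensorProduct.map
      (starLinearEquiv ℂ : P ≃ₛₗ[starRingEnd ℂ] P).toLinearMap
      (starLinearEquiv ℂ : Pᵐᵒᵖ ≃ₛₗ[starRingEnd ℂ] Pᵐᵒᵖ).toLinearMap)

@[simp]
theorem starFlip_tmul (P : Type u) [Ring P] [Algebra ℂ P] [StarRing P] [StarModule ℂ P] (p q : P) :
    starFlip P (p ⊗ₜ op q) = star q ⊗ₜ op (star p) := rfl

end HopfPair

end

open HopfPair

/-! Everything is moved into tensor powers of `P` by faithfully flat descent along `B ⊆ P`. Let `V`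
be a right `H`-comodule and give `V ⊗ P` the diagonal coaction. If `f : M → V ⊗ P` is a map of right
`B`-modules with coinvariant values, then the coaction applied to `f m * x` only sees `x`. So the
action map `M ⊗_B P → V ⊗ P` followed by the coaction is `f ⊗_B id` followed by the canonical map
`χ` on the last two legs (`diag_actMap`). Since `χ` is bijective and `P` is flat, the action map is
injective whenever `f` is. If, conversely, the action map is bijective, then faithfulness forces `f`
to be a bijection onto all coinvariants (`injective_and_range_of_actMap`).

For `L = (P ⊗ P)^{co H}` the action map `L ⊗_B P → P ⊗ P` is bijective (`IsCoinvariantModel.iso`).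
It is onto because `p₀ ⊗ τ(p₁)`, read in `(P ⊗ P) ⊗_B P`, multiplies out to `p ⊗ 1`, and by flatness
it comes from `L ⊗_B P`. Two applications of this isomorphism give `(L ⊗_B L) ⊗_B P ≅ P ⊗ P ⊗ P`,
hence `L ⊗_B L ≅ (P ⊗ P ⊗ P)^{co H}` by `(p ⊗ q) ⊗ (r ⊗ u) ↦ p ⊗ qr ⊗ u`
(`pairMap_injective_and_range`). In this picture the coproduct is `p ⊗ q ↦ p ⊗ 1 ⊗ q`, and the
bialgebroid axioms become identities in `P ⊗ P ⊗ P`. Coassociativity also needs that `L ⊗_B L ⊗_B L`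
embeds in the fourth tensor power (`tripleMap_injective`).

The source of the Galois map `λ` is identified with the same coinvariants by `X ⊗ Y ↦ p ⊗ r ⊗ uq`
for `X = p ⊗ q`, `Y = r ⊗ u` (`outerMap_injective_and_range`). Under the two identifications `λ` is
the identity, so `L` is a left Hopf algebroid. The involution `p ⊗ q ↦ q* ⊗ p*` is multiplicative on
`L`, exchanges source and target and reverses `p ⊗ 1 ⊗ q`. It conjugates the second Galois map `μ`
into `λ`, so `L` is also an anti-left Hopf algebroid.

It remains to compare `p ⊗ 1 ⊗ q` with the formula `p₀ ⊗ τ(p₁) ⊗ q` (`joinMiddle_map_eq_iff`). One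
direction multiplies the two middle legs and uses `τ¹(h) τ²(h) = ε(h)`. The other uses an embedding
of `P ⊗ (P ⊗_B P) ⊗ P` in `P ⊗ P ⊗ P ⊗ H`, built from `χ` and the inverse of the antipode. As
`pairMap` is injective, the formula determines the coproduct, which gives uniqueness. -/

noncomputable section

namespace HopfPair

set_option linter.unusedSectionVars false

/-! ## Maps between balanced tensor products -/

namespace BalancedTensor

section Functoriality

variable {A M N M' N' M'' N'' Q : Type*}
  [AddCommGroup M] [Module ℂ M] [AddCommGroup N] [Module ℂ N]
  [AddCommGroup M'] [Module ℂ M'] [AddCommGroup N'] [Module ℂ N']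
  [AddCommGroup M''] [Module ℂ M''] [AddCommGroup N''] [Module ℂ N'']
  [AddCommGroup Q] [Module ℂ Q]
  {ρ : A → M →ₗ[ℂ] M} {σ : A → N →ₗ[ℂ] N} {ρ' : A → M' →ₗ[ℂ] M'} {σ' : A → N' →ₗ[ℂ] N'}
  {ρ'' : A → M'' →ₗ[ℂ] M''} {σ'' : A → N'' →ₗ[ℂ] N''}

theorem hom_ext {f g : BalancedTensor ρ σ →ₗ[ℂ] Q}
    (h : ∀ m n, f (mk ρ σ (m ⊗ₜ n)) = g (mk ρ σ (m ⊗ₜ n))) : f = g :=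
  Submodule.linearMap_qext _ (TensorProduct.ext' h)

/-- `f ⊗ g` for equivariant maps `f` and `g`. -/
def map (f : M →ₗ[ℂ] M') (g : N →ₗ[ℂ] N') (hf : ∀ a m, f (ρ a m) = ρ' a (f m))
    (hg : ∀ a n, g (σ a n) = σ' a (g n)) : BalancedTensor ρ σ →ₗ[ℂ] BalancedTensor ρ' σ' :=
  lift (mk ρ' σ' ∘ₗ TensorProduct.map f g) (fun a m n => by
    have := balancedMk_eq ρ' σ' a (f m) (g n)
    simpa only [LinearMap.comp_apply, TensorProduct.map_tmul, hf, hg] using this)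

theorem map_mk (f : M →ₗ[ℂ] M') (g : N →ₗ[ℂ] N') (hf : ∀ a m, f (ρ a m) = ρ' a (f m))
    (hg : ∀ a n, g (σ a n) = σ' a (g n)) (z : M ⊗[ℂ] N) :
    map f g hf hg (mk ρ σ z) = mk ρ' σ' (TensorProduct.map f g z) := rfl

/-- `f ⊗ g` for equivariant isomorphisms `f` and `g`. -/
def congr (f : M ≃ₗ[ℂ] M') (g : N ≃ₗ[ℂ] N') (hf : ∀ a m, f (ρ a m) = ρ' a (f m))
    (hg : ∀ a n, g (σ a n) = σ' a (g n)) : BalancedTensor ρ σ ≃ₗ[ℂ] BalancedTensor ρ' σ' :=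
  LinearEquiv.ofLinearMap (map f.toLinearMap g.toLinearMap hf hg)
    (map f.symm.toLinearMap g.symm.toLinearMap
      (fun a m => f.injective (by simp [hf])) (fun a m => g.injective (by simp [hg])))
    (hom_ext fun m n => congrArg (mk ρ' σ') (by simp))
    (hom_ext fun m n => congrArg (mk ρ σ) (by simp))

/-- The exchange of the two factors. -/
def comm (ρ : A → M →ₗ[ℂ] M) (σ : A → N →ₗ[ℂ] N) : BalancedTensor ρ σ ≃ₗ[ℂ] BalancedTensor σ ρ :=
  LinearEquiv.ofLinearMap
    (lift (mk σ ρ ∘ₗ (TensorProduct.comm ℂ M N).toLinearMap)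
      (fun a m n => (balancedMk_eq σ ρ a n m).symm))
    (lift (mk ρ σ ∘ₗ (TensorProduct.comm ℂ N M).toLinearMap)
      (fun a m n => (balancedMk_eq ρ σ a n m).symm))
    (hom_ext fun _ _ => rfl) (hom_ext fun _ _ => rfl)

theorem comm_mk (m : M) (n : N) : comm ρ σ (mk ρ σ (m ⊗ₜ n)) = mk σ ρ (n ⊗ₜ m) := rfl

/-- `(M ⊗ N) ⊗ W ≅ M ⊗ (N ⊗ W)`, where the first product is balanced and the second one is not. -/
def assocRight (ρ : A → M →ₗ[ℂ] M) (σ : A → N →ₗ[ℂ] N) (W : Type*) [AddCommGroup W] [Module ℂ W] :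
    BalancedTensor ρ (fun a => (σ a).rTensor W) ≃ₗ[ℂ] BalancedTensor ρ σ ⊗[ℂ] W :=
  LinearEquiv.ofLinearMap
    (lift ((mk ρ σ).rTensor W ∘ₗ (TensorProduct.assoc ℂ M N W).symm.toLinearMap) (by
      intro a m n
      induction n with
      | zero => simp
      | add x y hx hy => simp only [TensorProduct.tmul_add, map_add, hx, hy]
      | tmul n w =>
        have := congrArg (· ⊗ₜ[ℂ] w) (balancedMk_eq ρ σ a m n)
        simpa using this))
    (TensorProduct.lift (lift (TensorProduct.curry
      (mk ρ (fun a => (σ a).rTensor W) ∘ₗ (TensorProduct.assoc ℂ M N W).toLinearMap))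
      (fun a m n => LinearMap.ext fun w =>
        balancedMk_eq ρ (fun a => (σ a).rTensor W) a m (n ⊗ₜ w))))
    (by
      refine TensorProduct.ext' fun z w => ?_
      obtain ⟨z, rfl⟩ := Submodule.mkQ_surjective _ z
      induction z with
      | zero => simp
      | add x y hx hy => simp only [TensorProduct.add_tmul, map_add, hx, hy]
      | tmul m n => rfl)
    (by
      refine hom_ext fun m z => ?_
      induction z with
      | zero => simp
      | add x y hx hy => simp only [TensorProduct.tmul_add, map_add, hx, hy]
      | tmul n w => rfl)

/-- `(W ⊗ M) ⊗ N ≅ W ⊗ (M ⊗ N)`, where the second product is balanced and the first one is not. -/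
def assocLeft (W : Type*) [AddCommGroup W] [Module ℂ W] (ρ : A → M →ₗ[ℂ] M) (σ : A → N →ₗ[ℂ] N) :
    BalancedTensor (fun a => (ρ a).lTensor W) σ ≃ₗ[ℂ] W ⊗[ℂ] BalancedTensor ρ σ :=
  LinearEquiv.ofLinearMap
    (lift ((mk ρ σ).lTensor W ∘ₗ (TensorProduct.assoc ℂ W M N).toLinearMap) (by
      intro a m n
      induction m with
      | zero => simp
      | add x y hx hy => simp only [TensorProduct.add_tmul, map_add, hx, hy]
      | tmul w m =>
        have := congrArg (w ⊗ₜ[ℂ] ·) (balancedMk_eq ρ σ a m n)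
        simpa using this))
    -- The quotient sits in the second factor of `W ⊗ (M ⊗ N)`, so the inverse is first defined on
    -- the balanced product with values in maps out of `W`, and then flipped.
    (TensorProduct.lift (lift (TensorProduct.curry (TensorProduct.uncurry (.id ℂ) _ _ _
      (TensorProduct.curry
        (mk (fun a => (ρ a).lTensor W) σ ∘ₗ (TensorProduct.assoc ℂ W M N).symm.toLinearMap)) ∘ₗ
        (TensorProduct.comm ℂ (M ⊗[ℂ] N) W).toLinearMap))
      (fun a m n => LinearMap.ext fun w =>
        balancedMk_eq (fun a => (ρ a).lTensor W) σ a (w ⊗ₜ m) n)).flip)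
    (by
      refine TensorProduct.ext' fun w z => ?_
      obtain ⟨z, rfl⟩ := Submodule.mkQ_surjective _ z
      induction z with
      | zero => simp
      | add x y hx hy => simp only [TensorProduct.tmul_add, map_add, hx, hy]
      | tmul m n => rfl)
    (by
      refine hom_ext fun z n => ?_
      induction z with
      | zero => simp
      | add x y hx hy => simp only [TensorProduct.add_tmul, map_add, hx, hy]
      | tmul w m => rfl)

end Functoriality

section Bimodule

variable {A A' L M N Q : Type*}
  [AddCommGroup L] [Module ℂ L] [AddCommGroup M] [Module ℂ M] [AddCommGroup N] [Module ℂ N]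
  (ρ : A → L →ₗ[ℂ] L) {σ : A → M →ₗ[ℂ] M} {ρ' : A' → M →ₗ[ℂ] M} (σ' : A' → N →ₗ[ℂ] N)

/-- The action on `L ⊗ M` induced by one on `M`. -/
def actRight (h : ∀ a b m, ρ' b (σ a m) = σ a (ρ' b m)) (b : A') :
    BalancedTensor ρ σ →ₗ[ℂ] BalancedTensor ρ σ :=
  map LinearMap.id (ρ' b) (fun _ _ => rfl) (fun a m => h a b m)

/-- The action on `M ⊗ N` induced by one on `M`. -/
def actLeft (h : ∀ a b m, ρ' b (σ a m) = σ a (ρ' b m)) (a : A) :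
    BalancedTensor ρ' σ' →ₗ[ℂ] BalancedTensor ρ' σ' :=
  map (σ a) LinearMap.id (fun b m => (h a b m).symm) (fun _ _ => rfl)

/-- `(L ⊗ M) ⊗ N → L ⊗ (M ⊗ N)`, both products being balanced. -/
def assocHom (h : ∀ a b m, ρ' b (σ a m) = σ a (ρ' b m)) :
    BalancedTensor (actRight ρ h) σ' →ₗ[ℂ] BalancedTensor ρ (actLeft σ' h) :=
  lift (TensorProduct.lift (lift (TensorProduct.lift
      (LinearMap.mk₂ ℂ (fun l m => mk ρ (actLeft σ' h) ∘ₗ TensorProduct.mk ℂ _ _ l ∘ₗ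
          mk ρ' σ' ∘ₗ TensorProduct.mk ℂ _ _ m)
        (fun _ _ _ => LinearMap.ext fun _ => by simp [-Submodule.mkQ_apply])
        (fun _ _ _ => LinearMap.ext fun _ => by simp [-Submodule.mkQ_apply])
        (fun _ _ _ => LinearMap.ext fun _ => by simp [-Submodule.mkQ_apply, TensorProduct.tmul_add])
        (fun _ _ _ => LinearMap.ext fun _ => by simp [-Submodule.mkQ_apply])))
      (fun a l m => LinearMap.ext fun n =>
        balancedMk_eq ρ (actLeft σ' h) a l (mk ρ' σ' (m ⊗ₜ n))))) (by
    intro b z n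
    obtain ⟨z, rfl⟩ := Submodule.mkQ_surjective _ z
    induction z with
    | zero => simp
    | add x y hx hy => simp only [TensorProduct.add_tmul, map_add, hx, hy]
    | tmul l m =>
      have := balancedMk_eq ρ' σ' b m n
      exact congrArg (fun t => mk ρ (actLeft σ' h) (l ⊗ₜ t)) this)

theorem assocHom_mk (h : ∀ a b m, ρ' b (σ a m) = σ a (ρ' b m)) (l : L) (m : M) (n : N) :
    assocHom ρ σ' h (mk (actRight ρ h) σ' (mk ρ σ (l ⊗ₜ m) ⊗ₜ n)) =
      mk ρ (actLeft σ' h) (l ⊗ₜ mk ρ' σ' (m ⊗ₜ n)) := rfl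

/-- `L ⊗ (M ⊗ N) → (L ⊗ M) ⊗ N`, both products being balanced. -/
def assocInv (h : ∀ a b m, ρ' b (σ a m) = σ a (ρ' b m)) :
    BalancedTensor ρ (actLeft σ' h) →ₗ[ℂ] BalancedTensor (actRight ρ h) σ' :=
  lift (TensorProduct.lift (lift (TensorProduct.lift
      (LinearMap.mk₂ ℂ (fun m n => mk (actRight ρ h) σ' ∘ₗ
          (TensorProduct.mk ℂ _ _).flip n ∘ₗ mk ρ σ ∘ₗ (TensorProduct.mk ℂ _ _).flip m)
        (fun _ _ _ => LinearMap.ext fun _ => by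
          simp [-Submodule.mkQ_apply])
        (fun _ _ _ => LinearMap.ext fun _ => by
          simp [-Submodule.mkQ_apply])
        (fun _ _ _ => LinearMap.ext fun _ => by simp [-Submodule.mkQ_apply])
        (fun _ _ _ => LinearMap.ext fun _ => by simp [-Submodule.mkQ_apply])))
      (fun b m n => LinearMap.ext fun l =>
        balancedMk_eq (actRight ρ h) σ' b (mk ρ σ (l ⊗ₜ m)) n)).flip) (by
    intro a l z
    obtain ⟨z, rfl⟩ := Submodule.mkQ_surjective _ z
    induction z with
    | zero => simp
    | add x y hx hy => simp only [TensorProduct.tmul_add, map_add, hx, hy]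
    | tmul m n =>
      have := balancedMk_eq ρ σ a l m
      exact congrArg (fun t => mk (actRight ρ h) σ' (t ⊗ₜ n)) this)

theorem assocInv_mk (h : ∀ a b m, ρ' b (σ a m) = σ a (ρ' b m)) (l : L) (m : M) (n : N) :
    assocInv ρ σ' h (mk ρ (actLeft σ' h) (l ⊗ₜ mk ρ' σ' (m ⊗ₜ n))) =
      mk (actRight ρ h) σ' (mk ρ σ (l ⊗ₜ m) ⊗ₜ n) := rfl

/-- `(L ⊗ M) ⊗ N ≅ L ⊗ (M ⊗ N)`, both products being balanced. -/
def assoc (h : ∀ a b m, ρ' b (σ a m) = σ a (ρ' b m)) :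
    BalancedTensor (actRight ρ h) σ' ≃ₗ[ℂ] BalancedTensor ρ (actLeft σ' h) :=
  LinearEquiv.ofLinearMap (assocHom ρ σ' h) (assocInv ρ σ' h)
    (by
      refine hom_ext fun l z => ?_
      obtain ⟨z, rfl⟩ := Submodule.mkQ_surjective _ z
      induction z with
      | zero => simp
      | add x y hx hy => simp only [TensorProduct.tmul_add, map_add, hx, hy]
      | tmul m n => rw [LinearMap.comp_apply, assocInv_mk, assocHom_mk, LinearMap.id_apply])
    (by
      refine hom_ext fun z n => ?_
      obtain ⟨z, rfl⟩ := Submodule.mkQ_surjective _ z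
      induction z with
      | zero => simp
      | add x y hx hy => simp only [TensorProduct.add_tmul, map_add, hx, hy]
      | tmul l m => rw [LinearMap.comp_apply, assocHom_mk, assocInv_mk, LinearMap.id_apply])

end Bimodule

end BalancedTensor

/-! ## Right actions and faithful flatness -/

/-- `ρ` makes `M` a right `B`-module. -/
structure IsRightAction {B M : Type*} [Ring B] [Algebra ℂ B] [AddCommGroup M] [Module ℂ M]
    (ρ : B → M →ₗ[ℂ] M) : Prop where
  one : ∀ m, ρ 1 m = m
  mul : ∀ a b m, ρ (a * b) m = ρ b (ρ a m)
  add : ∀ a b m, ρ (a + b) m = ρ a m + ρ b m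
  smul : ∀ (c : ℂ) a m, ρ (c • a) m = c • ρ a m

namespace IsRightAction

variable {B M N : Type*} [Ring B] [Algebra ℂ B] [AddCommGroup M] [Module ℂ M]
  [AddCommGroup N] [Module ℂ N] {ρ : B → M →ₗ[ℂ] M} {ρ' : B → N →ₗ[ℂ] N}

/-- The module over the opposite ring given by a right action. -/
abbrev toModule (h : IsRightAction ρ) : Module Bᵐᵒᵖ M where
  smul b m := ρ (unop b) m
  one_smul m := h.one m
  mul_smul a b m := h.mul (unop b) (unop a) m
  smul_zero b := map_zero (ρ (unop b))
  smul_add b := map_add (ρ (unop b))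
  add_smul a b m := h.add (unop a) (unop b) m
  zero_smul m := by
    have := h.smul 0 0 m
    rw [zero_smul, zero_smul] at this
    exact this

/-- A subspace stable under a right action. -/
theorem restrict (h : IsRightAction ρ) (K : Submodule ℂ M) (hK : ∀ b, ∀ m ∈ K, ρ b m ∈ K) :
    IsRightAction fun b => (ρ b).restrict (hK b) where
  one m := Subtype.ext (h.one m)
  mul a b m := Subtype.ext (h.mul a b m)
  add a b m := Subtype.ext (h.add a b m)
  smul c a m := Subtype.ext (h.smul c a m)

theorem quotient (h : IsRightAction ρ) (K : Submodule ℂ M) (hK : ∀ b, K ≤ K.comap (ρ b)) :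
    IsRightAction fun b => K.mapQ K (ρ b) (hK b) where
  one m := by
    obtain ⟨m, rfl⟩ := Submodule.mkQ_surjective _ m
    exact congrArg K.mkQ (h.one m)
  mul a b m := by
    obtain ⟨m, rfl⟩ := Submodule.mkQ_surjective _ m
    exact congrArg K.mkQ (h.mul a b m)
  add a b m := by
    obtain ⟨m, rfl⟩ := Submodule.mkQ_surjective _ m
    exact congrArg K.mkQ (h.add a b m)
  smul c a m := by
    obtain ⟨m, rfl⟩ := Submodule.mkQ_surjective _ m
    exact congrArg K.mkQ (h.smul c a m)

/-- Needed for the transport along `ULift`, which moves an action into the universe where flatness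
is assumed. -/
theorem conj (h : IsRightAction ρ) (e : M ≃ₗ[ℂ] N) :
    IsRightAction fun b => e.toLinearMap ∘ₗ ρ b ∘ₗ e.symm.toLinearMap where
  one m := by simp [h.one]
  mul a b m := by simp [h.mul]
  add a b m := by simp [h.add]
  smul c a m := by simp [h.smul]

theorem lTensor (h : IsRightAction ρ) (W : Type*) [AddCommGroup W] [Module ℂ W] :
    IsRightAction fun b => (ρ b).lTensor W where
  one m := by
    rw [show ρ 1 = .id from LinearMap.ext h.one, LinearMap.lTensor_id, LinearMap.id_apply]
  mul a b m := by
    rw [show ρ (a * b) = ρ b ∘ₗ ρ a from LinearMap.ext (h.mul a b), LinearMap.lTensor_comp_apply]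
  add a b m := by
    rw [show ρ (a + b) = ρ a + ρ b from LinearMap.ext (h.add a b), LinearMap.lTensor_add,
      LinearMap.add_apply]
  smul c a m := by
    rw [show ρ (c • a) = c • ρ a from LinearMap.ext (h.smul c a), LinearMap.lTensor_smul,
      LinearMap.smul_apply]

theorem actRight {A L : Type*} [AddCommGroup L] [Module ℂ L] (h : IsRightAction ρ)
    (τ : A → L →ₗ[ℂ] L) {σ : A → M →ₗ[ℂ] M} (hc : ∀ a b m, ρ b (σ a m) = σ a (ρ b m)) :
    IsRightAction (BalancedTensor.actRight τ hc) := by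
  have key : ∀ b z, BalancedTensor.actRight τ hc b (BalancedTensor.mk τ σ z) =
    BalancedTensor.mk τ σ ((ρ b).lTensor L z) := fun _ _ => rfl
  have h' := h.lTensor L
  refine ⟨fun m => ?_, fun a b m => ?_, fun a b m => ?_, fun c a m => ?_⟩ <;>
    obtain ⟨m, rfl⟩ := Submodule.mkQ_surjective _ m
  · rw [key, h'.one]
  · rw [key, key, key, h'.mul]
  · rw [key, key, key, h'.add, map_add]
  · rw [key, key, h'.smul, map_smul]

end IsRightAction

namespace IsFaithfullyFlat

open BalancedTensor

variable {B P : Type u} [Ring B] [Algebra ℂ B] [AddCommGroup P] [Module ℂ P] [Module B P]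
  [IsScalarTower ℂ B P] {π : B → P →ₗ[ℂ] P}

section SameUniverse

variable {M N : Type w} [AddCommGroup M] [Module ℂ M] [AddCommGroup N] [Module ℂ N]
  {ρ : B → M →ₗ[ℂ] M} {ρ' : B → N →ₗ[ℂ] N}

/-- Actions are handled below as families of operators, whereas faithful flatness quantifies over
modules over the opposite ring. The operators are packed into such modules, and the balanced
products on both sides are identified by the identity on representatives. -/
theorem map_injective_aux (hF : IsFaithfullyFlat.{w} B P) (hπ : ∀ b p, π b p = b • p)
    (hρ : IsRightAction ρ) (hρ' : IsRightAction ρ') (f : M →ₗ[ℂ] N)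
    (hf : ∀ b m, f (ρ b m) = ρ' b (f m)) (hi : Function.Injective f) :
    Function.Injective (map (σ := π) (σ' := π) f LinearMap.id hf fun _ _ => rfl) := by
  let _ := hρ.toModule
  let _ := hρ'.toModule
  have : IsScalarTower ℂ Bᵐᵒᵖ M := ⟨fun c b m => hρ.smul c (unop b) m⟩
  have : IsScalarTower ℂ Bᵐᵒᵖ N := ⟨fun c b m => hρ'.smul c (unop b) m⟩
  let F : M →ₗ[Bᵐᵒᵖ] N := { f with map_smul' := fun b m => hf (unop b) m }
  have h1 := hF.1 M N F hi
  let e : BalancedTensor ρ π ≃ₗ[ℂ] ModuleTensor B M P :=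
    BalancedTensor.congr (.refl ℂ M) (.refl ℂ P) (fun _ _ => rfl) (fun b p => hπ b p)
  let e' : BalancedTensor ρ' π ≃ₗ[ℂ] ModuleTensor B N P :=
    BalancedTensor.congr (.refl ℂ N) (.refl ℂ P) (fun _ _ => rfl) (fun b p => hπ b p)
  have h2 : ∀ z, e' (map (σ := π) (σ' := π) f LinearMap.id hf (fun _ _ => rfl) z) =
      ModuleTensor.rTensor B P F (e z) := by
    refine LinearMap.congr_fun (f := e'.toLinearMap ∘ₗ _)
      (g := ModuleTensor.rTensor B P F ∘ₗ e.toLinearMap) (hom_ext fun m p => ?_)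
    rfl
  intro x y hxy
  apply e.injective
  apply h1
  rw [← h2, ← h2, hxy]

theorem subsingleton_aux (hF : IsFaithfullyFlat.{w} B P) (hπ : ∀ b p, π b p = b • p)
    (hρ : IsRightAction ρ) (h : ∀ z : BalancedTensor ρ π, z = 0) (m : M) : m = 0 := by
  let _ := hρ.toModule
  have : IsScalarTower ℂ Bᵐᵒᵖ M := ⟨fun c b m => hρ.smul c (unop b) m⟩
  let e : BalancedTensor ρ π ≃ₗ[ℂ] ModuleTensor B M P :=
    BalancedTensor.congr (.refl ℂ M) (.refl ℂ P) (fun _ _ => rfl) (fun b p => hπ b p)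
  by_contra hm
  obtain ⟨x, y, hxy⟩ := hF.2 M ⟨m, 0, hm⟩
  apply hxy
  rw [← e.apply_symm_apply x, ← e.apply_symm_apply y, h (e.symm x), h (e.symm y)]

end SameUniverse

section

variable {M : Type u} {N : Type (max u v)} [AddCommGroup M] [Module ℂ M] [AddCommGroup N]
  [Module ℂ N] {ρ : B → M →ₗ[ℂ] M} {ρ' : B → N →ₗ[ℂ] N}

/-- Flatness is assumed for modules in the universe `max u v`, which has to contain tensor products
with `H`. The source, which lives in `u`, is lifted there. -/
theorem map_injective (hF : IsFaithfullyFlat.{max u v} B P) (hπ : ∀ b p, π b p = b • p)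
    (hρ : IsRightAction ρ) (hρ' : IsRightAction ρ') (f : M →ₗ[ℂ] N)
    (hf : ∀ b m, f (ρ b m) = ρ' b (f m)) (hi : Function.Injective f) :
    Function.Injective (map (σ := π) (σ' := π) f LinearMap.id hf fun _ _ => rfl) := by
  let e : M ≃ₗ[ℂ] ULift.{v} M := ULift.moduleEquiv.symm
  have hf' : ∀ b m, (f ∘ₗ e.symm.toLinearMap) ((e.toLinearMap ∘ₗ ρ b ∘ₗ e.symm.toLinearMap) m) =
      ρ' b ((f ∘ₗ e.symm.toLinearMap) m) := fun b m => by simp [hf]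
  have h1 := hF.map_injective_aux hπ (hρ.conj e) hρ' (f ∘ₗ e.symm.toLinearMap) hf'
    (hi.comp e.symm.injective)
  let E : BalancedTensor ρ π ≃ₗ[ℂ]
      BalancedTensor (fun b => e.toLinearMap ∘ₗ ρ b ∘ₗ e.symm.toLinearMap) π :=
    BalancedTensor.congr e (.refl ℂ P) (fun _ _ => by simp) (fun _ _ => rfl)
  have h2 : map (σ := π) (σ' := π) f LinearMap.id hf (fun _ _ => rfl) =
      map (σ := π) (σ' := π) (f ∘ₗ e.symm.toLinearMap) LinearMap.id hf' (fun _ _ => rfl) ∘ₗ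
        E.toLinearMap := hom_ext fun m p => rfl
  rw [h2]
  exact h1.comp E.injective

theorem eq_zero (hF : IsFaithfullyFlat.{max u v} B P) (hπ : ∀ b p, π b p = b • p)
    (hρ : IsRightAction ρ) (h : ∀ z : BalancedTensor ρ π, z = 0) (m : M) : m = 0 := by
  let e : M ≃ₗ[ℂ] ULift.{v} M := ULift.moduleEquiv.symm
  let E : BalancedTensor ρ π ≃ₗ[ℂ]
      BalancedTensor (fun b => e.toLinearMap ∘ₗ ρ b ∘ₗ e.symm.toLinearMap) π :=
    BalancedTensor.congr e (.refl ℂ P) (fun _ _ => by simp) (fun _ _ => rfl)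
  have h1 := hF.subsingleton_aux hπ (hρ.conj e) (fun z => by
    rw [← E.apply_symm_apply z, h (E.symm z), map_zero]) (e m)
  exact e.injective (h1.trans (map_zero e).symm)

/-- `- ⊗_B P` preserves kernels. -/
theorem exists_of_map_eq_zero (hF : IsFaithfullyFlat.{max u v} B P) (hπ : ∀ b p, π b p = b • p)
    (hρ : IsRightAction ρ) (hρ' : IsRightAction ρ') (f : M →ₗ[ℂ] N)
    (hf : ∀ b m, f (ρ b m) = ρ' b (f m)) (z : BalancedTensor ρ π)
    (hz : map (σ := π) (σ' := π) f LinearMap.id hf (fun _ _ => rfl) z = 0) :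
    ∃ y : LinearMap.ker f ⊗[ℂ] P, mk ρ π ((LinearMap.ker f).subtype.rTensor P y) = z := by
  set K := LinearMap.ker f
  have hK : ∀ b, K ≤ K.comap (ρ b) := fun b m hm => by
    have hm' : f m = 0 := hm
    change f (ρ b m) = 0
    rw [hf, hm', map_zero]
  -- The map `f` factors through the injection `f'`, which stays injective after tensoring with `P`.
  -- Hence the element already vanishes in `(M ⧸ K) ⊗_B P`.
  let f' : M ⧸ K →ₗ[ℂ] N := K.liftQ f le_rfl
  have hf' : ∀ b m, f' (K.mapQ K (ρ b) (hK b) m) = ρ' b (f' m) := fun b m => by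
    obtain ⟨m, rfl⟩ := Submodule.mkQ_surjective _ m
    exact hf b m
  have h1 := hF.map_injective hπ (hρ.quotient K hK) hρ' f' hf'
    (LinearMap.ker_eq_bot.1 (Submodule.ker_liftQ_eq_bot _ _ _ le_rfl))
  obtain ⟨x, rfl⟩ := Submodule.mkQ_surjective _ z
  have h2 : mk (fun b => K.mapQ K (ρ b) (hK b)) π (K.mkQ.rTensor P x) = 0 := by
    apply h1
    rw [map_zero]
    refine Eq.trans ?_ hz
    rw [map_mk, ← LinearMap.rTensor_def, ← LinearMap.rTensor_comp_apply]
    rfl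
  rw [Submodule.mkQ_apply, Submodule.Quotient.mk_eq_zero] at h2
  -- Every relation over `M ⧸ K` lifts to a relation over `M`. After subtraction of such a lift the
  -- representative vanishes in the plain tensor product over `ℂ`, where right exactness applies.
  have h3 : balancedRel (fun b => K.mapQ K (ρ b) (hK b)) π ≤
      (balancedRel ρ π).map (K.mkQ.rTensor P) := by
    refine Submodule.span_le.2 ?_
    rintro _ ⟨b, m, p, rfl⟩
    obtain ⟨m, rfl⟩ := Submodule.mkQ_surjective _ m
    exact ⟨ρ b m ⊗ₜ p - m ⊗ₜ π b p, Submodule.subset_span ⟨b, m, p, rfl⟩, by simp⟩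
  obtain ⟨x', hx', h4⟩ := h3 h2
  have h5 : K.mkQ.rTensor P (x - x') = 0 := by rw [map_sub, h4, sub_self]
  have hex : Function.Exact (K.subtype.rTensor P) (K.mkQ.rTensor P) :=
    rTensor_exact P (LinearMap.exact_subtype_mkQ K) (Submodule.mkQ_surjective K)
  obtain ⟨y, hy⟩ := (hex _).1 h5
  refine ⟨y, ?_⟩
  rw [hy, map_sub, sub_eq_self, Submodule.mkQ_apply, Submodule.Quotient.mk_eq_zero]
  exact hx'

end

section Descent

variable {M N : Type u} [AddCommGroup M] [Module ℂ M] [AddCommGroup N]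
  [Module ℂ N] {ρ : B → M →ₗ[ℂ] M} {ρ' : B → N →ₗ[ℂ] N} {Z : Type*} [AddCommGroup Z] [Module ℂ Z]

theorem map_injective' (hF : IsFaithfullyFlat.{max u v} B P) (hπ : ∀ b p, π b p = b • p)
    (hρ : IsRightAction ρ) (hρ' : IsRightAction ρ') (f : M →ₗ[ℂ] N)
    (hf : ∀ b m, f (ρ b m) = ρ' b (f m)) (hi : Function.Injective f) :
    Function.Injective (map (σ := π) (σ' := π) f LinearMap.id hf fun _ _ => rfl) := by
  let e : N ≃ₗ[ℂ] ULift.{v} N := ULift.moduleEquiv.symm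
  have hf' : ∀ b m, (e.toLinearMap ∘ₗ f) (ρ b m) =
      (e.toLinearMap ∘ₗ ρ' b ∘ₗ e.symm.toLinearMap) ((e.toLinearMap ∘ₗ f) m) :=
    fun b m => by simp [hf]
  have h1 := hF.map_injective.{u, v} hπ hρ (hρ'.conj e) (e.toLinearMap ∘ₗ f) hf'
    (e.injective.comp hi)
  let E : BalancedTensor ρ' π ≃ₗ[ℂ]
      BalancedTensor (fun b => e.toLinearMap ∘ₗ ρ' b ∘ₗ e.symm.toLinearMap) π :=
    BalancedTensor.congr e (.refl ℂ P) (fun _ _ => by simp) (fun _ _ => rfl)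
  have h2 : map (σ := π) (σ' := π) (e.toLinearMap ∘ₗ f) LinearMap.id hf' (fun _ _ => rfl) =
      E.toLinearMap ∘ₗ map (σ := π) (σ' := π) f LinearMap.id hf (fun _ _ => rfl) :=
    hom_ext fun m p => rfl
  rw [h2] at h1
  exact Function.Injective.of_comp (f := E) h1

/-- By flatness, the product `K ⊗_B P` for `K = ker f` embeds in `M ⊗_B P`. The injective composite
kills its image, so `K ⊗_B P = 0`, and faithfulness gives `K = 0`. -/
theorem injective_of_comp (hF : IsFaithfullyFlat.{max u v} B P) (hπ : ∀ b p, π b p = b • p)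
    (hρ : IsRightAction ρ) (f : M →ₗ[ℂ] N)
    (hf : ∀ b m, f (ρ b m) = ρ' b (f m)) (g : BalancedTensor ρ' π →ₗ[ℂ] Z)
    (hi : Function.Injective (g ∘ₗ map (σ := π) (σ' := π) f LinearMap.id hf fun _ _ => rfl)) :
    Function.Injective f := by
  set K := LinearMap.ker f with hKdef
  have hK : ∀ b, ∀ m ∈ K, ρ b m ∈ K := fun b m hm => by
    have hm' : f m = 0 := hm
    change f (ρ b m) = 0
    rw [hf, hm', map_zero]
  have hz : ∀ z : BalancedTensor (fun b => (ρ b).restrict (hK b)) π, z = 0 := by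
    intro z
    apply hF.map_injective'.{u, v} hπ (hρ.restrict K hK) hρ K.subtype (fun _ _ => rfl)
      Subtype.val_injective
    rw [map_zero]
    apply hi
    rw [map_zero]
    obtain ⟨z, rfl⟩ := Submodule.mkQ_surjective _ z
    change g (mk ρ' π (f.rTensor P (K.subtype.rTensor P z))) = 0
    rw [← LinearMap.rTensor_comp_apply, show f ∘ₗ K.subtype = 0 from
        LinearMap.ext fun k => k.2, LinearMap.rTensor_zero]
    simp
  rw [← LinearMap.ker_eq_bot, eq_bot_iff]
  intro m hm
  have := hF.eq_zero.{u, v} hπ (hρ.restrict K hK) hz ⟨m, hm⟩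
  exact congrArg Subtype.val this

/-- Since `g` is injective, `f ⊗_B id` is itself onto. So the cokernel of `f` dies after tensoring
with `P`, and faithfulness makes it zero. -/
theorem surjective_of_comp (hF : IsFaithfullyFlat.{max u v} B P) (hπ : ∀ b p, π b p = b • p)
    (hρ' : IsRightAction ρ') (f : M →ₗ[ℂ] N)
    (hf : ∀ b m, f (ρ b m) = ρ' b (f m)) (g : BalancedTensor ρ' π →ₗ[ℂ] Z)
    (hg : Function.Injective g)
    (hs : Function.Surjective (g ∘ₗ map (σ := π) (σ' := π) f LinearMap.id hf fun _ _ => rfl)) :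
    Function.Surjective f := by
  set R := LinearMap.range f
  have hR : ∀ b, R ≤ R.comap (ρ' b) := by
    rintro b _ ⟨m, rfl⟩
    exact ⟨ρ b m, hf b m⟩
  have hz : ∀ z : BalancedTensor (fun b => R.mapQ R (ρ' b) (hR b)) π, z = 0 := by
    intro z
    obtain ⟨z, rfl⟩ := Submodule.mkQ_surjective _ z
    obtain ⟨y, rfl⟩ := LinearMap.rTensor_surjective P (Submodule.mkQ_surjective R) z
    obtain ⟨x, hx⟩ := hs (g (mk ρ' π y))
    have hx' := hg hx
    obtain ⟨x, rfl⟩ := Submodule.mkQ_surjective _ x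
    have h1 := congrArg (map (σ := π) (σ' := π) R.mkQ LinearMap.id
      (ρ' := fun b => R.mapQ R (ρ' b) (hR b)) (fun _ _ => rfl) fun _ _ => rfl) hx'
    change mk _ π (R.mkQ.rTensor P (f.rTensor P x)) = mk _ π (R.mkQ.rTensor P y) at h1
    rw [← LinearMap.rTensor_comp_apply, show R.mkQ ∘ₗ f = 0 from LinearMap.ext fun k =>
        (Submodule.Quotient.mk_eq_zero _).2 ⟨k, rfl⟩, LinearMap.rTensor_zero] at h1
    refine h1.symm.trans ?_
    simp
  intro n
  have := hF.eq_zero.{u, v} hπ (hρ'.quotient R hR) hz (R.mkQ n)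
  exact (Submodule.Quotient.mk_eq_zero _).1 this

end Descent

end IsFaithfullyFlat

/-! ## Relative Hopf modules of the form `V ⊗ P` -/

section MulLast

variable (V : Type*) [AddCommGroup V] [Module ℂ V] (Q : Type*) [Ring Q] [Algebra ℂ Q]

/-- `(v ⊗ q) ⊗ x ↦ v ⊗ q * x`. -/
def mulLast : (V ⊗[ℂ] Q) ⊗[ℂ] Q →ₗ[ℂ] V ⊗[ℂ] Q :=
  (LinearMap.mul' ℂ Q).lTensor V ∘ₗ (TensorProduct.assoc ℂ V Q Q).toLinearMap

@[simp]
theorem mulLast_tmul (v : V) (q x : Q) : mulLast V Q ((v ⊗ₜ q) ⊗ₜ x) = v ⊗ₜ (q * x) := rfl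

theorem mulLast_mul (z : V ⊗[ℂ] Q) (x y : Q) :
    mulLast V Q (z ⊗ₜ (x * y)) = mulLast V Q (mulLast V Q (z ⊗ₜ x) ⊗ₜ y) := by
  induction z with
  | zero => simp
  | add a b ha hb => simp only [TensorProduct.add_tmul, map_add, ha, hb]
  | tmul v q => simp [mul_assoc]

theorem mulLast_eq_lTensor (z : V ⊗[ℂ] Q) (x : Q) :
    mulLast V Q (z ⊗ₜ x) = (LinearMap.mulRight ℂ x).lTensor V z := by
  induction z with
  | zero => simp
  | add a b ha hb => simp only [TensorProduct.add_tmul, map_add, ha, hb]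
  | tmul v q => simp

end MulLast

section HopfModule

variable (H : Type v) (P : Type u) [Ring H] [HopfAlgebra ℂ H] [Ring P] [Algebra ℂ P]
  [ComoduleAlgebra H P]

/-- Left multiplication of `P^{co H}` on `P`. -/
abbrev coinvLeft : coinvariants H P → P →ₗ[ℂ] P := fun b => LinearMap.mulLeft ℂ (b : P)

/-- Right multiplication of `P^{co H}` on `P`. -/
abbrev coinvRight : coinvariants H P → P →ₗ[ℂ] P := fun b => LinearMap.mulRight ℂ (b : P)

theorem isRightAction_coinvRight : IsRightAction (coinvRight H P) where
  one m := mul_one m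
  mul a b m := (mul_assoc m (a : P) (b : P)).symm
  add a b m := mul_add m (a : P) (b : P)
  smul c a m := mul_smul_comm c m (a : P)

/-- `p ↦ p ⊗ 1`. -/
abbrev tmulOne : P →ₗ[ℂ] P ⊗[ℂ] H :=
  (Algebra.TensorProduct.includeLeft : P →ₐ[ℂ] P ⊗[ℂ] H).toLinearMap

/-- The coaction as a linear map. -/
abbrev coactLin : P →ₗ[ℂ] P ⊗[ℂ] H := (ComoduleAlgebra.coact (H := H) (P := P)).toLinearMap

variable (V : Type w) [AddCommGroup V] [Module ℂ V]

/-- The right action of `P^{co H}` on `V ⊗ P`. -/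
abbrev coinvAct : coinvariants H P → V ⊗[ℂ] P →ₗ[ℂ] V ⊗[ℂ] P := fun b => (coinvRight H P b).lTensor V

/-- `(v ⊗ h) ⊗ (p ⊗ k) ↦ v ⊗ (p ⊗ h * k)`. -/
def diagMul : (V ⊗[ℂ] H) ⊗[ℂ] (P ⊗[ℂ] H) →ₗ[ℂ] V ⊗[ℂ] (P ⊗[ℂ] H) :=
  (TensorProduct.assoc ℂ V P H).toLinearMap ∘ₗ
    (LinearMap.mul' ℂ H).lTensor (V ⊗[ℂ] P) ∘ₗ
    (TensorProduct.tensorTensorTensorComm ℂ V H P H).toLinearMap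

@[simp]
theorem diagMul_tmul (v : V) (h : H) (p : P) (k : H) :
    diagMul H P V ((v ⊗ₜ h) ⊗ₜ (p ⊗ₜ k)) = v ⊗ₜ (p ⊗ₜ (h * k)) := rfl

theorem diagMul_mul (a : V ⊗[ℂ] H) (c d : P ⊗[ℂ] H) :
    diagMul H P V (a ⊗ₜ (c * d)) = mulLast V (P ⊗[ℂ] H) (diagMul H P V (a ⊗ₜ c) ⊗ₜ d) := by
  induction a with
  | zero => simp
  | add a b ha hb => simp only [TensorProduct.add_tmul, map_add, ha, hb]
  | tmul v h =>
  induction c with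
  | zero => simp
  | add a b ha hb => simp only [TensorProduct.add_tmul, TensorProduct.tmul_add, map_add, add_mul,
      ha, hb]
  | tmul p k =>
  induction d with
  | zero => simp
  | add a b ha hb => simp only [TensorProduct.tmul_add, map_add, mul_add, ha, hb]
  | tmul q l => simp [mul_assoc]

variable {H P V}

/-- The diagonal coaction `v ⊗ p ↦ v₀ ⊗ (p₀ ⊗ v₁ * p₁)`. -/
def diag (δ : V →ₗ[ℂ] V ⊗[ℂ] H) : V ⊗[ℂ] P →ₗ[ℂ] V ⊗[ℂ] (P ⊗[ℂ] H) :=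
  diagMul H P V ∘ₗ TensorProduct.map δ (coactLin H P)

theorem diag_tmul (δ : V →ₗ[ℂ] V ⊗[ℂ] H) (v : V) (p : P) :
    diag δ (v ⊗ₜ p) = diagMul H P V (δ v ⊗ₜ ComoduleAlgebra.coact p) := rfl

/-- This is the compatibility of a relative Hopf module. It holds because the coaction of `P` is
multiplicative and the coefficient of `x` is multiplied in on the far right. -/
theorem diag_mulLast (δ : V →ₗ[ℂ] V ⊗[ℂ] H) (z : V ⊗[ℂ] P) (x : P) :
    diag δ (mulLast V P (z ⊗ₜ x)) =
      mulLast V (P ⊗[ℂ] H) (diag δ z ⊗ₜ ComoduleAlgebra.coact x) := by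
  induction z with
  | zero => simp
  | add a b ha hb => simp only [TensorProduct.add_tmul, map_add, ha, hb]
  | tmul v p => rw [mulLast_tmul, diag_tmul, diag_tmul, map_mul, diagMul_mul]

variable (H P V) in
/-- `(V ⊗ P) ⊗_B P ≅ V ⊗ (P ⊗ H)`, `(v ⊗ p) ⊗ x ↦ v ⊗ (p * x₀ ⊗ x₁)`. -/
def chi (hG : IsHopfGalois H P) :
    BalancedTensor (coinvAct H P V) (coinvLeft H P) ≃ₗ[ℂ] V ⊗[ℂ] (P ⊗[ℂ] H) :=
  BalancedTensor.assocLeft V (coinvRight H P) (coinvLeft H P) ≪≫ₗ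
    (LinearEquiv.ofBijective (canonicalMap H P) hG).lTensor V

theorem chi_mk (hG : IsHopfGalois H P) (z : V ⊗[ℂ] P) (x : P) :
    chi H P V hG (BalancedTensor.mk _ _ (z ⊗ₜ x)) =
      mulLast V (P ⊗[ℂ] H) ((tmulOne H P).lTensor V z ⊗ₜ ComoduleAlgebra.coact x) := by
  induction z with
  | zero => simp
  | add a b ha hb => simp only [TensorProduct.add_tmul, map_add, ha, hb]
  | tmul v p => rfl

variable (H P V) in
/-- `(V ⊗ P) ⊗_B P → V ⊗ P`, `(v ⊗ p) ⊗ x ↦ v ⊗ p * x`. -/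
def mulBalanced : BalancedTensor (coinvAct H P V) (coinvLeft H P) →ₗ[ℂ] V ⊗[ℂ] P :=
  BalancedTensor.lift (mulLast V P) (fun b z x => by
    rw [LinearMap.mulLeft_apply, mulLast_mul, mulLast_eq_lTensor V P z])

section Structure

variable {M : Type*} [AddCommGroup M] [Module ℂ M] {ρ : coinvariants H P → M →ₗ[ℂ] M}

/-- `M ⊗_B P → V ⊗ P`, `m ⊗ x ↦ f m * x`. -/
def actMap (f : M →ₗ[ℂ] V ⊗[ℂ] P) (hf : ∀ b m, f (ρ b m) = coinvAct H P V b (f m)) :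
    BalancedTensor ρ (coinvLeft H P) →ₗ[ℂ] V ⊗[ℂ] P :=
  mulBalanced H P V ∘ₗ BalancedTensor.map f LinearMap.id hf fun _ _ => rfl

theorem actMap_mk (f : M →ₗ[ℂ] V ⊗[ℂ] P) (hf : ∀ b m, f (ρ b m) = coinvAct H P V b (f m)) (m : M)
    (x : P) : actMap f hf (BalancedTensor.mk _ _ (m ⊗ₜ x)) = mulLast V P (f m ⊗ₜ x) := rfl

/-- As `f m` is coinvariant, the coaction sends `f m * x` to `f m * x₀ ⊗ x₁`, which is `χ` applied
to `f m ⊗ x`. -/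
theorem diag_actMap (hG : IsHopfGalois H P) (δ : V →ₗ[ℂ] V ⊗[ℂ] H) (f : M →ₗ[ℂ] V ⊗[ℂ] P)
    (hf : ∀ b m, f (ρ b m) = coinvAct H P V b (f m))
    (hc : ∀ m, diag δ (f m) = (tmulOne H P).lTensor V (f m)) :
    diag δ ∘ₗ actMap f hf = (chi H P V hG).toLinearMap ∘ₗ
      BalancedTensor.map f LinearMap.id hf fun _ _ => rfl := by
  refine BalancedTensor.hom_ext fun m x => ?_
  rw [LinearMap.comp_apply, actMap_mk, diag_mulLast, hc]
  exact (chi_mk hG (f m) x).symm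

end Structure

theorem coact_coinvariant (b : coinvariants H P) :
    ComoduleAlgebra.coact (H := H) (b : P) = (b : P) ⊗ₜ 1 := (mem_coinvariants H P).1 b.2

section Injectivity

variable {V M : Type u} [AddCommGroup V] [Module ℂ V] [AddCommGroup M] [Module ℂ M]
  {ρ : coinvariants H P → M →ₗ[ℂ] M}

/-- By `diag_actMap` the action map becomes injective after composition with the coaction: `f ⊗_B
id` is injective by flatness and `chi` is an isomorphism. -/
theorem actMap_injective (hG : IsHopfGalois H P)
    (hF : IsFaithfullyFlat.{max u v} (coinvariants H P) P) (hρ : IsRightAction ρ)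
    (δ : V →ₗ[ℂ] V ⊗[ℂ] H) (f : M →ₗ[ℂ] V ⊗[ℂ] P)
    (hf : ∀ b m, f (ρ b m) = coinvAct H P V b (f m))
    (hc : ∀ m, diag δ (f m) = (tmulOne H P).lTensor V (f m)) (hi : Function.Injective f) :
    Function.Injective (actMap f hf) := by
  refine Function.Injective.of_comp (f := diag δ) ?_
  rw [← LinearMap.coe_comp, diag_actMap hG δ f hf hc, LinearMap.coe_comp]
  exact (chi H P V hG).injective.comp (hF.map_injective'.{u, v} (fun _ _ => rfl) hρ
    ((isRightAction_coinvRight H P).lTensor V) f hf hi)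

/-- A `B`-linear map from `M` to the coinvariants of `V ⊗ P` such that the induced map
`M ⊗_B P → V ⊗ P` is bijective is itself bijective. -/
theorem injective_and_range_of_actMap (hG : IsHopfGalois H P)
    (hF : IsFaithfullyFlat.{max u v} (coinvariants H P) P) (hρ : IsRightAction ρ)
    (δ : V →ₗ[ℂ] V ⊗[ℂ] H) (f : M →ₗ[ℂ] V ⊗[ℂ] P)
    (hf : ∀ b m, f (ρ b m) = coinvAct H P V b (f m))
    (hc : ∀ m, diag δ (f m) = (tmulOne H P).lTensor V (f m))
    (hb : Function.Bijective (actMap f hf)) :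
    Function.Injective f ∧ ∀ z, diag δ z = (tmulOne H P).lTensor V z → ∃ m, f m = z := by
  refine ⟨hF.injective_of_comp.{u, v} (fun _ _ => rfl) hρ f hf (mulBalanced H P V) hb.1, ?_⟩
  -- For the coinvariants `E`, the map `E ⊗_B P → V ⊗ P` is injective by `actMap_injective`, and the
  -- given bijection factors through it. Descent then shows that `M → E` is onto.
  let E : Submodule ℂ (V ⊗[ℂ] P) := LinearMap.eqLocus (diag δ) ((tmulOne H P).lTensor V)
  have hE : ∀ b, ∀ z ∈ E, coinvAct H P V b z ∈ E := fun b z hz => by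
    have hz' : diag δ z = (tmulOne H P).lTensor V z := hz
    change diag δ ((LinearMap.mulRight ℂ (b : P)).lTensor V z) = (tmulOne H P).lTensor V
      ((LinearMap.mulRight ℂ (b : P)).lTensor V z)
    rw [← mulLast_eq_lTensor, diag_mulLast, hz', coact_coinvariant]
    clear hz hz'
    induction z with
    | zero => simp
    | add a b ha hb => simp only [TensorProduct.add_tmul, map_add, ha, hb]
    | tmul v p => simp
  have hρE := ((isRightAction_coinvRight H P).lTensor V).restrict E hE
  let f' : M →ₗ[ℂ] E := f.codRestrict E hc
  have hf' : ∀ b m, f' (ρ b m) = (coinvAct H P V b).restrict (hE b) (f' m) := fun b m =>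
    Subtype.ext (hf b m)
  let g : BalancedTensor (fun b => (coinvAct H P V b).restrict (hE b)) (coinvLeft H P) →ₗ[ℂ]
    V ⊗[ℂ] P := actMap E.subtype fun _ _ => rfl
  have hg : Function.Injective g := actMap_injective hG hF hρE δ E.subtype (fun _ _ => rfl)
    (fun z => z.2) Subtype.val_injective
  have hs : Function.Surjective (g ∘ₗ BalancedTensor.map (σ := coinvLeft H P) f' LinearMap.id hf'
      fun _ _ => rfl) := by
    have : g ∘ₗ BalancedTensor.map (σ := coinvLeft H P) f' LinearMap.id hf'
      (fun _ _ => rfl) = actMap f hf := BalancedTensor.hom_ext fun _ _ => rfl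
    rw [this]
    exact hb.2
  intro z hz
  obtain ⟨m, hm⟩ := hF.surjective_of_comp.{u, v} (fun _ _ => rfl) hρE f' hf' g hg hs ⟨z, hz⟩
  exact ⟨m, congrArg Subtype.val hm⟩

end Injectivity

end HopfModule

/-! ### The map `h ⊗ k ↦ h k₁ ⊗ k₂` of the Hopf algebra -/

section HopfAlgebra

variable (H : Type v) [Ring H] [HopfAlgebra ℂ H]

/-- `h ⊗ k ↦ h * k₁ ⊗ k₂`. -/
def mulComul : H ⊗[ℂ] H →ₗ[ℂ] H ⊗[ℂ] H :=
  (LinearMap.mul' ℂ H).rTensor H ∘ₗ (TensorProduct.assoc ℂ H H H).symm.toLinearMap ∘ₗ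
    (Coalgebra.comul (R := ℂ)).lTensor H

/-- `h ⊗ k ↦ h * S(k₁) ⊗ k₂`. -/
def mulAntipodeComul : H ⊗[ℂ] H →ₗ[ℂ] H ⊗[ℂ] H :=
  (LinearMap.mul' ℂ H ∘ₗ (HopfAlgebra.antipode ℂ).lTensor H).rTensor H ∘ₗ
    (TensorProduct.assoc ℂ H H H).symm.toLinearMap ∘ₗ (Coalgebra.comul (R := ℂ)).lTensor H

theorem mulAntipodeComul_comul (k : H) :
    mulAntipodeComul H (Coalgebra.comul (R := ℂ) k) = 1 ⊗ₜ k := by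
  rw [mulAntipodeComul, LinearMap.comp_apply, LinearMap.comp_apply, LinearEquiv.coe_coe,
    Coalgebra.coassoc_symm_apply, ← LinearMap.rTensor_comp_apply, LinearMap.comp_assoc,
    HopfAlgebra.mul_antipode_lTensor_comul, LinearMap.rTensor_comp_apply,
    Coalgebra.rTensor_counit_comul]
  simp

theorem mulAntipodeComul_mul (h : H) (z : H ⊗[ℂ] H) :
    mulAntipodeComul H ((h ⊗ₜ 1) * z) = (h ⊗ₜ 1) * mulAntipodeComul H z := by
  induction z with
  | zero => simp
  | add a b ha hb => simp only [mul_add, map_add, ha, hb]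
  | tmul l k =>
    simp only [mulAntipodeComul, Algebra.TensorProduct.tmul_mul_tmul, LinearMap.comp_apply,
      LinearMap.lTensor_tmul, one_mul]
    generalize Coalgebra.comul (R := ℂ) k = y
    induction y with
    | zero => simp
    | add a b ha hb => simp only [TensorProduct.tmul_add, mul_add, map_add, ha, hb]
    | tmul a b => simp [mul_assoc]

theorem mulComul_tmul (h k : H) : mulComul H (h ⊗ₜ k) = (h ⊗ₜ 1) * Coalgebra.comul (R := ℂ) k := by
  simp only [mulComul, LinearMap.comp_apply, LinearMap.lTensor_tmul]
  generalize Coalgebra.comul (R := ℂ) k = y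
  induction y with
  | zero => simp
  | add a b ha hb => simp only [TensorProduct.tmul_add, mul_add, map_add, ha, hb]
  | tmul a b => simp

/-- A left inverse is `h ⊗ k ↦ h S(k₁) ⊗ k₂`. It commutes with left multiplication by `h`, so only
`k₁ S(k₂) ⊗ k₃ = 1 ⊗ k` has to be known. -/
theorem mulComul_injective : Function.Injective (mulComul H) := by
  have h : mulAntipodeComul H ∘ₗ mulComul H = LinearMap.id := TensorProduct.ext' fun h k => by
    rw [LinearMap.comp_apply, mulComul_tmul, mulAntipodeComul_mul, mulAntipodeComul_comul]
    simp
  exact Function.LeftInverse.injective (g := mulAntipodeComul H) fun z => LinearMap.congr_fun h z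

end HopfAlgebra

/-! ### The coinvariance defect after tensoring with `P` -/

section Surjectivity

variable (H : Type v) (P : Type u) [Ring H] [HopfAlgebra ℂ H] [Ring P] [Algebra ℂ P]
  [ComoduleAlgebra H P] (V : Type w) [AddCommGroup V] [Module ℂ V]

/-- `v ⊗ (p ⊗ h) ↦ (v ⊗ h) ⊗ p`. -/
def moveLast : V ⊗[ℂ] (P ⊗[ℂ] H) ≃ₗ[ℂ] (V ⊗[ℂ] H) ⊗[ℂ] P :=
  (TensorProduct.comm ℂ P H).lTensor V ≪≫ₗ (TensorProduct.assoc ℂ V H P).symm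

@[simp]
theorem moveLast_tmul (v : V) (p : P) (h : H) :
    moveLast H P V (v ⊗ₜ (p ⊗ₜ h)) = (v ⊗ₜ h) ⊗ₜ p := rfl

/-- `(v ⊗ h) ⊗ (p ⊗ k) ↦ v ⊗ ((p ⊗ h * k₁) ⊗ k₂)`. -/
def mulComulLast : (V ⊗[ℂ] H) ⊗[ℂ] (P ⊗[ℂ] H) →ₗ[ℂ] V ⊗[ℂ] ((P ⊗[ℂ] H) ⊗[ℂ] H) :=
  ((TensorProduct.assoc ℂ V P (H ⊗[ℂ] H)) ≪≫ₗ
    (TensorProduct.assoc ℂ P H H).symm.lTensor V).toLinearMap ∘ₗ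
    (mulComul H).lTensor (V ⊗[ℂ] P) ∘ₗ (TensorProduct.tensorTensorTensorComm ℂ V H P H).toLinearMap

theorem mulComulLast_injective : Function.Injective (mulComulLast H P V) := by
  rw [mulComulLast, LinearMap.coe_comp, LinearMap.coe_comp]
  exact (LinearEquiv.injective _).comp ((Module.Flat.lTensor_preserves_injective_linearMap _
    (mulComul_injective H)).comp (LinearEquiv.injective _))

/-- `p ⊗ h ↦ p ⊗ h₁ ⊗ h₂`. -/
abbrev comulLast : P ⊗[ℂ] H →ₗ[ℂ] (P ⊗[ℂ] H) ⊗[ℂ] H :=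
  (TensorProduct.assoc ℂ P H H).symm.toLinearMap ∘ₗ (Coalgebra.comul (R := ℂ)).lTensor P

theorem mulComulLast_tmul (v : V) (h : H) (p : P) (k : H) :
    mulComulLast H P V ((v ⊗ₜ h) ⊗ₜ (p ⊗ₜ k)) =
      v ⊗ₜ (((p ⊗ₜ h) ⊗ₜ 1) * comulLast H P (1 ⊗ₜ k)) := by
  simp only [mulComulLast, comulLast, LinearMap.comp_apply, LinearMap.lTensor_tmul,
    LinearEquiv.coe_coe, TensorProduct.tensorTensorTensorComm_tmul, LinearEquiv.trans_apply,
    mulComul_tmul]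
  generalize Coalgebra.comul (R := ℂ) k = y
  induction y with
  | zero => simp
  | add a b ha hb => simp only [TensorProduct.tmul_add, mul_add, map_add, ha, hb]
  | tmul a b => simp

variable {H P V}

theorem comulLast_mul (p : P) (y : P ⊗[ℂ] H) :
    comulLast H P ((p ⊗ₜ 1) * y) = ((p ⊗ₜ 1) ⊗ₜ 1) * comulLast H P y := by
  induction y with
  | zero => simp
  | add a b ha hb => simp only [mul_add, map_add, ha, hb]
  | tmul q k =>
    simp only [comulLast, Algebra.TensorProduct.tmul_mul_tmul, LinearMap.comp_apply,
      LinearMap.lTensor_tmul, one_mul]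
    generalize Coalgebra.comul (R := ℂ) k = y
    induction y with
    | zero => simp
    | add a b ha hb => simp only [TensorProduct.tmul_add, mul_add, map_add, ha, hb]
    | tmul a b => simp

theorem rTensor_coact_coact (p : P) :
    (coactLin H P).rTensor H (ComoduleAlgebra.coact p) = comulLast H P (ComoduleAlgebra.coact p) := by
  rw [comulLast, LinearMap.comp_apply, ← ComoduleAlgebra.coact_coassoc]
  simp

theorem mulComulLast_mul (a : V ⊗[ℂ] (P ⊗[ℂ] H)) (y : P ⊗[ℂ] H) :
    mulComulLast H P V (mulLast (V ⊗[ℂ] H) (P ⊗[ℂ] H)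
        ((tmulOne H P).lTensor (V ⊗[ℂ] H) (moveLast H P V a) ⊗ₜ y)) =
      mulLast V ((P ⊗[ℂ] H) ⊗[ℂ] H)
        ((Algebra.TensorProduct.includeLeft :
          P ⊗[ℂ] H →ₐ[ℂ] (P ⊗[ℂ] H) ⊗[ℂ] H).toLinearMap.lTensor V a ⊗ₜ comulLast H P y) := by
  induction a with
  | zero => simp
  | add a b ha hb => simp only [TensorProduct.add_tmul, map_add, ha, hb]
  | tmul v c =>
  induction c with
  | zero => simp
  | add a b ha hb => simp only [TensorProduct.add_tmul, TensorProduct.tmul_add, map_add, ha, hb]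
  | tmul p h =>
  induction y with
  | zero => simp
  | add a b ha hb => simp only [TensorProduct.tmul_add, map_add, ha, hb]
  | tmul q k =>
    have h1 : (q ⊗ₜ[ℂ] k : P ⊗[ℂ] H) = (q ⊗ₜ 1) * (1 ⊗ₜ k) := by simp
    have h2 : mulLast (V ⊗[ℂ] H) (P ⊗[ℂ] H) ((tmulOne H P).lTensor (V ⊗[ℂ] H)
        (moveLast H P V (v ⊗ₜ (p ⊗ₜ h))) ⊗ₜ (q ⊗ₜ k)) = (v ⊗ₜ h) ⊗ₜ ((p * q) ⊗ₜ k) := by simp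
    rw [h2, mulComulLast_tmul, h1, comulLast_mul]
    simp [← mul_assoc]

/-- `v ⊗ (p ⊗ h) ↦ v₀ ⊗ ((p₀ ⊗ v₁ * p₁) ⊗ h)`. -/
def diagFirst (δ : V →ₗ[ℂ] V ⊗[ℂ] H) :
    V ⊗[ℂ] (P ⊗[ℂ] H) →ₗ[ℂ] V ⊗[ℂ] ((P ⊗[ℂ] H) ⊗[ℂ] H) :=
  (TensorProduct.assoc ℂ V (P ⊗[ℂ] H) H).toLinearMap ∘ₗ (diag δ).rTensor H ∘ₗ
    (TensorProduct.assoc ℂ V P H).symm.toLinearMap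

/-- Both sides are the coaction of `z * q` with a spectator leg in `H`: this is `diag_mulLast` for
the first leg `q` of `y`. -/
theorem mulLast_diag_eq (δ : V →ₗ[ℂ] V ⊗[ℂ] H) (z : V ⊗[ℂ] P) (y : P ⊗[ℂ] H) :
    mulLast V ((P ⊗[ℂ] H) ⊗[ℂ] H) ((Algebra.TensorProduct.includeLeft :
          P ⊗[ℂ] H →ₐ[ℂ] (P ⊗[ℂ] H) ⊗[ℂ] H).toLinearMap.lTensor V (diag δ z) ⊗ₜ
        (coactLin H P).rTensor H y) =
      diagFirst δ (mulLast V (P ⊗[ℂ] H) ((tmulOne H P).lTensor V z ⊗ₜ y)) := by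
  induction y with
  | zero => simp
  | add a b ha hb => simp only [TensorProduct.tmul_add, map_add, ha, hb]
  | tmul q k =>
  have h1 : mulLast V (P ⊗[ℂ] H) ((tmulOne H P).lTensor V z ⊗ₜ (q ⊗ₜ k)) =
      TensorProduct.assoc ℂ V P H (mulLast V P (z ⊗ₜ q) ⊗ₜ k) := by
    induction z with
    | zero => simp
    | add a b ha hb => simp only [TensorProduct.add_tmul, map_add, ha, hb]
    | tmul v p => simp
  rw [h1, diagFirst, LinearMap.comp_apply, LinearMap.comp_apply, LinearEquiv.coe_coe,
    LinearEquiv.coe_coe, LinearEquiv.symm_apply_apply, LinearMap.rTensor_tmul,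
    LinearMap.rTensor_tmul, diag_mulLast, AlgHom.toLinearMap_apply]
  generalize diag δ z = a
  generalize ComoduleAlgebra.coact (H := H) q = y
  induction a with
  | zero => simp
  | add a b ha hb => simp only [TensorProduct.add_tmul, map_add, ha, hb]
  | tmul v c => simp

theorem mulLast_comulLast (z : V ⊗[ℂ] P) (y : P ⊗[ℂ] H) :
    mulLast V ((P ⊗[ℂ] H) ⊗[ℂ] H) ((Algebra.TensorProduct.includeLeft :
          P ⊗[ℂ] H →ₐ[ℂ] (P ⊗[ℂ] H) ⊗[ℂ] H).toLinearMap.lTensor V ((tmulOne H P).lTensor V z) ⊗ₜ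
        comulLast H P y) =
      (comulLast H P).lTensor V (mulLast V (P ⊗[ℂ] H) ((tmulOne H P).lTensor V z ⊗ₜ y)) := by
  induction z with
  | zero => simp
  | add a b ha hb => simp only [TensorProduct.add_tmul, map_add, ha, hb]
  | tmul v p =>
    rw [LinearMap.lTensor_tmul, LinearMap.lTensor_tmul, mulLast_tmul, mulLast_tmul,
      LinearMap.lTensor_tmul]
    exact congrArg (v ⊗ₜ ·) (comulLast_mul p y).symm

/-- The defect of coinvariance `z ↦ z₀ ⊗ z₁ - z ⊗ 1` of elements of `V ⊗ P`. -/
def coinvDefect (δ : V →ₗ[ℂ] V ⊗[ℂ] H) : V ⊗[ℂ] P →ₗ[ℂ] (V ⊗[ℂ] H) ⊗[ℂ] P :=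
  (moveLast H P V).toLinearMap ∘ₗ (diag δ - (tmulOne H P).lTensor V)

theorem coinvDefect_eq_zero {δ : V →ₗ[ℂ] V ⊗[ℂ] H} {z : V ⊗[ℂ] P} :
    coinvDefect δ z = 0 ↔ diag δ z = (tmulOne H P).lTensor V z := by
  rw [coinvDefect, LinearMap.comp_apply, LinearEquiv.coe_coe, LinearEquiv.map_eq_zero_iff,
    LinearMap.sub_apply, sub_eq_zero]

/-- Elements of `B` contribute only `1` to the `H`-leg, so both terms of the defect commute with
right multiplication by them. Flatness can therefore be applied to the defect. -/
theorem coinvDefect_coinvAct (δ : V →ₗ[ℂ] V ⊗[ℂ] H) (b : coinvariants H P) (z : V ⊗[ℂ] P) :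
    coinvDefect δ (coinvAct H P V b z) = coinvAct H P (V ⊗[ℂ] H) b (coinvDefect δ z) := by
  have h1 : ∀ a : V ⊗[ℂ] (P ⊗[ℂ] H), moveLast H P V (mulLast V (P ⊗[ℂ] H) (a ⊗ₜ ((b : P) ⊗ₜ 1))) =
      coinvAct H P (V ⊗[ℂ] H) b (moveLast H P V a) := by
    intro a
    induction a with
    | zero => simp
    | add a b ha hb => simp only [TensorProduct.add_tmul, map_add, ha, hb]
    | tmul v c =>
    induction c with
    | zero => simp
    | add a b ha hb => simp only [TensorProduct.add_tmul, TensorProduct.tmul_add, map_add, ha, hb]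
    | tmul p h => simp
  have h2 : (tmulOne H P).lTensor V (mulLast V P (z ⊗ₜ (b : P))) =
      mulLast V (P ⊗[ℂ] H) ((tmulOne H P).lTensor V z ⊗ₜ ((b : P) ⊗ₜ 1)) := by
    induction z with
    | zero => simp
    | add a b ha hb => simp only [TensorProduct.add_tmul, map_add, ha, hb]
    | tmul v p => simp
  rw [coinvDefect, LinearMap.comp_apply, LinearMap.comp_apply, ← mulLast_eq_lTensor,
    LinearMap.sub_apply, diag_mulLast, h2, coact_coinvariant, ← map_sub, ← TensorProduct.sub_tmul]
  exact h1 _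

/-- Coinvariance tensored with `P` becomes a condition in `V ⊗ P ⊗ H`. For `t = z ⊗ x` the two terms
are `z₀ x₀ ⊗ z₁ x₁ ⊗ x₂` and `z x₀ ⊗ x₁ ⊗ x₂`. They come from `z x₀ ⊗ x₁` by the diagonal coaction
and by the coproduct of `H`, respectively. -/
theorem mulComulLast_chi_coinvDefect (hG : IsHopfGalois H P) (δ : V →ₗ[ℂ] V ⊗[ℂ] H)
    (t : BalancedTensor (coinvAct H P V) (coinvLeft H P)) :
    mulComulLast H P V (chi H P (V ⊗[ℂ] H) hG (BalancedTensor.map (σ' := coinvLeft H P)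
        (coinvDefect δ) LinearMap.id (coinvDefect_coinvAct δ) (fun _ _ => rfl) t)) =
      diagFirst δ (chi H P V hG t) - (comulLast H P).lTensor V (chi H P V hG t) := by
  obtain ⟨t, rfl⟩ := Submodule.mkQ_surjective _ t
  induction t with
  | zero => simp
  | add a b ha hb =>
    simp only [map_add, ha, hb]
    abel
  | tmul z x =>
    have h1 : mulComulLast H P V (chi H P (V ⊗[ℂ] H) hG (BalancedTensor.mk _ _
        (coinvDefect δ z ⊗ₜ x))) = diagFirst δ (chi H P V hG (BalancedTensor.mk _ _ (z ⊗ₜ x))) -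
      (comulLast H P).lTensor V (chi H P V hG (BalancedTensor.mk _ _ (z ⊗ₜ x))) := by
      rw [chi_mk, chi_mk, ← mulLast_diag_eq, ← mulLast_comulLast, rTensor_coact_coact, ← map_sub,
        ← TensorProduct.sub_tmul, ← map_sub, ← LinearMap.sub_apply, ← mulComulLast_mul]
      rfl
    exact h1

/-- `v ⊗ p * ε(h)` for `v ⊗ (p ⊗ h)`. -/
theorem mulBalanced_eq_counit_chi (hG : IsHopfGalois H P)
    (t : BalancedTensor (coinvAct H P V) (coinvLeft H P)) :
    mulBalanced H P V t = ((TensorProduct.rid ℂ P).toLinearMap ∘ₗ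
      (Coalgebra.counit (R := ℂ) (A := H)).lTensor P).lTensor V (chi H P V hG t) := by
  obtain ⟨t, rfl⟩ := Submodule.mkQ_surjective _ t
  induction t with
  | zero => simp
  | add a b ha hb => simp only [map_add, ha, hb]
  | tmul z x =>
    refine Eq.trans ?_ (congrArg _ (chi_mk hG z x).symm)
    change mulLast V P _ = _
    induction z with
    | zero => simp
    | add a b ha hb => simp only [TensorProduct.add_tmul, map_add, ha, hb]
    | tmul v p =>
      have h1 : ∀ y : P ⊗[ℂ] H, TensorProduct.rid ℂ P ((Coalgebra.counit (R := ℂ) (A := H)).lTensor P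
          ((p ⊗ₜ 1) * y)) =
          p * TensorProduct.rid ℂ P ((Coalgebra.counit (R := ℂ) (A := H)).lTensor P y) := by
        intro y
        induction y with
        | zero => simp
        | add a b ha hb => simp only [mul_add, map_add, ha, hb]
        | tmul q k => simp
      rw [mulLast_tmul, LinearMap.lTensor_tmul, mulLast_tmul, LinearMap.lTensor_tmul]
      refine congrArg (v ⊗ₜ ·) ?_
      refine Eq.trans ?_ (h1 _).symm
      rw [ComoduleAlgebra.coact_counit]

end Surjectivity

/-! ### Surjectivity of the action map for `P ⊗ P` -/

section Bijectivity

variable {H : Type v} {P : Type u} [Ring H] [HopfAlgebra ℂ H] [Ring P] [Algebra ℂ P]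
  [ComoduleAlgebra H P] {M : Type u} [AddCommGroup M] [Module ℂ M]
  {ρ : coinvariants H P → M →ₗ[ℂ] M}

/-- The element `p₀ ⊗ τ(p₁)` of `(P ⊗ P) ⊗_B P` is a preimage of `p ⊗ 1` under multiplication.
Coassociativity makes its defect vanish, so by flatness it comes from coinvariants. -/
theorem actMap_surjective (hG : IsHopfGalois H P)
    (hF : IsFaithfullyFlat.{max u v} (coinvariants H P) P) (f : M →ₗ[ℂ] P ⊗[ℂ] P)
    (hf : ∀ b m, f (ρ b m) = coinvAct H P P b (f m))
    (hc : ∀ z, diag (coactLin H P) z = (tmulOne H P).lTensor P z → ∃ m, f m = z) :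
    Function.Surjective (actMap f hf) := by
  let u : P ⊗[ℂ] H →ₗ[ℂ] P ⊗[ℂ] (P ⊗[ℂ] H) := (TensorProduct.mk ℂ P H 1).lTensor P
  have h1 : ∀ p : P, p ⊗ₜ[ℂ] (1 : P) ∈ LinearMap.range (actMap f hf) := by
    intro p
    -- This is `p₀ ⊗ τ(p₁)`: its image under `chi` is `p₀ ⊗ (1 ⊗ p₁)`.
    set t := (chi H P P hG).symm (u (ComoduleAlgebra.coact p)) with ht
    have ht' : chi H P P hG t = u (ComoduleAlgebra.coact p) := LinearEquiv.apply_symm_apply _ _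
    have h2 : ∀ y : P ⊗[ℂ] H, diagFirst (coactLin H P) (u y) =
        ((TensorProduct.mk ℂ P H 1).rTensor H).lTensor P
          (TensorProduct.assoc ℂ P H H ((coactLin H P).rTensor H y)) := by
      intro y
      induction y with
      | zero => simp
      | add a b ha hb => simp only [map_add, ha, hb]
      | tmul q k =>
        simp only [u, diagFirst, LinearMap.comp_apply, LinearMap.lTensor_tmul, LinearEquiv.coe_coe,
          TensorProduct.mk_apply, TensorProduct.assoc_symm_tmul, LinearMap.rTensor_tmul, diag_tmul,
          AlgHom.toLinearMap_apply, map_one]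
        generalize ComoduleAlgebra.coact (H := H) q = y
        induction y with
        | zero => simp
        | add a b ha hb => simp only [TensorProduct.add_tmul, map_add, ha, hb]
        | tmul q k => simp [Algebra.TensorProduct.one_def]
    have h3 : ∀ y : P ⊗[ℂ] H, (comulLast H P).lTensor P (u y) =
        ((TensorProduct.mk ℂ P H 1).rTensor H).lTensor P
          ((Coalgebra.comul (R := ℂ)).lTensor P y) := by
      intro y
      induction y with
      | zero => simp
      | add a b ha hb => simp only [map_add, ha, hb]
      | tmul q k =>
        simp only [u, comulLast, LinearMap.comp_apply, LinearMap.lTensor_tmul, LinearEquiv.coe_coe,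
          TensorProduct.mk_apply]
        generalize Coalgebra.comul (R := ℂ) k = y
        induction y with
        | zero => simp
        | add a b ha hb => simp only [TensorProduct.tmul_add, map_add, ha, hb]
        | tmul q k => simp
    -- Seen through `chi` and `mulComulLast`, the defect is the difference of two forms of `p₀ ⊗ (1
    -- ⊗ p₁) ⊗ p₂`, one from the iterated coaction and one from the coproduct.
    have h4 : BalancedTensor.map (σ' := coinvLeft H P) (coinvDefect (coactLin H P)) LinearMap.id
        (coinvDefect_coinvAct (coactLin H P)) (fun _ _ => rfl) t = 0 := by
      apply (chi H P (P ⊗[ℂ] H) hG).injective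
      apply mulComulLast_injective H P P
      rw [mulComulLast_chi_coinvDefect, ht', h2, h3, ← ComoduleAlgebra.coact_coassoc, sub_self,
        map_zero, map_zero]
    obtain ⟨y, hy⟩ := hF.exists_of_map_eq_zero.{u, v} (fun _ _ => rfl)
      ((isRightAction_coinvRight H P).lTensor P)
      ((isRightAction_coinvRight H P).lTensor (P ⊗[ℂ] H)) (coinvDefect (coactLin H P))
      (coinvDefect_coinvAct (coactLin H P)) t h4
    -- Multiplying out is `chi` followed by the counit, so this is `p₀ ε(p₁) = p`.
    have h5 : mulBalanced H P P t = p ⊗ₜ 1 := by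
      rw [mulBalanced_eq_counit_chi hG, ht']
      have h6 : ∀ y : P ⊗[ℂ] H, ((TensorProduct.rid ℂ P).toLinearMap ∘ₗ
          (Coalgebra.counit (R := ℂ) (A := H)).lTensor P).lTensor P (u y) =
          TensorProduct.rid ℂ P ((Coalgebra.counit (R := ℂ) (A := H)).lTensor P y) ⊗ₜ 1 := by
        intro y
        induction y with
        | zero => simp
        | add a b ha hb => simp only [map_add, TensorProduct.add_tmul, ha, hb]
        | tmul q k => simp [u, TensorProduct.smul_tmul]
      rw [h6, ComoduleAlgebra.coact_counit]
    rw [← h5, ← hy]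
    clear hy h5 h4 ht ht' t
    induction y with
    | zero => simp
    | add a b ha hb =>
      simp only [map_add]
      exact add_mem ha hb
    | tmul k x =>
      obtain ⟨m, hm⟩ := hc k.1 (coinvDefect_eq_zero.1 k.2)
      refine ⟨BalancedTensor.mk _ _ (m ⊗ₜ x), ?_⟩
      rw [actMap_mk, hm]
      rfl
  -- The range is stable under right multiplication by `P`, so the elements `p ⊗ 1` suffice.
  have h7 : ∀ z ∈ LinearMap.range (actMap f hf), ∀ x : P,
      mulLast P P (z ⊗ₜ x) ∈ LinearMap.range (actMap f hf) := by
    rintro _ ⟨t, rfl⟩ x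
    obtain ⟨t, rfl⟩ := Submodule.mkQ_surjective _ t
    induction t with
    | zero => simp
    | add a b ha hb =>
      simp only [map_add, TensorProduct.add_tmul]
      exact add_mem ha hb
    | tmul m y =>
      refine ⟨BalancedTensor.mk _ _ (m ⊗ₜ (y * x)), ?_⟩
      rw [actMap_mk, mulLast_mul]
      rfl
  rw [← LinearMap.range_eq_top, eq_top_iff]
  rintro z -
  induction z with
  | zero => simp
  | add a b ha hb => exact add_mem ha hb
  | tmul p x =>
    have := h7 _ (h1 p) x
    rwa [mulLast_tmul, one_mul] at this

end Bijectivity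

/-! ### Iterated balanced products tensored with `P` -/

section Iteration

variable {H : Type v} {P : Type u} [Ring H] [HopfAlgebra ℂ H] [Ring P] [Algebra ℂ P]
  [ComoduleAlgebra H P] {M N V W : Type*} [AddCommGroup M] [Module ℂ M] [AddCommGroup N]
  [Module ℂ N] [AddCommGroup V] [Module ℂ V] [AddCommGroup W] [Module ℂ W]
  {ρ : coinvariants H P → M →ₗ[ℂ] M} {σ τ : coinvariants H P → N →ₗ[ℂ] N}

/-- If `M ⊗_B P ≅ V` and `N ⊗_B P ≅ P ⊗ W` then `(M ⊗_B N) ⊗_B P ≅ V ⊗ W`. -/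
def tensorIso (hc : ∀ a b n, τ b (σ a n) = σ a (τ b n))
    (φ : BalancedTensor ρ (coinvLeft H P) ≃ₗ[ℂ] V)
    (θ : BalancedTensor τ (coinvLeft H P) ≃ₗ[ℂ] P ⊗[ℂ] W)
    (hθ : ∀ a z, θ (BalancedTensor.actLeft (coinvLeft H P) hc a z) =
      (coinvLeft H P a).rTensor W (θ z)) :
    BalancedTensor (BalancedTensor.actRight ρ hc) (coinvLeft H P) ≃ₗ[ℂ] V ⊗[ℂ] W :=
  BalancedTensor.assoc ρ (coinvLeft H P) hc ≪≫ₗ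
    BalancedTensor.congr (.refl ℂ M) θ (fun _ _ => rfl) hθ ≪≫ₗ
    BalancedTensor.assocRight ρ (coinvLeft H P) W ≪≫ₗ φ.rTensor W

theorem tensorIso_mk (hc : ∀ a b n, τ b (σ a n) = σ a (τ b n))
    (φ : BalancedTensor ρ (coinvLeft H P) ≃ₗ[ℂ] V)
    (θ : BalancedTensor τ (coinvLeft H P) ≃ₗ[ℂ] P ⊗[ℂ] W)
    (hθ : ∀ a z, θ (BalancedTensor.actLeft (coinvLeft H P) hc a z) =
      (coinvLeft H P a).rTensor W (θ z)) (m : M) (n : N) (x : P) :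
    tensorIso hc φ θ hθ (BalancedTensor.mk _ _ (BalancedTensor.mk _ _ (m ⊗ₜ n) ⊗ₜ x)) =
      (φ.toLinearMap ∘ₗ BalancedTensor.mk _ _ ∘ₗ TensorProduct.mk ℂ M P m).rTensor W
        (θ (BalancedTensor.mk _ _ (n ⊗ₜ x))) := by
  have h1 : tensorIso hc φ θ hθ (BalancedTensor.mk _ _ (BalancedTensor.mk _ _ (m ⊗ₜ n) ⊗ₜ x)) =
      φ.rTensor W (BalancedTensor.assocRight ρ (coinvLeft H P) W
        (BalancedTensor.mk _ _ (m ⊗ₜ θ (BalancedTensor.mk _ _ (n ⊗ₜ x))))) := rfl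
  rw [h1]
  clear h1
  generalize θ (BalancedTensor.mk _ _ (n ⊗ₜ x)) = y
  induction y with
  | zero => simp
  | add a b ha hb => simp only [TensorProduct.tmul_add, map_add, ha, hb]
  | tmul p w => rfl

end Iteration

/-! ### Balanced squares of `(P ⊗ P)^{co H}` as coinvariants of `P ⊗ P ⊗ P` -/

section EhresmannSchauenburg

variable (H : Type v) (P : Type u) [Ring H] [HopfAlgebra ℂ H] [Ring P] [Algebra ℂ P]
  [ComoduleAlgebra H P]

/-- `(p ⊗ q) (r ⊗ u) = p * r ⊗ u * q`. -/
def flipMul : (P ⊗[ℂ] P) ⊗[ℂ] (P ⊗[ℂ] P) →ₗ[ℂ] P ⊗[ℂ] P :=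
  TensorProduct.map (LinearMap.mul' ℂ P)
      (LinearMap.mul' ℂ P ∘ₗ (TensorProduct.comm ℂ P P).toLinearMap) ∘ₗ
    (TensorProduct.tensorTensorTensorComm ℂ P P P P).toLinearMap

@[simp]
theorem flipMul_tmul (p q r u : P) :
    flipMul P ((p ⊗ₜ q) ⊗ₜ (r ⊗ₜ u)) = (p * r) ⊗ₜ (u * q) := rfl

/-- `(v ⊗ q) ⊗ (r ⊗ u) ↦ (v ⊗ q * r) ⊗ u`. -/
def mulMiddle (V : Type*) [AddCommGroup V] [Module ℂ V] :
    (V ⊗[ℂ] P) ⊗[ℂ] (P ⊗[ℂ] P) →ₗ[ℂ] (V ⊗[ℂ] P) ⊗[ℂ] P :=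
  (mulLast V P).rTensor P ∘ₗ (TensorProduct.assoc ℂ (V ⊗[ℂ] P) P P).symm.toLinearMap

@[simp]
theorem mulMiddle_tmul (V : Type*) [AddCommGroup V] [Module ℂ V] (z : V ⊗[ℂ] P) (r u : P) :
    mulMiddle P V (z ⊗ₜ (r ⊗ₜ u)) = mulLast V P (z ⊗ₜ r) ⊗ₜ u := rfl

/-- `(r ⊗ u) ⊗ (p ⊗ q) ↦ (p ⊗ r) ⊗ u * q`. -/
def mulOuter : (P ⊗[ℂ] P) ⊗[ℂ] (P ⊗[ℂ] P) →ₗ[ℂ] (P ⊗[ℂ] P) ⊗[ℂ] P :=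
  (TensorProduct.assoc ℂ P P P).symm.toLinearMap ∘ₗ (mulLast P P).lTensor P ∘ₗ
    (TensorProduct.leftComm ℂ (P ⊗[ℂ] P) P P).toLinearMap

@[simp]
theorem mulOuter_tmul (z : P ⊗[ℂ] P) (p q : P) :
    mulOuter P (z ⊗ₜ (p ⊗ₜ q)) = (TensorProduct.assoc ℂ P P P).symm (p ⊗ₜ mulLast P P (z ⊗ₜ q)) :=
  rfl

/-- The diagonal coaction of `P ⊗ P`. -/
abbrev coact₂ : P ⊗[ℂ] P →ₗ[ℂ] (P ⊗[ℂ] P) ⊗[ℂ] H :=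
  (TensorProduct.assoc ℂ P P H).symm.toLinearMap ∘ₗ diag (coactLin H P)

variable {H P}

/-- With `y = p ⊗ q` and `z = r ⊗ u` the coefficient in `H` is `p₁ q₁ r₁ u₁`. Coinvariance of `y`
removes `p₁ q₁`, and then coinvariance of `z` removes `r₁ u₁`. -/
theorem diag_mulMiddle {y z : P ⊗[ℂ] P}
    (hy : diag (coactLin H P) y = (tmulOne H P).lTensor P y)
    (hz : diag (coactLin H P) z = (tmulOne H P).lTensor P z) :
    diag (coact₂ H P) (mulMiddle P P (y ⊗ₜ z)) =
      (tmulOne H P).lTensor (P ⊗[ℂ] P) (mulMiddle P P (y ⊗ₜ z)) := by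
  have h1 : ∀ a c : P ⊗[ℂ] H, diagMul H P (P ⊗[ℂ] P) ((TensorProduct.assoc ℂ P P H).symm
      (mulLast P (P ⊗[ℂ] H) ((tmulOne H P).lTensor P y ⊗ₜ a)) ⊗ₜ c) =
      (mulLast P P ∘ₗ TensorProduct.mk ℂ (P ⊗[ℂ] P) P y).rTensor (P ⊗[ℂ] H)
        (diagMul H P P (a ⊗ₜ c)) := by
    intro a c
    induction a with
    | zero => simp
    | add a b ha hb => simp only [TensorProduct.add_tmul, TensorProduct.tmul_add, map_add, ha, hb]
    | tmul r h =>
    have h2 : (TensorProduct.assoc ℂ P P H).symm (mulLast P (P ⊗[ℂ] H)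
        ((tmulOne H P).lTensor P y ⊗ₜ (r ⊗ₜ h))) = mulLast P P (y ⊗ₜ r) ⊗ₜ h := by
      clear hy
      induction y with
      | zero => simp
      | add a b ha hb => simp only [TensorProduct.add_tmul, map_add, ha, hb]
      | tmul p q => simp
    rw [h2]
    induction c with
    | zero => simp
    | add a b ha hb => simp only [TensorProduct.tmul_add, map_add, ha, hb]
    | tmul u k => simp
  have h3 : ∀ z : P ⊗[ℂ] P, diag (coact₂ H P) (mulMiddle P P (y ⊗ₜ z)) =
      (mulLast P P ∘ₗ TensorProduct.mk ℂ (P ⊗[ℂ] P) P y).rTensor (P ⊗[ℂ] H)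
        (diag (coactLin H P) z) := by
    intro z
    induction z with
    | zero => simp
    | add a b ha hb => simp only [TensorProduct.tmul_add, map_add, ha, hb]
    | tmul r u =>
      rw [mulMiddle_tmul, diag_tmul, LinearMap.comp_apply, diag_mulLast, hy, LinearEquiv.coe_coe,
        h1, diag_tmul]
      rfl
  rw [h3, hz]
  clear hz
  induction z with
  | zero => simp
  | add a b ha hb => simp only [TensorProduct.tmul_add, map_add, ha, hb]
  | tmul r u => rfl

/-- With `y = r ⊗ u` and `z = p ⊗ q` the coefficient is `p₁ r₁ u₁ q₁`. The inner pair `r₁ u₁` is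
removed first by coinvariance of `y`, which leaves `p₁ q₁`. -/
theorem diag_mulOuter {y z : P ⊗[ℂ] P}
    (hy : diag (coactLin H P) y = (tmulOne H P).lTensor P y)
    (hz : diag (coactLin H P) z = (tmulOne H P).lTensor P z) :
    diag (coact₂ H P) (mulOuter P (y ⊗ₜ z)) =
      (tmulOne H P).lTensor (P ⊗[ℂ] P) (mulOuter P (y ⊗ₜ z)) := by
  let Λ : (P ⊗[ℂ] H) ⊗[ℂ] (P ⊗[ℂ] (P ⊗[ℂ] H)) →ₗ[ℂ] (P ⊗[ℂ] P) ⊗[ℂ] (P ⊗[ℂ] H) :=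
    (TensorProduct.assoc ℂ (P ⊗[ℂ] P) P H).toLinearMap ∘ₗ
      TensorProduct.map (TensorProduct.assoc ℂ P P P).symm.toLinearMap (LinearMap.mul' ℂ H) ∘ₗ
      (TensorProduct.tensorTensorTensorComm ℂ P H (P ⊗[ℂ] P) H).toLinearMap ∘ₗ
      (TensorProduct.assoc ℂ P P H).symm.toLinearMap.lTensor (P ⊗[ℂ] H)
  have hΛ : ∀ (p : P) (k : H) (r u : P) (h : H),
      Λ ((p ⊗ₜ k) ⊗ₜ (r ⊗ₜ (u ⊗ₜ h))) = (p ⊗ₜ r) ⊗ₜ (u ⊗ₜ (k * h)) := fun _ _ _ _ _ => rfl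
  have h1 : ∀ (p : P) (w : P ⊗[ℂ] P), diag (coact₂ H P)
      ((TensorProduct.assoc ℂ P P P).symm (p ⊗ₜ w)) =
      Λ (ComoduleAlgebra.coact p ⊗ₜ diag (coactLin H P) w) := by
    intro p w
    induction w with
    | zero => simp
    | add a b ha hb => simp only [TensorProduct.tmul_add, map_add, ha, hb]
    | tmul r u =>
      rw [TensorProduct.assoc_symm_tmul, diag_tmul, LinearMap.comp_apply, diag_tmul, diag_tmul,
        AlgHom.toLinearMap_apply, AlgHom.toLinearMap_apply]
      generalize ComoduleAlgebra.coact (H := H) p = a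
      generalize ComoduleAlgebra.coact (H := H) r = b
      generalize ComoduleAlgebra.coact (H := H) u = c
      induction a with
      | zero => simp
      | add a b ha hb => simp only [TensorProduct.add_tmul, map_add, ha, hb]
      | tmul p h =>
      induction b with
      | zero => simp
      | add a b ha hb => simp only [TensorProduct.add_tmul, TensorProduct.tmul_add, map_add, ha, hb]
      | tmul r k =>
      induction c with
      | zero => simp
      | add a b ha hb => simp only [TensorProduct.tmul_add, map_add, ha, hb]
      | tmul u l => simp [hΛ, mul_assoc]
  let ν : P ⊗[ℂ] (P ⊗[ℂ] H) →ₗ[ℂ] (P ⊗[ℂ] P) ⊗[ℂ] (P ⊗[ℂ] H) :=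
    (TensorProduct.assoc ℂ P P (P ⊗[ℂ] H)).symm.toLinearMap ∘ₗ
      (mulLast P (P ⊗[ℂ] H) ∘ₗ TensorProduct.mk ℂ _ _ ((tmulOne H P).lTensor P y)).lTensor P
  have hν : ∀ (p : P) (c : P ⊗[ℂ] H), ν (p ⊗ₜ c) = (TensorProduct.assoc ℂ P P (P ⊗[ℂ] H)).symm
      (p ⊗ₜ mulLast P (P ⊗[ℂ] H) ((tmulOne H P).lTensor P y ⊗ₜ c)) := fun _ _ => rfl
  have h2 : ∀ a c : P ⊗[ℂ] H, Λ (a ⊗ₜ mulLast P (P ⊗[ℂ] H) ((tmulOne H P).lTensor P y ⊗ₜ c)) =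
      ν (diagMul H P P (a ⊗ₜ c)) := by
    intro a c
    induction a with
    | zero => simp
    | add a b ha hb => simp only [TensorProduct.add_tmul, map_add, ha, hb]
    | tmul p h =>
    induction c with
    | zero => simp
    | add a b ha hb => simp only [TensorProduct.tmul_add, map_add, ha, hb]
    | tmul q k =>
    rw [diagMul_tmul, hν]
    clear hy hν ν h1
    induction y with
    | zero => simp
    | add a b ha hb => simp only [TensorProduct.add_tmul, TensorProduct.tmul_add, map_add, ha, hb]
    | tmul r u => simp [hΛ]
  have h3 : ∀ z : P ⊗[ℂ] P, diag (coact₂ H P) (mulOuter P (y ⊗ₜ z)) =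
      ν (diag (coactLin H P) z) := by
    intro z
    induction z with
    | zero => simp
    | add a b ha hb => simp only [TensorProduct.tmul_add, map_add, ha, hb]
    | tmul p q =>
      rw [mulOuter_tmul, h1, diag_mulLast, hy, h2]
      rfl
  rw [h3, hz]
  clear hz
  induction z with
  | zero => simp
  | add a b ha hb => simp only [TensorProduct.tmul_add, map_add, ha, hb]
  | tmul p q =>
    rw [LinearMap.lTensor_tmul, hν]
    clear h3 h2 hν h1 hΛ hy
    induction y with
    | zero => simp
    | add a b ha hb => simp only [TensorProduct.add_tmul, TensorProduct.tmul_add, map_add, ha, hb]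
    | tmul r u => simp

variable (H P) in
/-- `j` identifies the algebra `L` with the coinvariants of `P ⊗ P`, with the product
`(p ⊗ q) (r ⊗ u) = p * r ⊗ u * q`, in such a way that `s b = b ⊗ 1` and `t b = 1 ⊗ b`. -/
structure IsCoinvariantModel {L : Type*} [Ring L] [Algebra ℂ L] (j : L →ₗ[ℂ] P ⊗[ℂ] P)
    (s t : coinvariants H P → L) : Prop where
  injective : Function.Injective j
  diag_eq : ∀ X, diag (coactLin H P) (j X) = (tmulOne H P).lTensor P (j X)
  exists_eq : ∀ z, diag (coactLin H P) z = (tmulOne H P).lTensor P z → ∃ X, j X = z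
  one : j 1 = 1 ⊗ₜ 1
  mul : ∀ X Y, j (X * Y) = flipMul P (j X ⊗ₜ j Y)
  source : ∀ b, j (s b) = (b : P) ⊗ₜ 1
  target : ∀ b, j (t b) = 1 ⊗ₜ (b : P)

/-- Left multiplication by `t b`. -/
abbrev leftMul {A L : Type*} [Ring L] [Algebra ℂ L] (t : A → L) : A → L →ₗ[ℂ] L :=
  fun b => LinearMap.mulLeft ℂ (t b)

/-- Right multiplication by `t b`. -/
abbrev rightMul {A L : Type*} [Ring L] [Algebra ℂ L] (t : A → L) : A → L →ₗ[ℂ] L :=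
  fun b => LinearMap.mulRight ℂ (t b)

namespace IsCoinvariantModel

variable {L : Type u} [Ring L] [Algebra ℂ L] {j : L →ₗ[ℂ] P ⊗[ℂ] P} {s t : coinvariants H P → L}

theorem map_source_mul (hst : IsCoinvariantModel H P j s t) (b X) :
    j (s b * X) = (coinvLeft H P b).rTensor P (j X) := by
  rw [hst.mul, hst.source]
  induction j X with
  | zero => simp
  | add a b ha hb => simp only [TensorProduct.tmul_add, map_add, ha, hb]
  | tmul p q => simp

theorem map_target_mul (hst : IsCoinvariantModel H P j s t) (b X) :
    j (t b * X) = coinvAct H P P b (j X) := by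
  rw [hst.mul, hst.target]
  induction j X with
  | zero => simp
  | add a b ha hb => simp only [TensorProduct.tmul_add, map_add, ha, hb]
  | tmul p q => simp

theorem map_mul_target (hst : IsCoinvariantModel H P j s t) (X b) :
    j (X * t b) = (coinvLeft H P b).lTensor P (j X) := by
  rw [hst.mul, hst.target]
  induction j X with
  | zero => simp
  | add a b ha hb => simp only [TensorProduct.add_tmul, map_add, ha, hb]
  | tmul p q => simp

theorem source_comm_target (hst : IsCoinvariantModel H P j s t) (a b) : s a * t b = t b * s a := by
  apply hst.injective
  rw [hst.map_source_mul, hst.map_target_mul, hst.source, hst.target]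
  simp

theorem target_mul (hst : IsCoinvariantModel H P j s t) (a b) : t (a * b) = t b * t a := by
  apply hst.injective
  rw [hst.map_target_mul, hst.target, hst.target]
  simp

theorem isRightAction (hst : IsCoinvariantModel H P j s t) :
    IsRightAction (leftMul t) where
  one X := by
    apply hst.injective
    rw [LinearMap.mulLeft_apply, hst.map_target_mul]
    exact ((isRightAction_coinvRight H P).lTensor P).one _
  mul a b X := by
    simp only [LinearMap.mulLeft_apply, hst.target_mul, mul_assoc]
  add a b X := by
    apply hst.injective
    simp only [LinearMap.mulLeft_apply, map_add, hst.map_target_mul]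
    exact ((isRightAction_coinvRight H P).lTensor P).add _ _ _
  smul c a X := by
    apply hst.injective
    simp only [LinearMap.mulLeft_apply, map_smul, hst.map_target_mul]
    exact ((isRightAction_coinvRight H P).lTensor P).smul _ _ _

/-- `𝓛(P, H) ⊗_B P ≅ P ⊗ P`, `(p ⊗ q) ⊗ x ↦ p ⊗ q * x`. -/
def iso (hst : IsCoinvariantModel H P j s t) (hG : IsHopfGalois H P)
    (hF : IsFaithfullyFlat.{max u v} (coinvariants H P) P) :
    BalancedTensor (leftMul t) (coinvLeft H P) ≃ₗ[ℂ] P ⊗[ℂ] P :=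
  LinearEquiv.ofBijective (actMap j hst.map_target_mul)
    ⟨actMap_injective hG hF hst.isRightAction (coactLin H P) j hst.map_target_mul
      (hst.diag_eq) (hst.injective),
    actMap_surjective hG hF j hst.map_target_mul hst.exists_eq⟩

theorem iso_mk (hst : IsCoinvariantModel H P j s t) (hG : IsHopfGalois H P)
    (hF : IsFaithfullyFlat.{max u v} (coinvariants H P) P) (X : L) (x : P) :
    hst.iso hG hF (BalancedTensor.mk _ _ (X ⊗ₜ x)) = mulLast P P (j X ⊗ₜ x) := rfl

theorem target_mul_source_mul (hst : IsCoinvariantModel H P j s t) (a b) (X : L) :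
    leftMul t b (leftMul s a X) =
      leftMul s a (leftMul t b X) := by
  simp only [LinearMap.mulLeft_apply, ← mul_assoc, hst.source_comm_target]

/-- Left `B`-linearity of `iso`: it allows one copy of `L ⊗_B P` to be replaced by `P ⊗ P` inside a
further balanced product. -/
theorem iso_actLeft_source (hst : IsCoinvariantModel H P j s t) (hG : IsHopfGalois H P)
    (hF : IsFaithfullyFlat.{max u v} (coinvariants H P) P) (a z) :
    hst.iso hG hF (BalancedTensor.actLeft (coinvLeft H P) hst.target_mul_source_mul a z) =
      (coinvLeft H P a).rTensor P (hst.iso hG hF z) := by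
  refine LinearMap.congr_fun (f := (hst.iso hG hF).toLinearMap ∘ₗ _)
    (g := (coinvLeft H P a).rTensor P ∘ₗ (hst.iso hG hF).toLinearMap)
    (BalancedTensor.hom_ext fun X x => ?_) z
  have h1 : mulLast P P (j (s a * X) ⊗ₜ x) =
      (coinvLeft H P a).rTensor P (mulLast P P (j X ⊗ₜ x)) := by
    rw [hst.map_source_mul]
    induction j X with
    | zero => simp
    | add a b ha hb => simp only [TensorProduct.add_tmul, map_add, ha, hb]
    | tmul p q => simp
  exact h1

/-- `𝓛 ⊗_B 𝓛 → (P ⊗ P) ⊗ P`, `(p ⊗ q) ⊗ (r ⊗ u) ↦ (p ⊗ q * r) ⊗ u`. -/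
def pairMap (hst : IsCoinvariantModel H P j s t) :
    BalancedTensor (leftMul t) (leftMul s) →ₗ[ℂ]
      (P ⊗[ℂ] P) ⊗[ℂ] P :=
  BalancedTensor.lift (mulMiddle P P ∘ₗ TensorProduct.map j j)
    (fun b X Y => by
      simp only [LinearMap.comp_apply, TensorProduct.map_tmul, LinearMap.mulLeft_apply,
        hst.map_source_mul, hst.map_target_mul]
      induction j X with
      | zero => simp
      | add a b ha hb => simp only [TensorProduct.add_tmul, map_add, ha, hb]
      | tmul p q =>
      induction j Y with
      | zero => simp
      | add a b ha hb => simp only [TensorProduct.tmul_add, map_add, ha, hb]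
      | tmul r u => simp [mul_assoc])

theorem pairMap_mk (hst : IsCoinvariantModel H P j s t) (d) :
    hst.pairMap (BalancedTensor.mk _ _ d) =
      mulMiddle P P (TensorProduct.map j j d) := rfl

/-- The right `B`-module structure of `𝓛 ⊗_B 𝓛`. -/
abbrev pairAct (hst : IsCoinvariantModel H P j s t) :=
  BalancedTensor.actRight (leftMul t) hst.target_mul_source_mul

theorem pairMap_pairAct (hst : IsCoinvariantModel H P j s t) (b z) :
    hst.pairMap (hst.pairAct b z) = coinvAct H P (P ⊗[ℂ] P) b (hst.pairMap z) := by
  refine LinearMap.congr_fun (f := hst.pairMap ∘ₗ hst.pairAct b)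
    (g := coinvAct H P (P ⊗[ℂ] P) b ∘ₗ hst.pairMap) (BalancedTensor.hom_ext fun X Y => ?_) z
  have h1 : mulMiddle P P (j X ⊗ₜ j (t b * Y)) =
      coinvAct H P (P ⊗[ℂ] P) b (mulMiddle P P (j X ⊗ₜ j Y)) := by
    rw [hst.map_target_mul]
    induction j Y with
    | zero => simp
    | add a b ha hb => simp only [TensorProduct.tmul_add, map_add, ha, hb]
    | tmul r u => simp
  exact h1

/-- `(𝓛 ⊗_B 𝓛) ⊗_B P ≅ (P ⊗ P) ⊗ P`. -/
def pairIso (hst : IsCoinvariantModel H P j s t) (hG : IsHopfGalois H P)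
    (hF : IsFaithfullyFlat.{max u v} (coinvariants H P) P) :
    BalancedTensor hst.pairAct (coinvLeft H P) ≃ₗ[ℂ] (P ⊗[ℂ] P) ⊗[ℂ] P :=
  tensorIso hst.target_mul_source_mul (hst.iso hG hF) (hst.iso hG hF)
    (hst.iso_actLeft_source hG hF)

/-- The action map of `pairMap` is the composite `(L ⊗_B L) ⊗_B P ≅ L ⊗_B (P ⊗ P) ≅ (P ⊗ P) ⊗ P`,
which is bijective by construction. -/
theorem pairIso_eq (hst : IsCoinvariantModel H P j s t) (hG : IsHopfGalois H P)
    (hF : IsFaithfullyFlat.{max u v} (coinvariants H P) P) :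
    actMap hst.pairMap hst.pairMap_pairAct = (hst.pairIso hG hF).toLinearMap := by
  refine BalancedTensor.hom_ext fun z x => ?_
  obtain ⟨z, rfl⟩ := Submodule.mkQ_surjective _ z
  induction z with
  | zero => simp
  | add a b ha hb => simp only [TensorProduct.add_tmul, map_add, ha, hb]
  | tmul X Y =>
    rw [actMap_mk, LinearEquiv.coe_coe, pairIso]
    refine Eq.trans ?_ (tensorIso_mk hst.target_mul_source_mul (hst.iso hG hF) (hst.iso hG hF)
      (hst.iso_actLeft_source hG hF) X Y x).symm
    rw [iso_mk]
    change mulLast (P ⊗[ℂ] P) P (mulMiddle P P (j X ⊗ₜ j Y) ⊗ₜ x) = _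
    induction j Y with
    | zero => simp
    | add a b ha hb => simp only [TensorProduct.add_tmul, TensorProduct.tmul_add, map_add, ha, hb]
    | tmul r u => rfl

theorem diag_pairMap (hst : IsCoinvariantModel H P j s t) (z) : diag (coact₂ H P) (hst.pairMap z) =
    (tmulOne H P).lTensor (P ⊗[ℂ] P) (hst.pairMap z) := by
  obtain ⟨z, rfl⟩ := Submodule.mkQ_surjective _ z
  induction z with
  | zero => simp
  | add a b ha hb => simp only [map_add, ha, hb]
  | tmul X Y => exact diag_mulMiddle (hst.diag_eq X) (hst.diag_eq Y)

/-- Descent for `M = L ⊗_B L` and `V = P ⊗ P`. Equations in `L ⊗_B L` may henceforth be checked in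
`P ⊗ P ⊗ P`, and coinvariants there define elements of `L ⊗_B L`. -/
theorem pairMap_injective_and_range (hst : IsCoinvariantModel H P j s t) (hG : IsHopfGalois H P)
    (hF : IsFaithfullyFlat.{max u v} (coinvariants H P) P) :
    Function.Injective hst.pairMap ∧ ∀ z : (P ⊗[ℂ] P) ⊗[ℂ] P,
      diag (coact₂ H P) z = (tmulOne H P).lTensor (P ⊗[ℂ] P) z → ∃ w, hst.pairMap w = z :=
  injective_and_range_of_actMap hG hF (hst.isRightAction.actRight _ _) (coact₂ H P) hst.pairMap
    hst.pairMap_pairAct hst.diag_pairMap (by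
      rw [hst.pairIso_eq hG hF]
      exact (hst.pairIso hG hF).bijective)

/-! ### The twisted product -/

theorem target_mul_mul_target (t : coinvariants H P → L) (a b)
    (X : L) :
    leftMul t b (rightMul t a X) =
      rightMul t a (leftMul t b X) :=
  (mul_assoc (t b) X (t a)).symm

/-- `𝓛(P, H) ⊗_B P ≅ P ⊗ P`, `(p ⊗ q) ⊗ x ↦ q * x ⊗ p`. -/
def isoSwap (hst : IsCoinvariantModel H P j s t) (hG : IsHopfGalois H P)
    (hF : IsFaithfullyFlat.{max u v} (coinvariants H P) P) :
    BalancedTensor (leftMul t) (coinvLeft H P) ≃ₗ[ℂ] P ⊗[ℂ] P :=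
  hst.iso hG hF ≪≫ₗ TensorProduct.comm ℂ P P

theorem isoSwap_mk (hst : IsCoinvariantModel H P j s t) (hG : IsHopfGalois H P)
    (hF : IsFaithfullyFlat.{max u v} (coinvariants H P) P) (X : L) (x : P) :
    hst.isoSwap hG hF (BalancedTensor.mk _ _ (X ⊗ₜ x)) =
      TensorProduct.comm ℂ P P (mulLast P P (j X ⊗ₜ x)) := rfl

/-- Right multiplication by `t a` acts on the second leg of `L`. The swap brings that leg to the
front, where `tensorIso` expects the left action of `B`. -/
theorem isoSwap_actLeft_target (hst : IsCoinvariantModel H P j s t) (hG : IsHopfGalois H P)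
    (hF : IsFaithfullyFlat.{max u v} (coinvariants H P) P) (a z) :
    hst.isoSwap hG hF (BalancedTensor.actLeft (coinvLeft H P) (target_mul_mul_target t) a z) =
      (coinvLeft H P a).rTensor P (hst.isoSwap hG hF z) := by
  refine LinearMap.congr_fun (f := (hst.isoSwap hG hF).toLinearMap ∘ₗ _)
    (g := (coinvLeft H P a).rTensor P ∘ₗ (hst.isoSwap hG hF).toLinearMap)
    (BalancedTensor.hom_ext fun X x => ?_) z
  have h1 : TensorProduct.comm ℂ P P (mulLast P P (j (X * t a) ⊗ₜ x)) =
      (coinvLeft H P a).rTensor P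
        (TensorProduct.comm ℂ P P (mulLast P P (j X ⊗ₜ x))) := by
    rw [hst.map_mul_target]
    induction j X with
    | zero => simp
    | add a b ha hb => simp only [TensorProduct.add_tmul, map_add, ha, hb]
    | tmul p q => simp [mul_assoc]
  exact h1

/-- `(r ⊗ u) ⊗ (p ⊗ q) ↦ (p ⊗ r) ⊗ u * q` on `𝓛 ⊗ 𝓛` modulo `t b * Y ⊗ X = Y ⊗ X * t b`. -/
def outerMap (hst : IsCoinvariantModel H P j s t) :
    BalancedTensor (leftMul t) (rightMul t) →ₗ[ℂ]
      (P ⊗[ℂ] P) ⊗[ℂ] P :=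
  BalancedTensor.lift (mulOuter P ∘ₗ TensorProduct.map j j)
    (fun b Y X => by
      simp only [LinearMap.comp_apply, TensorProduct.map_tmul, LinearMap.mulLeft_apply,
        LinearMap.mulRight_apply, hst.map_mul_target, hst.map_target_mul]
      induction j X with
      | zero => simp
      | add a b ha hb => simp only [TensorProduct.tmul_add, map_add, ha, hb]
      | tmul p q =>
      induction j Y with
      | zero => simp
      | add a b ha hb => simp only [TensorProduct.add_tmul, map_add, ha, hb]
      | tmul r u => simp [mul_assoc])

theorem outerMap_mk (hst : IsCoinvariantModel H P j s t) (d) :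
    hst.outerMap (BalancedTensor.mk _ _ d) =
      mulOuter P (TensorProduct.map j j d) := rfl

/-- The right `B`-module structure of the twisted product. -/
abbrev outerAct (_hst : IsCoinvariantModel H P j s t) :=
  BalancedTensor.actRight (leftMul t) (target_mul_mul_target t)

theorem outerMap_outerAct (hst : IsCoinvariantModel H P j s t) (b z) :
    hst.outerMap (hst.outerAct b z) = coinvAct H P (P ⊗[ℂ] P) b (hst.outerMap z) := by
  refine LinearMap.congr_fun (f := hst.outerMap ∘ₗ hst.outerAct b)
    (g := coinvAct H P (P ⊗[ℂ] P) b ∘ₗ hst.outerMap) (BalancedTensor.hom_ext fun Y X => ?_) z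
  have h1 : mulOuter P (j Y ⊗ₜ j (t b * X)) =
      coinvAct H P (P ⊗[ℂ] P) b (mulOuter P (j Y ⊗ₜ j X)) := by
    rw [hst.map_target_mul]
    induction j X with
    | zero => simp
    | add a b ha hb => simp only [TensorProduct.tmul_add, map_add, ha, hb]
    | tmul p q =>
    induction j Y with
    | zero => simp
    | add a b ha hb => simp only [TensorProduct.add_tmul, map_add, ha, hb]
    | tmul r u => simp [mul_assoc]
  exact h1

/-- The twisted product tensored with `P` is isomorphic to `(P ⊗ P) ⊗ P`. -/
def outerIso (hst : IsCoinvariantModel H P j s t) (hG : IsHopfGalois H P)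
    (hF : IsFaithfullyFlat.{max u v} (coinvariants H P) P) :
    BalancedTensor hst.outerAct (coinvLeft H P) ≃ₗ[ℂ] (P ⊗[ℂ] P) ⊗[ℂ] P :=
  tensorIso (target_mul_mul_target t) (hst.iso hG hF) (hst.isoSwap hG hF)
    (hst.isoSwap_actLeft_target hG hF) ≪≫ₗ
    (TensorProduct.comm ℂ (P ⊗[ℂ] P) P ≪≫ₗ (TensorProduct.assoc ℂ P P P).symm)

theorem outerIso_eq (hst : IsCoinvariantModel H P j s t) (hG : IsHopfGalois H P)
    (hF : IsFaithfullyFlat.{max u v} (coinvariants H P) P) :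
    actMap hst.outerMap hst.outerMap_outerAct = (hst.outerIso hG hF).toLinearMap := by
  refine BalancedTensor.hom_ext fun z x => ?_
  obtain ⟨z, rfl⟩ := Submodule.mkQ_surjective _ z
  induction z with
  | zero => simp
  | add a b ha hb => simp only [TensorProduct.add_tmul, map_add, ha, hb]
  | tmul Y X =>
    rw [actMap_mk, LinearEquiv.coe_coe, outerIso, LinearEquiv.trans_apply]
    refine Eq.trans ?_ (congrArg _ (tensorIso_mk (target_mul_mul_target t) (hst.iso hG hF)
      (hst.isoSwap hG hF) (hst.isoSwap_actLeft_target hG hF) Y X x)).symm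
    rw [isoSwap_mk]
    change mulLast (P ⊗[ℂ] P) P (mulOuter P (j Y ⊗ₜ j X) ⊗ₜ x) = _
    induction j X with
    | zero => simp
    | add a b ha hb => simp only [TensorProduct.add_tmul, TensorProduct.tmul_add, map_add, ha, hb]
    | tmul p q =>
      have h1 : ∀ y : P ⊗[ℂ] P, mulLast (P ⊗[ℂ] P) P (mulOuter P (y ⊗ₜ (p ⊗ₜ q)) ⊗ₜ x) =
          (TensorProduct.assoc ℂ P P P).symm (p ⊗ₜ mulLast P P (y ⊗ₜ (q * x))) := by
        intro y
        induction y with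
        | zero => simp
        | add a b ha hb =>
          simp only [TensorProduct.add_tmul, TensorProduct.tmul_add, map_add, ha, hb]
        | tmul r u => simp [mul_assoc]
      rw [h1]
      rfl

theorem diag_outerMap (hst : IsCoinvariantModel H P j s t) (z) : diag (coact₂ H P) (hst.outerMap z) =
    (tmulOne H P).lTensor (P ⊗[ℂ] P) (hst.outerMap z) := by
  obtain ⟨z, rfl⟩ := Submodule.mkQ_surjective _ z
  induction z with
  | zero => simp
  | add a b ha hb => simp only [map_add, ha, hb]
  | tmul X Y => exact diag_mulOuter (hst.diag_eq X) (hst.diag_eq Y)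

/-- Descent as for `pairMap`, now for the source of the Galois map `λ` with its factors exchanged.
The target consists of the same coinvariants. -/
theorem outerMap_injective_and_range (hst : IsCoinvariantModel H P j s t) (hG : IsHopfGalois H P)
    (hF : IsFaithfullyFlat.{max u v} (coinvariants H P) P) :
    Function.Injective hst.outerMap ∧ ∀ z : (P ⊗[ℂ] P) ⊗[ℂ] P,
      diag (coact₂ H P) z = (tmulOne H P).lTensor (P ⊗[ℂ] P) z → ∃ w, hst.outerMap w = z :=
  injective_and_range_of_actMap hG hF (hst.isRightAction.actRight _ _) (coact₂ H P) hst.outerMap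
    hst.outerMap_outerAct hst.diag_outerMap (by
      rw [hst.outerIso_eq hG hF]
      exact (hst.outerIso hG hF).bijective)

end IsCoinvariantModel

end EhresmannSchauenburg

/-! ### Products in `L ⊗ L` computed in `P ⊗ P ⊗ P` -/

section InsertOne

variable (P : Type u) [Ring P] [Algebra ℂ P] (V : Type*) [AddCommGroup V] [Module ℂ V]

/-- `v ⊗ p ↦ (v ⊗ 1) ⊗ p`. -/
def insertOne : V ⊗[ℂ] P →ₗ[ℂ] (V ⊗[ℂ] P) ⊗[ℂ] P :=
  ((TensorProduct.mk ℂ V P).flip 1).rTensor P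

@[simp]
theorem insertOne_tmul (v : V) (p : P) : insertOne P V (v ⊗ₜ p) = (v ⊗ₜ 1) ⊗ₜ p := rfl

/-- `((a ⊗ b) ⊗ c) ⊗ ((p ⊗ q) ⊗ (r ⊗ u)) ↦ (a * p ⊗ q * b * r) ⊗ u * c`. -/
def mulAround : ((P ⊗[ℂ] P) ⊗[ℂ] P) ⊗[ℂ] ((P ⊗[ℂ] P) ⊗[ℂ] (P ⊗[ℂ] P)) →ₗ[ℂ] (P ⊗[ℂ] P) ⊗[ℂ] P :=
  TensorProduct.map
      (mulLast P P ∘ₗ (flipMul P).rTensor P ∘ₗ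
        (TensorProduct.assoc ℂ (P ⊗[ℂ] P) (P ⊗[ℂ] P) P).symm.toLinearMap)
      (LinearMap.mul' ℂ P ∘ₗ (TensorProduct.comm ℂ P P).toLinearMap) ∘ₗ
    (TensorProduct.tensorTensorTensorComm ℂ (P ⊗[ℂ] P) P ((P ⊗[ℂ] P) ⊗[ℂ] P) P).toLinearMap ∘ₗ
    (TensorProduct.assoc ℂ (P ⊗[ℂ] P) P P).symm.toLinearMap.lTensor ((P ⊗[ℂ] P) ⊗[ℂ] P)

@[simp]
theorem mulAround_tmul (a b c p q r u : P) :
    mulAround P (((a ⊗ₜ b) ⊗ₜ c) ⊗ₜ ((p ⊗ₜ q) ⊗ₜ (r ⊗ₜ u))) =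
      ((a * p) ⊗ₜ (q * b * r)) ⊗ₜ (u * c) := rfl

theorem mulAround_mulMiddle (x y z w : P ⊗[ℂ] P) :
    mulAround P (mulMiddle P P (x ⊗ₜ y) ⊗ₜ (z ⊗ₜ w)) =
      mulMiddle P P (flipMul P (x ⊗ₜ z) ⊗ₜ flipMul P (y ⊗ₜ w)) := by
  induction x with
  | zero => simp
  | add a b ha hb => simp only [TensorProduct.add_tmul, map_add, ha, hb]
  | tmul a b =>
  induction y with
  | zero => simp
  | add a b ha hb => simp only [TensorProduct.add_tmul, TensorProduct.tmul_add, map_add, ha, hb]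
  | tmul c d =>
  induction z with
  | zero => simp
  | add a b ha hb => simp only [TensorProduct.add_tmul, TensorProduct.tmul_add, map_add, ha, hb]
  | tmul p q =>
  induction w with
  | zero => simp
  | add a b ha hb => simp only [TensorProduct.tmul_add, map_add, ha, hb]
  | tmul r u => simp [mul_assoc]

/-- `(p ⊗ q) ⊗ ((a ⊗ b) ⊗ c) ↦ (p * a ⊗ b) ⊗ c * q`. -/
def mulEnds : (P ⊗[ℂ] P) ⊗[ℂ] ((P ⊗[ℂ] P) ⊗[ℂ] P) →ₗ[ℂ] (P ⊗[ℂ] P) ⊗[ℂ] P :=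
  TensorProduct.map
      ((LinearMap.mul' ℂ P).rTensor P ∘ₗ (TensorProduct.assoc ℂ P P P).symm.toLinearMap)
      (LinearMap.mul' ℂ P ∘ₗ (TensorProduct.comm ℂ P P).toLinearMap) ∘ₗ
    (TensorProduct.tensorTensorTensorComm ℂ P P (P ⊗[ℂ] P) P).toLinearMap

@[simp]
theorem mulEnds_tmul (p q a b c : P) :
    mulEnds P ((p ⊗ₜ q) ⊗ₜ ((a ⊗ₜ b) ⊗ₜ c)) = ((p * a) ⊗ₜ b) ⊗ₜ (c * q) := rfl

/-- With `1` in the middle leg of the left factor, the element `(p ⊗ q) ⊗ (r ⊗ u)` enters only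
through `p ⊗ qr ⊗ u`. This is why products with representatives of `Δ(X)` depend only on classes. -/
theorem mulAround_insertOne (x : P ⊗[ℂ] P) (z : (P ⊗[ℂ] P) ⊗[ℂ] (P ⊗[ℂ] P)) :
    mulAround P (insertOne P P x ⊗ₜ z) = mulEnds P (x ⊗ₜ mulMiddle P P z) := by
  induction z with
  | zero => simp
  | add a b ha hb => simp only [TensorProduct.tmul_add, map_add, ha, hb]
  | tmul y z =>
  induction x with
  | zero => simp
  | add a b ha hb => simp only [TensorProduct.add_tmul, map_add, ha, hb]
  | tmul a b =>
  induction y with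
  | zero => simp
  | add a b ha hb => simp only [TensorProduct.add_tmul, TensorProduct.tmul_add, map_add, ha, hb]
  | tmul c d =>
  induction z with
  | zero => simp
  | add a b ha hb => simp only [TensorProduct.tmul_add, map_add, ha, hb]
  | tmul p q => simp

theorem mulEnds_insertOne (x y : P ⊗[ℂ] P) :
    mulEnds P (x ⊗ₜ insertOne P P y) = insertOne P P (flipMul P (x ⊗ₜ y)) := by
  induction x with
  | zero => simp
  | add a b ha hb => simp only [TensorProduct.add_tmul, map_add, ha, hb]
  | tmul a b =>
  induction y with
  | zero => simp
  | add a b ha hb => simp only [TensorProduct.tmul_add, map_add, ha, hb]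
  | tmul c d => simp

end InsertOne

namespace IsCoinvariantModel

variable {H : Type v} {P : Type u} [Ring H] [HopfAlgebra ℂ H] [Ring P] [Algebra ℂ P]
  [ComoduleAlgebra H P] {L : Type u} [Ring L] [Algebra ℂ L] {j : L →ₗ[ℂ] P ⊗[ℂ] P}
  {s t : coinvariants H P → L}

/-! ### The counit -/

/-- Multiplication `P ⊗ P → P` is colinear because the coaction is an algebra map, so it takes
coinvariants to coinvariants. -/
theorem mul'_mem_coinvariants {z : P ⊗[ℂ] P}
    (hz : diag (coactLin H P) z = (tmulOne H P).lTensor P z) :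
    LinearMap.mul' ℂ P z ∈ coinvariants H P := by
  have h1 : ∀ z : P ⊗[ℂ] P, ComoduleAlgebra.coact (H := H) (LinearMap.mul' ℂ P z) =
      (LinearMap.mul' ℂ P).rTensor H ((TensorProduct.assoc ℂ P P H).symm
        (diag (coactLin H P) z)) := by
    intro z
    induction z with
    | zero => simp
    | add a b ha hb => simp only [map_add, ha, hb]
    | tmul p q =>
      rw [diag_tmul, LinearMap.mul'_apply, map_mul, AlgHom.toLinearMap_apply]
      generalize ComoduleAlgebra.coact (H := H) p = a
      generalize ComoduleAlgebra.coact (H := H) q = c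
      induction a with
      | zero => simp
      | add a b ha hb => simp only [TensorProduct.add_tmul, map_add, add_mul, ha, hb]
      | tmul p h =>
      induction c with
      | zero => simp
      | add a b ha hb => simp only [TensorProduct.tmul_add, map_add, mul_add, ha, hb]
      | tmul q k => simp
  rw [mem_coinvariants, h1, hz]
  clear hz h1
  induction z with
  | zero => simp
  | add a b ha hb => simp only [TensorProduct.add_tmul, map_add, ha, hb]
  | tmul p q => simp

/-- `ε(p ⊗ q) = p * q`. -/
def counit (hst : IsCoinvariantModel H P j s t) : L →ₗ[ℂ] coinvariants H P :=
  (LinearMap.mul' ℂ P ∘ₗ j).codRestrict (coinvariants H P).toSubmodule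
    fun X => mul'_mem_coinvariants (hst.diag_eq X)

theorem counit_coe (hst : IsCoinvariantModel H P j s t) (X : L) :
    (hst.counit X : P) = LinearMap.mul' ℂ P (j X) := rfl

/-! ### The coproduct -/

theorem diag_insertOne {z : P ⊗[ℂ] P} (hz : diag (coactLin H P) z = (tmulOne H P).lTensor P z) :
    diag (coact₂ H P) (insertOne P P z) = (tmulOne H P).lTensor (P ⊗[ℂ] P) (insertOne P P z) := by
  have h1 : ∀ z : P ⊗[ℂ] P, diag (coact₂ H P) (insertOne P P z) =
      ((TensorProduct.mk ℂ P P).flip 1).rTensor (P ⊗[ℂ] H) (diag (coactLin H P) z) := by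
    intro z
    induction z with
    | zero => simp
    | add a b ha hb => simp only [map_add, ha, hb]
    | tmul p q =>
      rw [insertOne_tmul, diag_tmul, diag_tmul, LinearMap.comp_apply, diag_tmul,
        AlgHom.toLinearMap_apply, map_one]
      generalize ComoduleAlgebra.coact (H := H) p = a
      generalize ComoduleAlgebra.coact (H := H) q = c
      induction a with
      | zero => simp
      | add a b ha hb => simp only [TensorProduct.add_tmul, map_add, ha, hb]
      | tmul p h =>
      induction c with
      | zero => simp
      | add a b ha hb => simp only [TensorProduct.tmul_add, map_add, ha, hb]
      | tmul q k => simp [Algebra.TensorProduct.one_def]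
  rw [h1, hz]
  clear hz h1
  induction z with
  | zero => simp
  | add a b ha hb => simp only [map_add, ha, hb]
  | tmul p q => simp

section Galois

variable (hG : IsHopfGalois H P) (hF : IsFaithfullyFlat.{max u v} (coinvariants H P) P)

/-- The coproduct of the Ehresmann-Schauenburg bialgebroid. -/
def comul (hst : IsCoinvariantModel H P j s t) :
    L →ₗ[ℂ] BalancedTensor (leftMul t) (leftMul s) :=
  (LinearEquiv.ofInjective hst.pairMap
      (hst.pairMap_injective_and_range hG hF).1).symm.toLinearMap ∘ₗ
    (insertOne P P ∘ₗ j).codRestrict (LinearMap.range hst.pairMap) fun X =>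
      (hst.pairMap_injective_and_range hG hF).2 _ (diag_insertOne (hst.diag_eq X))

theorem pairMap_comul (hst : IsCoinvariantModel H P j s t) (X : L) :
    hst.pairMap (hst.comul hG hF X) = insertOne P P (j X) := by
  have := LinearEquiv.apply_symm_apply (LinearEquiv.ofInjective hst.pairMap
      (hst.pairMap_injective_and_range hG hF).1)
    ((insertOne P P ∘ₗ j).codRestrict (LinearMap.range hst.pairMap) (fun X =>
      (hst.pairMap_injective_and_range hG hF).2 _ (diag_insertOne (hst.diag_eq X))) X)
  exact congrArg Subtype.val this

theorem eq_comul_iff (hst : IsCoinvariantModel H P j s t) (z) (X : L) :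
    z = hst.comul hG hF X ↔ hst.pairMap z = insertOne P P (j X) := by
  rw [← hst.pairMap_comul hG hF, (hst.pairMap_injective_and_range hG hF).1.eq_iff]

/-- The working form of the coproduct: a tensor represents `Δ(p ⊗ q)` exactly when multiplying its
two middle legs gives `p ⊗ 1 ⊗ q`. -/
theorem mk_eq_comul_iff (hst : IsCoinvariantModel H P j s t) (d : L ⊗[ℂ] L) (X : L) :
    BalancedTensor.mk _ _ d = hst.comul hG hF X ↔
      mulMiddle P P (TensorProduct.map j j d) = insertOne P P (j X) := by
  rw [hst.eq_comul_iff hG hF, pairMap_mk]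

theorem mulMiddle_map_mul (hst : IsCoinvariantModel H P j s t) (d e : L ⊗[ℂ] L) :
    mulMiddle P P (TensorProduct.map j j (d * e)) =
      mulAround P (mulMiddle P P (TensorProduct.map j j d) ⊗ₜ TensorProduct.map j j e) := by
  induction d with
  | zero => simp
  | add a b ha hb => simp only [add_mul, TensorProduct.add_tmul, map_add, ha, hb]
  | tmul X Y =>
  induction e with
  | zero => simp
  | add a b ha hb => simp only [mul_add, TensorProduct.tmul_add, map_add, ha, hb]
  | tmul Z W =>
    simp only [Algebra.TensorProduct.tmul_mul_tmul, TensorProduct.map_tmul, hst.mul]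
    rw [mulAround_mulMiddle]

/-- In `P ⊗ P ⊗ P` the product of `p ⊗ 1 ⊗ q` with a representative of `r ⊗ 1 ⊗ u` is `pr ⊗ 1 ⊗ uq`.
-/
theorem comul_mul (hst : IsCoinvariantModel H P j s t) (X Y : L) (d e : L ⊗[ℂ] L)
    (hd : BalancedTensor.mk _ _ d = hst.comul hG hF X)
    (he : BalancedTensor.mk _ _ e = hst.comul hG hF Y) :
    hst.comul hG hF (X * Y) = BalancedTensor.mk _ _ (d * e) := by
  rw [eq_comm]
  rw [mk_eq_comul_iff] at hd he ⊢
  rw [hst.mulMiddle_map_mul, hd, mulAround_insertOne, he, mulEnds_insertOne, hst.mul]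

theorem mk_source_tmul_one (hst : IsCoinvariantModel H P j s t) (a) :
    BalancedTensor.mk _ _ (s a ⊗ₜ 1) = hst.comul hG hF (s a) := by
  rw [mk_eq_comul_iff]
  simp [hst.source, hst.one]

theorem mk_one_tmul_target (hst : IsCoinvariantModel H P j s t) (a) :
    BalancedTensor.mk _ _ (1 ⊗ₜ t a) = hst.comul hG hF (t a) := by
  rw [mk_eq_comul_iff]
  simp [hst.target, hst.one]

/-- Both extra factors insert `a` in the middle leg, and the `1` there makes the results equal. -/
theorem comul_takeuchi (hst : IsCoinvariantModel H P j s t) (a) (X : L) (d : L ⊗[ℂ] L)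
    (hd : BalancedTensor.mk _ _ d = hst.comul hG hF X) :
    BalancedTensor.mk (leftMul t) (leftMul s) (d * (t a ⊗ₜ 1)) =
      BalancedTensor.mk _ _ (d * (1 ⊗ₜ s a)) := by
  apply (hst.pairMap_injective_and_range hG hF).1
  rw [mk_eq_comul_iff] at hd
  rw [pairMap_mk, pairMap_mk, hst.mulMiddle_map_mul, hst.mulMiddle_map_mul, hd,
    mulAround_insertOne, mulAround_insertOne]
  simp [hst.target, hst.source, hst.one]

/-! ### Coassociativity -/

/-- `𝓛 ⊗_B 𝓛 ⊗_B 𝓛 → (𝓛 ⊗_B 𝓛) ⊗_B 𝓛`. -/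
def splitLeft (hst : IsCoinvariantModel H P j s t) :
    BalancedTensor₃ (leftMul t) (leftMul s) →ₗ[ℂ] BalancedTensor hst.pairAct (leftMul s) :=
  Submodule.liftQ _ (BalancedTensor.mk hst.pairAct (leftMul s) ∘ₗ
    (BalancedTensor.mk (leftMul t) (leftMul s)).rTensor L ∘ₗ
    (TensorProduct.assoc ℂ L L L).symm.toLinearMap) (by
    refine sup_le (Submodule.span_le.2 ?_) (Submodule.span_le.2 ?_)
    · rintro _ ⟨a, x, y, w, rfl⟩
      have := balancedMk_eq (leftMul t) (leftMul s) a x y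
      exact (map_sub _ _ _).trans (sub_eq_zero.2 (congrArg
        (fun z => BalancedTensor.mk hst.pairAct (leftMul s) (z ⊗ₜ w)) this))
    · rintro _ ⟨a, x, y, w, rfl⟩
      have := balancedMk_eq hst.pairAct (leftMul s) a
        (BalancedTensor.mk (leftMul t) (leftMul s) (x ⊗ₜ y)) w
      exact (map_sub _ _ _).trans (sub_eq_zero.2 this))

theorem splitLeft_joinLeft (hst : IsCoinvariantModel H P j s t)
    (z : BalancedTensor (leftMul t) (leftMul s)) (Z : L) :
    hst.splitLeft (joinLeft _ _ z Z) = BalancedTensor.mk _ _ (z ⊗ₜ Z) := by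
  obtain ⟨z, rfl⟩ := Submodule.mkQ_surjective _ z
  induction z with
  | zero => simp
  | add a b ha hb => simp only [TensorProduct.add_tmul, map_add, LinearMap.add_apply, ha, hb]
  | tmul X Y => rfl

/-- The two bracketings of the triple product are related by regrouping; `g` regroups back. -/
theorem splitLeft_injective (hst : IsCoinvariantModel H P j s t) :
    Function.Injective hst.splitLeft := by
  let g : BalancedTensor hst.pairAct (leftMul s) →ₗ[ℂ] BalancedTensor₃ (leftMul t) (leftMul s) :=
    BalancedTensor.lift (TensorProduct.lift (joinLeft _ _)) (fun a z Z => by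
      obtain ⟨z, rfl⟩ := Submodule.mkQ_surjective _ z
      induction z with
      | zero => simp
      | add a b ha hb => simp only [TensorProduct.add_tmul, map_add, ha, hb]
      | tmul X Y => exact balanced₃Mk_eq_right (leftMul t) (leftMul s) a X Y Z)
  have hg : g ∘ₗ hst.splitLeft ∘ₗ BalancedTensor₃.mk (leftMul t) (leftMul s) =
      BalancedTensor₃.mk (leftMul t) (leftMul s) :=
    TensorProduct.ext (LinearMap.ext fun X => TensorProduct.ext (LinearMap.ext fun Y =>
      LinearMap.ext fun Z => rfl))
  refine Function.LeftInverse.injective (g := g) fun z => ?_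
  obtain ⟨z, rfl⟩ := Submodule.mkQ_surjective _ z
  exact LinearMap.congr_fun hg z

theorem mulMiddle_tmul_mul (b : P) (x : (P ⊗[ℂ] P) ⊗[ℂ] P) (y : P ⊗[ℂ] P) :
    mulMiddle P (P ⊗[ℂ] P) ((LinearMap.mulRight ℂ b).lTensor (P ⊗[ℂ] P) x ⊗ₜ y) =
      mulMiddle P (P ⊗[ℂ] P) (x ⊗ₜ (LinearMap.mulLeft ℂ b).rTensor P y) := by
  induction y with
  | zero => simp
  | add a b ha hb => simp only [TensorProduct.tmul_add, map_add, ha, hb]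
  | tmul p q =>
  induction x with
  | zero => simp
  | add a b ha hb => simp only [TensorProduct.add_tmul, map_add, ha, hb]
  | tmul r u => simp [mul_assoc]

/-- `z ⊗ (v ⊗ w) ↦ (pairMap z) v ⊗ w` on `(𝓛 ⊗_B 𝓛) ⊗_B 𝓛`. -/
def tripleMap (hst : IsCoinvariantModel H P j s t) :
    BalancedTensor hst.pairAct (leftMul s) →ₗ[ℂ] ((P ⊗[ℂ] P) ⊗[ℂ] P) ⊗[ℂ] P :=
  BalancedTensor.lift (Q := ((P ⊗[ℂ] P) ⊗[ℂ] P) ⊗[ℂ] P) (ρ := hst.pairAct) (σ := leftMul s)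
    (mulMiddle P (P ⊗[ℂ] P) ∘ₗ TensorProduct.map hst.pairMap j)
    (fun b z X => by
      rw [LinearMap.comp_apply, TensorProduct.map_tmul, hst.pairMap_pairAct,
        LinearMap.comp_apply, TensorProduct.map_tmul, LinearMap.mulLeft_apply, hst.map_source_mul]
      exact mulMiddle_tmul_mul _ _ _)

theorem tripleMap_mk (hst : IsCoinvariantModel H P j s t) (z) (X : L) :
    hst.tripleMap (BalancedTensor.mk _ _ (z ⊗ₜ X)) =
      mulMiddle P (P ⊗[ℂ] P) (hst.pairMap z ⊗ₜ j X) := rfl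

/-- The action map is the isomorphism obtained from a third use of `iso`. Only injectivity is needed
for coassociativity, so `injective_of_comp` is enough and no coinvariance is checked. -/
theorem tripleMap_injective (hst : IsCoinvariantModel H P j s t) (hG : IsHopfGalois H P)
    (hF : IsFaithfullyFlat.{max u v} (coinvariants H P) P) :
    Function.Injective hst.tripleMap := by
  let τ := BalancedTensor.actRight hst.pairAct hst.target_mul_source_mul
  have hτ : ∀ b z, hst.tripleMap (τ b z) =
      coinvAct H P ((P ⊗[ℂ] P) ⊗[ℂ] P) b (hst.tripleMap z) := by
    intro b z
    refine LinearMap.congr_fun (f := hst.tripleMap ∘ₗ τ b)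
      (g := coinvAct H P ((P ⊗[ℂ] P) ⊗[ℂ] P) b ∘ₗ hst.tripleMap)
      (BalancedTensor.hom_ext (Q := ((P ⊗[ℂ] P) ⊗[ℂ] P) ⊗[ℂ] P) fun w X => ?_) z
    have h1 : mulMiddle P (P ⊗[ℂ] P) (hst.pairMap w ⊗ₜ j (t b * X)) =
        coinvAct H P ((P ⊗[ℂ] P) ⊗[ℂ] P) b
          (mulMiddle P (P ⊗[ℂ] P) (hst.pairMap w ⊗ₜ j X)) := by
      rw [hst.map_target_mul]
      induction j X with
      | zero => simp
      | add a b ha hb => simp only [TensorProduct.tmul_add, map_add, ha, hb]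
      | tmul r u => simp
    exact h1
  have h2 : actMap hst.tripleMap hτ = (tensorIso hst.target_mul_source_mul (hst.pairIso hG hF)
      (hst.iso hG hF) (hst.iso_actLeft_source hG hF)).toLinearMap := by
    refine BalancedTensor.hom_ext (Q := ((P ⊗[ℂ] P) ⊗[ℂ] P) ⊗[ℂ] P) fun z x => ?_
    obtain ⟨z, rfl⟩ := Submodule.mkQ_surjective _ z
    induction z with
    | zero => simp
    | add a b ha hb => simp only [TensorProduct.add_tmul, map_add, ha, hb]
    | tmul w X =>
      rw [actMap_mk, LinearEquiv.coe_coe]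
      refine Eq.trans ?_ (tensorIso_mk hst.target_mul_source_mul (hst.pairIso hG hF)
        (hst.iso hG hF) (hst.iso_actLeft_source hG hF) w X x).symm
      rw [iso_mk, ← hst.pairIso_eq hG hF]
      change mulLast _ P (mulMiddle P (P ⊗[ℂ] P) (hst.pairMap w ⊗ₜ j X) ⊗ₜ x) = _
      induction j X with
      | zero => simp
      | add a b ha hb =>
        simp only [TensorProduct.add_tmul, TensorProduct.tmul_add, map_add, ha, hb]
      | tmul r u => rfl
  refine hF.injective_of_comp.{u, v} (fun _ _ => rfl)
    (hst.isRightAction.actRight hst.pairAct hst.target_mul_source_mul) hst.tripleMap hτ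
    (mulBalanced H P _) ?_
  change Function.Injective (actMap hst.tripleMap hτ)
  rw [h2]
  exact LinearEquiv.injective _

/-- Both iterated coproducts of `p ⊗ q` become `p ⊗ 1 ⊗ 1 ⊗ q` in the fourth tensor power. -/
theorem coassoc (hst : IsCoinvariantModel H P j s t) (X : L) (d : L ⊗[ℂ] L)
    (hd : BalancedTensor.mk _ _ d = hst.comul hG hF X) :
    comulTensorId (hst.comul hG hF) d = idTensorComul (hst.comul hG hF) d := by
  rw [mk_eq_comul_iff] at hd
  apply hst.splitLeft_injective
  apply hst.tripleMap_injective hG hF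
  have h1 : hst.tripleMap (hst.splitLeft (comulTensorId (hst.comul hG hF) d)) =
      (insertOne P P).rTensor P (mulMiddle P P (TensorProduct.map j j d)) := by
    clear hd
    induction d with
    | zero => simp
    | add a b ha hb => simp only [map_add, ha, hb]
    | tmul Y Z =>
      have h2 : comulTensorId (hst.comul hG hF) (Y ⊗ₜ Z) =
        joinLeft _ _ (hst.comul hG hF Y) Z := rfl
      rw [h2, splitLeft_joinLeft, tripleMap_mk, pairMap_comul, TensorProduct.map_tmul]
      induction j Y with
      | zero => simp
      | add a b ha hb => simp only [TensorProduct.add_tmul, map_add, ha, hb]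
      | tmul p q =>
      induction j Z with
      | zero => simp
      | add a b ha hb => simp only [TensorProduct.tmul_add, map_add, ha, hb]
      | tmul r u => simp
  have h3 : hst.tripleMap (hst.splitLeft (idTensorComul (hst.comul hG hF) d)) =
      insertOne P (P ⊗[ℂ] P) (mulMiddle P P (TensorProduct.map j j d)) := by
    clear hd h1
    induction d with
    | zero => simp
    | add a b ha hb => simp only [map_add, ha, hb]
    | tmul Y Z =>
      have h2 : idTensorComul (hst.comul hG hF) (Y ⊗ₜ Z) =
        joinRight _ _ (hst.comul hG hF Z) Y := rfl
      have h4 : ∀ z, hst.tripleMap (hst.splitLeft (joinRight _ _ z Y)) =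
          (mulMiddle P P).rTensor P ((TensorProduct.assoc ℂ (P ⊗[ℂ] P) (P ⊗[ℂ] P) P).symm
            (j Y ⊗ₜ hst.pairMap z)) := by
        intro z
        obtain ⟨z, rfl⟩ := Submodule.mkQ_surjective _ z
        induction z with
        | zero => simp
        | add a b ha hb =>
          simp only [TensorProduct.tmul_add, map_add, LinearMap.add_apply, ha, hb]
        | tmul Z W =>
          change mulMiddle P (P ⊗[ℂ] P) (mulMiddle P P (j Y ⊗ₜ j Z) ⊗ₜ j W) =
            (mulMiddle P P).rTensor P ((TensorProduct.assoc ℂ (P ⊗[ℂ] P) (P ⊗[ℂ] P) P).symm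
              (j Y ⊗ₜ mulMiddle P P (j Z ⊗ₜ j W)))
          induction j Z with
          | zero => simp
          | add a b ha hb =>
            simp only [TensorProduct.tmul_add, TensorProduct.add_tmul, map_add, ha, hb]
          | tmul p q =>
          induction j W with
          | zero => simp
          | add a b ha hb => simp only [TensorProduct.tmul_add, map_add, ha, hb]
          | tmul r u => simp
      rw [h2, h4, pairMap_comul, TensorProduct.map_tmul]
      induction j Z with
      | zero => simp
      | add a b ha hb => simp only [TensorProduct.tmul_add, map_add, ha, hb]
      | tmul r u => simp
  rw [h1, h3, hd]
  induction j X with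
  | zero => simp
  | add a b ha hb => simp only [map_add, ha, hb]
  | tmul r u => simp

end Galois

/-! ### The bialgebroid -/

/-- The source map as an algebra map. -/
def sourceHom (hst : IsCoinvariantModel H P j s t) : coinvariants H P →ₐ[ℂ] L :=
  AlgHom.ofLinearMap
    { toFun := s
      map_add' := fun a b => hst.injective (by simp [hst.source, TensorProduct.add_tmul])
      map_smul' := fun c a => hst.injective (by simp [hst.source, TensorProduct.smul_tmul']) }
    (hst.injective ((hst.source 1).trans hst.one.symm))
    (fun a b => hst.injective (by
      change j (s (a * b)) = j (s a * s b)
      simp [hst.source, hst.mul]))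

/-- The target map as a linear map. -/
def targetLin (hst : IsCoinvariantModel H P j s t) : coinvariants H P →ₗ[ℂ] L where
  toFun := t
  map_add' a b := hst.injective (by simp [hst.target, TensorProduct.tmul_add])
  map_smul' c a := hst.injective (by simp [hst.target])

theorem mul'_source_mul (hst : IsCoinvariantModel H P j s t) (a) (X : L) :
    LinearMap.mul' ℂ P (j (s a * X)) = a * LinearMap.mul' ℂ P (j X) := by
  rw [hst.map_source_mul]
  induction j X with
  | zero => simp
  | add a b ha hb => simp only [map_add, mul_add, ha, hb]
  | tmul p q => simp [mul_assoc]

theorem mul'_target_mul (hst : IsCoinvariantModel H P j s t) (a) (X : L) :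
    LinearMap.mul' ℂ P (j (t a * X)) = LinearMap.mul' ℂ P (j X) * a := by
  rw [hst.map_target_mul]
  induction j X with
  | zero => simp
  | add a b ha hb => simp only [map_add, add_mul, ha, hb]
  | tmul p q => simp [mul_assoc]

/-- The counit of a product is `p (ru) q`, which depends on `r ⊗ u` only through `ru`. -/
theorem mul'_flipMul (x y : P ⊗[ℂ] P) : LinearMap.mul' ℂ P (flipMul P (x ⊗ₜ y)) =
    LinearMap.mul' ℂ P (flipMul P (x ⊗ₜ (LinearMap.mul' ℂ P y ⊗ₜ 1))) := by
  induction x with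
  | zero => simp
  | add a b ha hb => simp only [TensorProduct.add_tmul, map_add, ha, hb]
  | tmul p q =>
  induction y with
  | zero => simp
  | add a b ha hb => simp only [TensorProduct.tmul_add, TensorProduct.add_tmul, map_add, ha, hb]
  | tmul r u => simp [mul_assoc]

theorem mul'_flipMul_tmul_one (x : P ⊗[ℂ] P) (b : P) :
    LinearMap.mul' ℂ P (flipMul P (x ⊗ₜ (b ⊗ₜ 1))) =
      LinearMap.mul' ℂ P (flipMul P (x ⊗ₜ (1 ⊗ₜ b))) := by
  induction x with
  | zero => simp
  | add a b ha hb => simp only [TensorProduct.add_tmul, map_add, ha, hb]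
  | tmul p q => simp [mul_assoc]

theorem mulLeft_mul' (x y : P ⊗[ℂ] P) :
    (LinearMap.mulLeft ℂ (LinearMap.mul' ℂ P x)).rTensor P y =
      (LinearMap.mul' ℂ P).rTensor P (mulMiddle P P (x ⊗ₜ y)) := by
  induction y with
  | zero => simp
  | add a b ha hb => simp only [TensorProduct.tmul_add, map_add, ha, hb]
  | tmul r u =>
  rw [LinearMap.rTensor_tmul, LinearMap.mulLeft_apply]
  induction x with
  | zero => simp
  | add a b ha hb => rw [map_add, add_mul, TensorProduct.add_tmul, ha, hb, TensorProduct.add_tmul,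
      map_add, map_add]
  | tmul p q => simp [mul_assoc]

theorem mulRight_mul' (x y : P ⊗[ℂ] P) :
    (LinearMap.mulRight ℂ (LinearMap.mul' ℂ P y)).lTensor P x =
      mulLast P P (mulMiddle P P (x ⊗ₜ y)) := by
  induction x with
  | zero => simp
  | add a b ha hb => simp only [TensorProduct.add_tmul, map_add, ha, hb]
  | tmul r u =>
  rw [LinearMap.lTensor_tmul, LinearMap.mulRight_apply]
  induction y with
  | zero => simp
  | add a b ha hb => rw [map_add, mul_add, TensorProduct.tmul_add, ha, hb, TensorProduct.tmul_add,
      map_add, map_add]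
  | tmul p q => simp [mul_assoc]

variable (hG : IsHopfGalois H P) (hF : IsFaithfullyFlat.{max u v} (coinvariants H P) P)

/-- The Ehresmann-Schauenburg bialgebroid. -/
def bialgebroid (hst : IsCoinvariantModel H P j s t) : LeftBialgebroid (coinvariants H P) L where
  s := hst.sourceHom
  t := hst.targetLin
  t_one := hst.injective ((hst.target 1).trans hst.one.symm)
  t_mul := hst.target_mul
  s_comm_t := hst.source_comm_target
  comul := hst.comul hG hF
  counit := hst.counit
  -- Bimodule linearity is multiplicativity of `Δ` together with `Δ(s a) = s a ⊗ 1` and, for the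
  -- target, `Δ(t a) = 1 ⊗ t a`.
  comul_source a X d hd :=
    hst.comul_mul hG hF _ _ _ _ (hst.mk_source_tmul_one hG hF a) hd
  comul_target a X d hd :=
    hst.comul_mul hG hF _ _ _ _ (hst.mk_one_tmul_target hG hF a) hd
  counit_source a X := Subtype.ext (hst.mul'_source_mul a X)
  counit_target a X := Subtype.ext (hst.mul'_target_mul a X)
  coassoc := hst.coassoc hG hF
  counit_comul X d hd := by
    have h := (hst.mk_eq_comul_iff hG hF d X).1 hd
    clear hd
    -- The expression `s (ε X₁) * X₂` multiplies the first two legs of `p ⊗ 1 ⊗ q`.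
    have h1 : j (LinearMap.mul' ℂ L (TensorProduct.map (hst.sourceHom.toLinearMap ∘ₗ hst.counit)
        LinearMap.id d)) = (LinearMap.mul' ℂ P).rTensor P
          (mulMiddle P P (TensorProduct.map j j d)) := by
      clear h
      induction d with
      | zero => simp
      | add a b ha hb => simp only [map_add, ha, hb]
      | tmul X Y =>
        change j (s (hst.counit X) * Y) = _
        rw [hst.map_source_mul, TensorProduct.map_tmul]
        exact mulLeft_mul' _ _
    apply hst.injective
    rw [h1, h]
    induction j X with
    | zero => simp
    | add a b ha hb => simp only [map_add, ha, hb]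
    | tmul r u => simp
  comul_counit X d hd := by
    have h := (hst.mk_eq_comul_iff hG hF d X).1 hd
    clear hd
    -- The expression `t (ε X₂) * X₁` multiplies the last two legs of `p ⊗ 1 ⊗ q`.
    have h1 : j (LinearMap.mul' ℂ L (TensorProduct.map (hst.targetLin ∘ₗ hst.counit)
        LinearMap.id (TensorProduct.comm ℂ L L d))) =
          mulLast P P (mulMiddle P P (TensorProduct.map j j d)) := by
      clear h
      induction d with
      | zero => simp
      | add a b ha hb => simp only [map_add, ha, hb]
      | tmul X Y =>
        change j (t (hst.counit Y) * X) = _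
        rw [hst.map_target_mul, TensorProduct.map_tmul]
        exact mulRight_mul' _ _
    apply hst.injective
    rw [h1, h]
    induction j X with
    | zero => simp
    | add a b ha hb => simp only [map_add, ha, hb]
    | tmul r u => simp
  comul_takeuchi := hst.comul_takeuchi hG hF
  comul_one := by
    rw [eq_comm]
    refine (hst.mk_eq_comul_iff hG hF _ _).2 ?_
    simp [hst.one]
  comul_mul := hst.comul_mul hG hF
  counit_one := Subtype.ext (by simp [hst.counit_coe, hst.one])
  counit_mul_source X Y := Subtype.ext (by
    change LinearMap.mul' ℂ P (j (X * Y)) = LinearMap.mul' ℂ P (j (X * s (hst.counit Y)))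
    rw [hst.mul, hst.mul, hst.source, hst.counit_coe, mul'_flipMul])
  counit_mul_target X Y := Subtype.ext (by
    change LinearMap.mul' ℂ P (j (X * Y)) = LinearMap.mul' ℂ P (j (X * t (hst.counit Y)))
    rw [hst.mul, hst.mul, hst.target, hst.counit_coe, mul'_flipMul, mul'_flipMul_tmul_one])

end IsCoinvariantModel

/-! ## Hopf algebroid structures -/

section SemilinearSwap

variable {A A' M N M' N' : Type*} [AddCommGroup M] [Module ℂ M] [AddCommGroup N] [Module ℂ N]
  [AddCommGroup M'] [Module ℂ M'] [AddCommGroup N'] [Module ℂ N']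
  {ρ : A → M →ₗ[ℂ] M} {σ : A → N →ₗ[ℂ] N} {ρ' : A' → N' →ₗ[ℂ] N'} {σ' : A' → M' →ₗ[ℂ] M'}

/-- The antilinear map `m ⊗ n ↦ g n ⊗ f m` of balanced tensor products. -/
def BalancedTensor.semilinearSwap (e : A → A') (f : M →ₛₗ[starRingEnd ℂ] M')
    (g : N →ₛₗ[starRingEnd ℂ] N') (hf : ∀ a m, f (ρ a m) = σ' (e a) (f m))
    (hg : ∀ a n, g (σ a n) = ρ' (e a) (g n)) :
    BalancedTensor ρ σ →ₛₗ[starRingEnd ℂ] BalancedTensor ρ' σ' :=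
  (balancedRel ρ σ).liftQ
    ((BalancedTensor.mk ρ' σ' ∘ₗ (TensorProduct.comm ℂ M' N').toLinearMap).comp
      (TensorProduct.map f g)) (by
    refine Submodule.span_le.2 ?_
    rintro _ ⟨a, m, n, rfl⟩
    refine (map_sub _ _ _).trans (sub_eq_zero.2 ?_)
    change BalancedTensor.mk ρ' σ' (g n ⊗ₜ f (ρ a m)) = BalancedTensor.mk ρ' σ' (g (σ a n) ⊗ₜ f m)
    rw [hf, hg, balancedMk_eq])

theorem BalancedTensor.semilinearSwap_semilinearSwap (e : A → A') (f : M →ₛₗ[starRingEnd ℂ] M')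
    (g : N →ₛₗ[starRingEnd ℂ] N') (hf : ∀ a m, f (ρ a m) = σ' (e a) (f m))
    (hg : ∀ a n, g (σ a n) = ρ' (e a) (g n)) (e' : A' → A) (f' : M' →ₛₗ[starRingEnd ℂ] M)
    (g' : N' →ₛₗ[starRingEnd ℂ] N) (hf' : ∀ a m, f' (σ' a m) = ρ (e' a) (f' m))
    (hg' : ∀ a n, g' (ρ' a n) = σ (e' a) (g' n)) (hff : ∀ m, f' (f m) = m)
    (hgg : ∀ n, g' (g n) = n) (z : BalancedTensor ρ σ) :
    semilinearSwap e' g' f' hg' hf' (semilinearSwap e f g hf hg z) = z := by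
  obtain ⟨z, rfl⟩ := Submodule.mkQ_surjective _ z
  induction z with
  | zero => simp
  | add a b ha hb => simp only [map_add, ha, hb]
  | tmul m n =>
    change mk ρ σ (f' (f m) ⊗ₜ g' (g n)) = _
    rw [hff, hgg]

end SemilinearSwap

section StarSwap

variable (P : Type u) [Ring P] [Algebra ℂ P] [StarRing P] [StarModule ℂ P]

/-- `p ↦ p*` as an antilinear map. -/
abbrev starLin (P : Type*) [Ring P] [Algebra ℂ P] [StarRing P] [StarModule ℂ P] :
    P →ₛₗ[starRingEnd ℂ] P :=
  (starLinearEquiv ℂ : P ≃ₛₗ[starRingEnd ℂ] P).toLinearMap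

/-- `p ⊗ q ↦ q* ⊗ p*`. -/
def starSwap : P ⊗[ℂ] P →ₛₗ[starRingEnd ℂ] P ⊗[ℂ] P :=
  (TensorProduct.comm ℂ P P).toLinearMap.comp (TensorProduct.map (starLin P) (starLin P))

@[simp]
theorem starSwap_tmul (p q : P) : starSwap P (p ⊗ₜ q) = star q ⊗ₜ star p := rfl

/-- `(p ⊗ q) ⊗ r ↦ (r* ⊗ q*) ⊗ p*`. -/
def starReverse : (P ⊗[ℂ] P) ⊗[ℂ] P →ₛₗ[starRingEnd ℂ] (P ⊗[ℂ] P) ⊗[ℂ] P :=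
  ((TensorProduct.assoc ℂ P P P).symm.toLinearMap ∘ₗ
    (TensorProduct.comm ℂ (P ⊗[ℂ] P) P).toLinearMap).comp
    (TensorProduct.map (starSwap P) (starLin P))

@[simp]
theorem starReverse_tmul (p q r : P) :
    starReverse P ((p ⊗ₜ q) ⊗ₜ r) = (star r ⊗ₜ star q) ⊗ₜ star p := rfl

theorem starSwap_starSwap (z : P ⊗[ℂ] P) : starSwap P (starSwap P z) = z := by
  induction z with
  | zero => simp
  | add a b ha hb => simp only [map_add, ha, hb]
  | tmul p q => simp

theorem starSwap_flipMul (z w : P ⊗[ℂ] P) :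
    starSwap P (flipMul P (z ⊗ₜ w)) = flipMul P (starSwap P z ⊗ₜ starSwap P w) := by
  induction z with
  | zero => simp
  | add a b ha hb => simp only [TensorProduct.add_tmul, map_add, ha, hb]
  | tmul p q =>
  induction w with
  | zero => simp
  | add a b ha hb => simp only [TensorProduct.tmul_add, map_add, ha, hb]
  | tmul r u => simp

theorem mul'_starSwap (z : P ⊗[ℂ] P) :
    LinearMap.mul' ℂ P (starSwap P z) = star (LinearMap.mul' ℂ P z) := by
  induction z with
  | zero => simp
  | add a b ha hb => simp only [map_add, star_add, ha, hb]
  | tmul p q => simp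

theorem starReverse_mulMiddle (z w : P ⊗[ℂ] P) :
    starReverse P (mulMiddle P P (z ⊗ₜ w)) = mulMiddle P P (starSwap P w ⊗ₜ starSwap P z) := by
  induction z with
  | zero => simp
  | add a b ha hb => simp only [TensorProduct.add_tmul, TensorProduct.tmul_add, map_add, ha, hb]
  | tmul p q =>
  induction w with
  | zero => simp
  | add a b ha hb => simp only [TensorProduct.add_tmul, TensorProduct.tmul_add, map_add, ha, hb]
  | tmul r u => simp

theorem starReverse_insertOne (z : P ⊗[ℂ] P) :
    starReverse P (insertOne P P z) = insertOne P P (starSwap P z) := by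
  induction z with
  | zero => simp
  | add a b ha hb => simp only [map_add, ha, hb]
  | tmul p q => simp

end StarSwap

namespace LeftBialgebroid

variable {B L : Type*} [Ring B] [Algebra ℂ B] [Ring L] [Algebra ℂ L] (𝓛 : LeftBialgebroid B L)

theorem galoisLambda_mk (X Y : L) (d : L ⊗[ℂ] L) (hd : BalancedTensor.mk _ _ d = 𝓛.comul X) :
    𝓛.galoisLambda (BalancedTensor.mk _ _ (X ⊗ₜ Y)) = BalancedTensor.mk _ _ (d * (1 ⊗ₜ Y)) := by
  rw [galoisLambda, BalancedTensor.lift_mk, preLambda, TensorProduct.lift.tmul,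
    LinearMap.mk₂_apply, ← hd, 𝓛.mulBoth_mk]

theorem galoisMu_mk (X Y : L) (d : L ⊗[ℂ] L) (hd : BalancedTensor.mk _ _ d = 𝓛.comul Y) :
    𝓛.galoisMu (BalancedTensor.mk _ _ (X ⊗ₜ Y)) = BalancedTensor.mk _ _ (d * (X ⊗ₜ 1)) := by
  rw [galoisMu, BalancedTensor.lift_mk, preMu, TensorProduct.lift.tmul,
    LinearMap.mk₂_apply, ← hd, 𝓛.mulBoth_mk]

end LeftBialgebroid

namespace IsCoinvariantModel

section Hopf

variable {H : Type v} {P : Type u} [Ring H] [HopfAlgebra ℂ H] [Ring P] [Algebra ℂ P]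
  [ComoduleAlgebra H P] {L : Type u} [Ring L] [Algebra ℂ L] {j : L →ₗ[ℂ] P ⊗[ℂ] P}
  {𝓛 : LeftBialgebroid (coinvariants H P) L}

theorem mulEnds_mulMiddle_one (z w : P ⊗[ℂ] P) :
    mulEnds P (z ⊗ₜ mulMiddle P P ((1 ⊗ₜ 1) ⊗ₜ w)) = mulOuter P (w ⊗ₜ z) := by
  induction z with
  | zero => simp
  | add a b ha hb => simp only [TensorProduct.add_tmul, TensorProduct.tmul_add, map_add, ha, hb]
  | tmul p q =>
  induction w with
  | zero => simp
  | add a b ha hb => simp only [TensorProduct.add_tmul, TensorProduct.tmul_add, map_add, ha, hb]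
  | tmul r u => simp

/-- For `X = p ⊗ q` and `Y = r ⊗ u`, multiplying `p ⊗ 1 ⊗ q` by `1 ⊗ Y` gives `p ⊗ r ⊗ uq`, which is
`outerMap` of `Y ⊗ X`. -/
theorem pairMap_galoisLambda (hst : IsCoinvariantModel H P j 𝓛.s 𝓛.t)
    (hΔ : ∀ X, hst.pairMap (𝓛.comul X) = insertOne P P (j X)) (z) :
    hst.pairMap (𝓛.galoisLambda (BalancedTensor.comm (leftMul 𝓛.t) (rightMul 𝓛.t) z)) =
      hst.outerMap z := by
  obtain ⟨z, rfl⟩ := Submodule.mkQ_surjective _ z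
  rw [outerMap_mk]
  induction z with
  | zero => simp only [map_zero]
  | add a b ha hb => simp only [map_add, ha, hb]
  | tmul Y X =>
    rw [BalancedTensor.comm_mk, TensorProduct.map_tmul]
    obtain ⟨d, hd⟩ := Submodule.mkQ_surjective _ (𝓛.comul X)
    have h1 := hΔ X
    rw [← hd, pairMap_mk] at h1
    rw [𝓛.galoisLambda_mk X Y d hd, pairMap_mk, hst.mulMiddle_map_mul, h1,
      mulAround_insertOne, TensorProduct.map_tmul, hst.one, mulEnds_mulMiddle_one]

/-- Both `pairMap` and `outerMap` are bijections onto the coinvariants of `P ⊗ P ⊗ P`, and they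
intertwine `λ`, up to an exchange of factors, with the identity. -/
theorem isLeftHopf (hst : IsCoinvariantModel H P j 𝓛.s 𝓛.t)
    (hG : IsHopfGalois H P) (hF : IsFaithfullyFlat.{max u v} (coinvariants H P) P)
    (hΔ : ∀ X, hst.pairMap (𝓛.comul X) = insertOne P P (j X)) : 𝓛.IsLeftHopf := by
  have h1 : Function.Bijective (𝓛.galoisLambda ∘
      BalancedTensor.comm (leftMul 𝓛.t) (rightMul 𝓛.t)) := by
    refine ⟨fun z w h => (hst.outerMap_injective_and_range hG hF).1 ?_, fun w => ?_⟩
    · rw [← hst.pairMap_galoisLambda hΔ, ← hst.pairMap_galoisLambda hΔ]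
      exact congrArg hst.pairMap h
    · obtain ⟨z, hz⟩ := (hst.outerMap_injective_and_range hG hF).2 _ (hst.diag_pairMap w)
      refine ⟨z, (hst.pairMap_injective_and_range hG hF).1 ?_⟩
      rw [← hz]
      exact hst.pairMap_galoisLambda hΔ z
  exact (Function.Bijective.of_comp_iff _
    (BalancedTensor.comm (leftMul 𝓛.t) (rightMul 𝓛.t)).bijective).1 h1

end Hopf

section Star

variable {H : Type v} {P : Type u} [Ring H] [HopfAlgebra ℂ H] [StarRing H] [StarModule ℂ H]
  [Ring P] [Algebra ℂ P] [StarRing P] [StarModule ℂ P] [ComoduleAlgebra H P]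
  [IsUnitaryCoaction H P] {L : Type u} [Ring L] [Algebra ℂ L] {j : L →ₗ[ℂ] P ⊗[ℂ] P}
  {s t : coinvariants H P → L} {θ : L ≃ₛₗ[starRingEnd ℂ] L}

theorem star_star (hst : IsCoinvariantModel H P j s t) (hθ : ∀ X, j (θ X) = starSwap P (j X))
    (X : L) : θ (θ X) = X :=
  hst.injective (by rw [hθ, hθ, starSwap_starSwap])

theorem star_one (hst : IsCoinvariantModel H P j s t) (hθ : ∀ X, j (θ X) = starSwap P (j X)) :
    θ 1 = 1 :=
  hst.injective (by simp [hθ, hst.one])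

/-- Two reversals cancel: the star of `P` is antimultiplicative, and the exchange of legs turns the
product of `L` into its opposite. Hence `θ` reverses products only as a map to the opposite algebra.
-/
theorem star_mul (hst : IsCoinvariantModel H P j s t) (hθ : ∀ X, j (θ X) = starSwap P (j X))
    (X Y : L) : θ (X * Y) = θ X * θ Y :=
  hst.injective (by rw [hθ, hst.mul, hst.mul, hθ, hθ, starSwap_flipMul])

theorem star_source (hst : IsCoinvariantModel H P j s t) (hθ : ∀ X, j (θ X) = starSwap P (j X))
    (a : coinvariants H P) : θ (s a) = t (star a) :=
  hst.injective (by
    rw [hθ, hst.source, hst.target, starSwap_tmul, _root_.star_one]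
    rfl)

theorem star_target (hst : IsCoinvariantModel H P j s t) (hθ : ∀ X, j (θ X) = starSwap P (j X))
    (a : coinvariants H P) : θ (t a) = s (star a) :=
  hst.injective (by
    rw [hθ, hst.source, hst.target, starSwap_tmul, _root_.star_one]
    rfl)

variable {𝓛 : LeftBialgebroid (coinvariants H P) L}

/-- Reversing the three legs sends `p ⊗ 1 ⊗ q` to `q* ⊗ 1 ⊗ p*`, the coproduct of `q* ⊗ p*`. -/
theorem comul_star (hst : IsCoinvariantModel H P j 𝓛.s 𝓛.t)
    (hG : IsHopfGalois H P) (hF : IsFaithfullyFlat.{max u v} (coinvariants H P) P)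
    (hΔ : ∀ X, hst.pairMap (𝓛.comul X) = insertOne P P (j X))
    (hθ : ∀ X, j (θ X) = starSwap P (j X))
    (X : L) (d : L ⊗[ℂ] L) (hd : BalancedTensor.mk _ _ d = 𝓛.comul X) :
    BalancedTensor.mk _ _ (TensorProduct.comm ℂ L L
      (TensorProduct.map (θ : L →ₛₗ[starRingEnd ℂ] L) (θ : L →ₛₗ[starRingEnd ℂ] L) d)) =
      𝓛.comul (θ X) := by
  apply (hst.pairMap_injective_and_range hG hF).1
  rw [hΔ, hθ, ← starReverse_insertOne, ← hΔ, ← hd, pairMap_mk, pairMap_mk]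
  clear hd
  induction d with
  | zero => simp
  | add a b ha hb => simp only [map_add, ha, hb]
  | tmul Y Z =>
    rw [TensorProduct.map_tmul, TensorProduct.map_tmul, TensorProduct.comm_tmul,
      TensorProduct.map_tmul, starReverse_mulMiddle, LinearEquiv.coe_coe, hθ, hθ]

/-- Applying `θ` to both factors and exchanging them turns `Y₁ X ⊗ Y₂` into `θ(Y)₁ ⊗ θ(Y)₂ θ(X)`, so
`μ` is conjugate to `λ`. -/
theorem isAntiLeftHopf (hst : IsCoinvariantModel H P j 𝓛.s 𝓛.t)
    (hG : IsHopfGalois H P) (hF : IsFaithfullyFlat.{max u v} (coinvariants H P) P)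
    (hΔ : ∀ X, hst.pairMap (𝓛.comul X) = insertOne P P (j X))
    (hθ : ∀ X, j (θ X) = starSwap P (j X)) : 𝓛.IsAntiLeftHopf := by
  have hs : ∀ a X, θ (𝓛.s a * X) = 𝓛.t (star a) * θ X := fun a X => by
    rw [hst.star_mul hθ, hst.star_source hθ]
  have ht : ∀ a X, θ (𝓛.t a * X) = 𝓛.s (star a) * θ X := fun a X => by
    rw [hst.star_mul hθ, hst.star_target hθ]
  have hs' : ∀ a X, θ (X * 𝓛.s a) = θ X * 𝓛.t (star a) := fun a X => by
    rw [hst.star_mul hθ, hst.star_source hθ]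
  have ht' : ∀ a X, θ (X * 𝓛.t a) = θ X * 𝓛.s (star a) := fun a X => by
    rw [hst.star_mul hθ, hst.star_target hθ]
  -- The antilinear exchange `D` maps the source of `μ` to that of `λ`, with inverse `D'`; `C` is
  -- the corresponding involution of the common target. They respect the relations because `θ`
  -- interchanges `s` and `t`.
  let D := BalancedTensor.semilinearSwap (ρ := leftMul 𝓛.s) (σ := rightMul 𝓛.s)
    (ρ' := rightMul 𝓛.t) (σ' := leftMul 𝓛.t) star
    (θ : L →ₛₗ[starRingEnd ℂ] L) (θ : L →ₛₗ[starRingEnd ℂ] L) hs hs'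
  let D' := BalancedTensor.semilinearSwap (ρ := rightMul 𝓛.t) (σ := leftMul 𝓛.t)
    (ρ' := leftMul 𝓛.s) (σ' := rightMul 𝓛.s) star
    (θ : L →ₛₗ[starRingEnd ℂ] L) (θ : L →ₛₗ[starRingEnd ℂ] L) ht' ht
  let C := BalancedTensor.semilinearSwap (ρ := leftMul 𝓛.t) (σ := leftMul 𝓛.s)
    (ρ' := leftMul 𝓛.t) (σ' := leftMul 𝓛.s) star
    (θ : L →ₛₗ[starRingEnd ℂ] L) (θ : L →ₛₗ[starRingEnd ℂ] L) ht hs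
  have hθθ := hst.star_star hθ
  have hD : Function.Bijective D := Function.bijective_iff_has_inverse.2 ⟨D',
    fun z => BalancedTensor.semilinearSwap_semilinearSwap _ _ _ hs hs' _ _ _ ht ht' hθθ hθθ z,
    fun z => BalancedTensor.semilinearSwap_semilinearSwap _ _ _ ht' ht _ _ _ hs' hs hθθ hθθ z⟩
  have hC : Function.Bijective C := Function.bijective_iff_has_inverse.2 ⟨C,
    fun z => BalancedTensor.semilinearSwap_semilinearSwap _ _ _ ht hs _ _ _ hs ht hθθ hθθ z,
    fun z => BalancedTensor.semilinearSwap_semilinearSwap _ _ _ ht hs _ _ _ hs ht hθθ hθθ z⟩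
  have h1 : ∀ z, C (𝓛.galoisMu z) = 𝓛.galoisLambda (D z) := by
    intro z
    obtain ⟨z, rfl⟩ := Submodule.mkQ_surjective _ z
    induction z with
    | zero => simp only [map_zero]
    | add a b ha hb => simp only [map_add, ha, hb]
    | tmul X Y =>
      obtain ⟨d, hd⟩ := Submodule.mkQ_surjective _ (𝓛.comul Y)
      have h2 : D (BalancedTensor.mk (leftMul 𝓛.s) (rightMul 𝓛.s) (X ⊗ₜ Y)) =
        BalancedTensor.mk (rightMul 𝓛.t) (leftMul 𝓛.t) (θ Y ⊗ₜ θ X) := rfl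
      rw [𝓛.galoisMu_mk X Y d hd, h2,
        𝓛.galoisLambda_mk (θ Y) (θ X) _ (hst.comul_star hG hF hΔ hθ Y d hd)]
      refine congrArg (BalancedTensor.mk (leftMul 𝓛.t) (leftMul 𝓛.s)) ?_
      clear hd
      induction d with
      | zero => simp
      | add a b ha hb => simp only [add_mul, map_add, ha, hb]
      | tmul Z W => simp [hst.star_mul hθ]
  refine (Function.Bijective.of_comp_iff' hC _).1 ?_
  rw [show C ∘ 𝓛.galoisMu = 𝓛.galoisLambda ∘ D from funext h1]
  exact (hst.isLeftHopf hG hF hΔ).comp hD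

theorem isStarRelated (hst : IsCoinvariantModel H P j 𝓛.s 𝓛.t)
    (hG : IsHopfGalois H P) (hF : IsFaithfullyFlat.{max u v} (coinvariants H P) P)
    (hΔ : ∀ X, hst.pairMap (𝓛.comul X) = insertOne P P (j X))
    (hε : ∀ X, (𝓛.counit X : P) = LinearMap.mul' ℂ P (j X))
    (hθ : ∀ X, j (θ X) = starSwap P (j X)) :
    IsStarRelated 𝓛 𝓛.op (θ.trans (opLinearEquiv ℂ : L ≃ₗ[ℂ] Lᵐᵒᵖ)) where
  map_one := congrArg op (hst.star_one hθ)
  map_mul X Y := congrArg op (hst.star_mul hθ X Y)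
  source a := congrArg op (hst.star_source hθ a).symm
  target a := congrArg op (hst.star_target hθ a).symm
  comul X d hd := by
    have h1 := congrArg 𝓛.opBalanced (hst.comul_star hG hF hΔ hθ X d hd)
    refine Eq.trans ?_ h1
    refine congrArg (BalancedTensor.mk _ _) ?_
    clear hd h1
    induction d with
    | zero => simp
    | add a b ha hb => simp only [map_add, ha, hb]
    | tmul Z W => rfl
  counit X := Subtype.ext (by
    change (𝓛.counit (θ X) : P) = star (𝓛.counit X : P)
    rw [hε, hε, hθ, mul'_starSwap])

end Star

end IsCoinvariantModel

theorem LeftBialgebroid.isReflexive_op {B L : Type*} [Ring B] [Algebra ℂ B] [Ring L] [Algebra ℂ L]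
    (𝓛 : LeftBialgebroid B L) : IsReflexive 𝓛 𝓛.op (opLinearEquiv ℂ) where
  map_one := rfl
  map_mul _ _ := rfl
  source _ := rfl
  target _ := rfl
  comul _ _ hd := congrArg 𝓛.opBalanced hd
  counit _ := rfl

/-! ## The Ehresmann-Schauenburg bialgebroid as a coinvariant model -/

section EhresmannSchauenburg

variable (H : Type v) (P : Type u) [Ring H] [HopfAlgebra ℂ H] [Ring P] [Algebra ℂ P]
  [ComoduleAlgebra H P]

/-- `p ⊗ op q ↦ p ⊗ q`. -/
abbrev unopRight : P ⊗[ℂ] Pᵐᵒᵖ ≃ₗ[ℂ] P ⊗[ℂ] P := (opLinearEquiv ℂ).symm.lTensor P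

/-- The inclusion of `𝓛(P, H)` in `P ⊗ P`. -/
def esIncl : ehresmannSchauenburg H P →ₗ[ℂ] P ⊗[ℂ] P :=
  (unopRight P).toLinearMap ∘ₗ (ehresmannSchauenburg H P).val.toLinearMap

theorem esIncl_apply (X : ehresmannSchauenburg H P) :
    esIncl H P X = unopRight P (X : P ⊗[ℂ] Pᵐᵒᵖ) := rfl

theorem esIncl_injective : Function.Injective (esIncl H P) :=
  (unopRight P).injective.comp Subtype.val_injective

theorem diag_unopRight (z : P ⊗[ℂ] Pᵐᵒᵖ) :
    diag (coactLin H P) (unopRight P z) =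
      TensorProduct.assoc ℂ P P H ((unopRight P).toLinearMap.rTensor H (diagonalCoact H P z)) := by
  induction z with
  | zero => simp
  | add a b ha hb => simp only [map_add, ha, hb]
  | tmul p q =>
    rw [diagonalCoact_tmul]
    change diagMul H P P (ComoduleAlgebra.coact p ⊗ₜ ComoduleAlgebra.coact (unop q)) = _
    generalize ComoduleAlgebra.coact (H := H) p = a
    generalize ComoduleAlgebra.coact (H := H) (unop q) = c
    induction a with
    | zero => simp
    | add a b ha hb => simp only [TensorProduct.add_tmul, map_add, ha, hb]
    | tmul p h =>
    induction c with
    | zero => simp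
    | add a b ha hb => simp only [TensorProduct.tmul_add, map_add, ha, hb]
    | tmul q k => rfl

theorem unopRight_tmulOne (z : P ⊗[ℂ] Pᵐᵒᵖ) :
    (tmulOne H P).lTensor P (unopRight P z) =
      TensorProduct.assoc ℂ P P H ((unopRight P).toLinearMap.rTensor H (z ⊗ₜ 1)) := by
  induction z with
  | zero => simp
  | add a b ha hb => simp only [map_add, TensorProduct.add_tmul, ha, hb]
  | tmul p q => rfl

theorem mem_ehresmannSchauenburg {z : P ⊗[ℂ] Pᵐᵒᵖ} : z ∈ ehresmannSchauenburg H P ↔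
    diag (coactLin H P) (unopRight P z) = (tmulOne H P).lTensor P (unopRight P z) := by
  rw [diag_unopRight, unopRight_tmulOne, EmbeddingLike.apply_eq_iff_eq]
  have h : Function.Injective ((unopRight P).toLinearMap.rTensor H) :=
    ((unopRight P).rTensor H).injective
  rw [h.eq_iff]
  rfl

theorem diag_esIncl (X : ehresmannSchauenburg H P) :
    diag (coactLin H P) (esIncl H P X) = (tmulOne H P).lTensor P (esIncl H P X) :=
  (mem_ehresmannSchauenburg H P).1 X.2

theorem exists_esIncl_eq {z : P ⊗[ℂ] P}
    (hz : diag (coactLin H P) z = (tmulOne H P).lTensor P z) : ∃ X, esIncl H P X = z := by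
  refine ⟨⟨(unopRight P).symm z, ?_⟩, ?_⟩
  · rw [mem_ehresmannSchauenburg, LinearEquiv.apply_symm_apply, hz]
  · rw [esIncl_apply, LinearEquiv.apply_symm_apply]

theorem unopRight_mul (z w : P ⊗[ℂ] Pᵐᵒᵖ) :
    unopRight P (z * w) = flipMul P (unopRight P z ⊗ₜ unopRight P w) := by
  induction z with
  | zero => simp
  | add a b ha hb => simp only [add_mul, map_add, TensorProduct.add_tmul, ha, hb]
  | tmul p q =>
  induction w with
  | zero => simp
  | add a b ha hb => simp only [mul_add, map_add, TensorProduct.tmul_add, ha, hb]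
  | tmul r u =>
    rw [Algebra.TensorProduct.tmul_mul_tmul]
    rfl

theorem esIncl_mul (X Y : ehresmannSchauenburg H P) :
    esIncl H P (X * Y) = flipMul P (esIncl H P X ⊗ₜ esIncl H P Y) := unopRight_mul P _ _

theorem esIncl_one : esIncl H P 1 = 1 ⊗ₜ 1 := rfl

variable {H P}

/-- Source and target are left as variables, so that the same results serve the bialgebroid
constructed here and an arbitrary one satisfying the formulas. -/
theorem isCoinvariantModel_esIncl {s t : coinvariants H P → ehresmannSchauenburg H P}
    (hs : ∀ b, (s b : P ⊗[ℂ] Pᵐᵒᵖ) = (b : P) ⊗ₜ 1)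
    (ht : ∀ b, (t b : P ⊗[ℂ] Pᵐᵒᵖ) = 1 ⊗ₜ op (b : P)) :
    IsCoinvariantModel H P (esIncl H P) s t where
  injective := esIncl_injective H P
  diag_eq := diag_esIncl H P
  exists_eq _ hz := exists_esIncl_eq H P hz
  one := esIncl_one H P
  mul := esIncl_mul H P
  source b := by
    rw [esIncl_apply, hs]
    rfl
  target b := by
    rw [esIncl_apply, ht]
    rfl

/-! ### The formula for the coproduct -/

/-- `P ⊗_B P → P`, `p ⊗ q ↦ p * q`, applied in the middle of `P ⊗ (P ⊗_B P) ⊗ P`. -/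
def collapseMiddle : P ⊗[ℂ] (GaloisTensor H P ⊗[ℂ] Pᵐᵒᵖ) →ₗ[ℂ] (P ⊗[ℂ] P) ⊗[ℂ] P :=
  (TensorProduct.assoc ℂ P P P).symm.toLinearMap ∘ₗ
    (TensorProduct.map
      ((TensorProduct.rid ℂ P).toLinearMap ∘ₗ (Coalgebra.counit (R := ℂ) (A := H)).lTensor P ∘ₗ
        canonicalMap H P) (opLinearEquiv ℂ).symm.toLinearMap).lTensor P

theorem rid_counit_canonicalMap (q p : P) :
    TensorProduct.rid ℂ P ((Coalgebra.counit (R := ℂ) (A := H)).lTensor P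
      (canonicalMap H P (BalancedTensor.mk _ _ (q ⊗ₜ p)))) = q * p := by
  have h1 : ∀ z : P ⊗[ℂ] H, TensorProduct.rid ℂ P
      ((Coalgebra.counit (R := ℂ) (A := H)).lTensor P ((q ⊗ₜ 1) * z)) =
      q * TensorProduct.rid ℂ P ((Coalgebra.counit (R := ℂ) (A := H)).lTensor P z) := by
    intro z
    induction z with
    | zero => simp
    | add a b ha hb => simp only [mul_add, map_add, ha, hb]
    | tmul x h => simp
  refine (h1 (ComoduleAlgebra.coact p)).trans ?_
  rw [ComoduleAlgebra.coact_counit]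

theorem collapseMiddle_joinMiddle (z w : P ⊗[ℂ] Pᵐᵒᵖ) :
    collapseMiddle (joinMiddle H P (z ⊗ₜ w)) =
      mulMiddle P P (unopRight P z ⊗ₜ unopRight P w) := by
  induction z with
  | zero => simp
  | add a b ha hb => simp only [TensorProduct.add_tmul, map_add, ha, hb]
  | tmul p q =>
  induction w with
  | zero => simp
  | add a b ha hb => simp only [TensorProduct.tmul_add, map_add, ha, hb]
  | tmul r u =>
    change (TensorProduct.assoc ℂ P P P).symm (p ⊗ₜ (TensorProduct.rid ℂ P
      ((Coalgebra.counit (R := ℂ) (A := H)).lTensor P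
        (canonicalMap H P (BalancedTensor.mk _ _ (unop q ⊗ₜ r)))) ⊗ₜ unop u)) = _
    rw [rid_counit_canonicalMap]
    rfl

theorem canonicalMap_translationMap (hG : IsHopfGalois H P) (h : H) :
    canonicalMap H P (translationMap hG h) = 1 ⊗ₜ h :=
  LinearEquiv.apply_symm_apply (LinearEquiv.ofBijective (canonicalMap H P) hG) _

/-- Multiplication `P ⊗_B P → P` is `(id ⊗ ε) χ`, so it sends `τ(h)` to `ε(h)`. What remains is `p₀
ε(p₁) ⊗ 1 ⊗ q`. -/
theorem collapseMiddle_coproductFormula (hG : IsHopfGalois H P) (z : P ⊗[ℂ] Pᵐᵒᵖ) :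
    collapseMiddle (coproductFormula hG z) = insertOne P P (unopRight P z) := by
  induction z with
  | zero => simp
  | add a b ha hb => simp only [map_add, ha, hb]
  | tmul p q =>
    have h1 : ∀ c : P ⊗[ℂ] H, collapseMiddle (TensorProduct.assoc ℂ P (GaloisTensor H P) Pᵐᵒᵖ
        ((translationMap hG).lTensor P c ⊗ₜ q)) = insertOne P P
          (TensorProduct.rid ℂ P ((Coalgebra.counit (R := ℂ) (A := H)).lTensor P c) ⊗ₜ unop q) := by
      intro c
      induction c with
      | zero => simp
      | add a b ha hb => simp only [TensorProduct.add_tmul, map_add, ha, hb]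
      | tmul x h =>
        change (TensorProduct.assoc ℂ P P P).symm (x ⊗ₜ (TensorProduct.rid ℂ P
          ((Coalgebra.counit (R := ℂ) (A := H)).lTensor P
            (canonicalMap H P (translationMap hG h))) ⊗ₜ unop q)) = _
        rw [canonicalMap_translationMap]
        simp [TensorProduct.smul_tmul']
    refine (h1 (ComoduleAlgebra.coact p)).trans ?_
    rw [ComoduleAlgebra.coact_counit]
    rfl

/-- `h ⊗ p ↦ p₀ ⊗ h * p₁`. -/
def coactMul : H ⊗[ℂ] P →ₗ[ℂ] P ⊗[ℂ] H :=
  (LinearMap.mul' ℂ H).lTensor P ∘ₗ (TensorProduct.leftComm ℂ H P H).toLinearMap ∘ₗ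
    (coactLin H P).lTensor H

/-- The map `p ⊗ h ↦ h S⁻¹(p₁) ⊗ p₀` is a left inverse. This is the place where the inverse of the
antipode is needed. -/
theorem coactMul_injective
    (hS : Function.Bijective (HopfAlgebra.antipode ℂ : H →ₗ[ℂ] H)) :
    Function.Injective (coactMul : H ⊗[ℂ] P →ₗ[ℂ] P ⊗[ℂ] H) := by
  let T := (LinearEquiv.ofBijective (HopfAlgebra.antipode ℂ : H →ₗ[ℂ] H) hS).symm
  have hT : ∀ h, HopfAlgebra.antipode ℂ (T h) = h := fun h =>
    LinearEquiv.apply_symm_apply (LinearEquiv.ofBijective (HopfAlgebra.antipode ℂ : H →ₗ[ℂ] H) hS) h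
  let E : H ⊗[ℂ] H →ₗ[ℂ] H := LinearMap.mul' ℂ H ∘ₗ T.toLinearMap.lTensor H ∘ₗ
    (TensorProduct.comm ℂ H H).toLinearMap
  have hE : ∀ a b, E (a ⊗ₜ b) = b * T a := fun _ _ => rfl
  have hSE : ∀ z, HopfAlgebra.antipode ℂ (E z) =
      LinearMap.mul' ℂ H ((HopfAlgebra.antipode ℂ).lTensor H z) := by
    intro z
    induction z with
    | zero => simp
    | add a b ha hb => simp only [map_add, ha, hb]
    | tmul a b => rw [hE, HopfAlgebra.antipode_mul_antidistrib, hT]; rfl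
  -- The identity `h₂ S⁻¹(h₁) = ε(h)` becomes `h₁ S(h₂) = ε(h)` after application of `S`.
  have hEc : ∀ h, E (Coalgebra.comul (R := ℂ) h) =
      algebraMap ℂ H (Coalgebra.counit (R := ℂ) h) := by
    intro h
    apply hS.1
    rw [hSE, HopfAlgebra.mul_antipode_lTensor_comul_apply, Algebra.algebraMap_eq_smul_one,
      map_smul, HopfAlgebra.antipode_one]
  let G : P ⊗[ℂ] H →ₗ[ℂ] H ⊗[ℂ] P := (TensorProduct.comm ℂ P H).toLinearMap ∘ₗ E.lTensor P ∘ₗ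
    (TensorProduct.assoc ℂ P H H).toLinearMap ∘ₗ (coactLin H P).rTensor H
  have hG1 : ∀ (h : H) (c : P ⊗[ℂ] H), G ((LinearMap.mul' ℂ H).lTensor P
      (TensorProduct.leftComm ℂ H P H (h ⊗ₜ c))) = (LinearMap.mulLeft ℂ h).rTensor P (G c) := by
    intro h c
    induction c with
    | zero => simp
    | add a b ha hb => simp only [TensorProduct.tmul_add, map_add, ha, hb]
    | tmul x k =>
      have h1 : ∀ (c : P ⊗[ℂ] H) (l : H), TensorProduct.comm ℂ P H (E.lTensor P
          (TensorProduct.assoc ℂ P H H (c ⊗ₜ (h * l)))) = (LinearMap.mulLeft ℂ h).rTensor P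
          (TensorProduct.comm ℂ P H (E.lTensor P (TensorProduct.assoc ℂ P H H (c ⊗ₜ l)))) := by
        intro c l
        induction c with
        | zero => simp
        | add a b ha hb => simp only [TensorProduct.add_tmul, map_add, ha, hb]
        | tmul y m => simp [hE, mul_assoc]
      exact h1 _ _
  have hG2 : ∀ p : P, G (ComoduleAlgebra.coact p) = 1 ⊗ₜ p := by
    intro p
    have h1 : ∀ c : P ⊗[ℂ] H, TensorProduct.comm ℂ P H (E.lTensor P
        ((Coalgebra.comul (R := ℂ) (A := H)).lTensor P c)) =
        1 ⊗ₜ TensorProduct.rid ℂ P ((Coalgebra.counit (R := ℂ) (A := H)).lTensor P c) := by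
      intro c
      induction c with
      | zero => simp
      | add a b ha hb => simp only [TensorProduct.tmul_add, map_add, ha, hb]
      | tmul x h =>
        rw [LinearMap.lTensor_tmul, LinearMap.lTensor_tmul, hEc, Algebra.algebraMap_eq_smul_one]
        simp
    refine Eq.trans ?_ ((h1 (ComoduleAlgebra.coact p)).trans ?_)
    · rw [← ComoduleAlgebra.coact_coassoc]
      rfl
    · rw [ComoduleAlgebra.coact_counit]
  refine Function.LeftInverse.injective (g := G) fun z => ?_
  induction z with
  | zero => simp
  | add a b ha hb => simp only [map_add, ha, hb]
  | tmul h p =>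
    refine (hG1 h (ComoduleAlgebra.coact p)).trans ?_
    rw [hG2]
    simp

/-- `p ⊗ [q ⊗ r] ⊗ u ↦ (p ⊗ q * r₀) ⊗ (u₀ ⊗ r₁ * u₁)`. -/
def spread : P ⊗[ℂ] (GaloisTensor H P ⊗[ℂ] Pᵐᵒᵖ) →ₗ[ℂ] (P ⊗[ℂ] P) ⊗[ℂ] (P ⊗[ℂ] H) :=
  (TensorProduct.assoc ℂ P P (P ⊗[ℂ] H)).symm.toLinearMap ∘ₗ
    (coactMul.lTensor P ∘ₗ (TensorProduct.assoc ℂ P H P).toLinearMap ∘ₗ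
      TensorProduct.map (canonicalMap H P) (opLinearEquiv ℂ).symm.toLinearMap).lTensor P

/-- The map is built from the bijection `χ` and the injection `coactMul`, and tensoring over the
field `ℂ` preserves injections. -/
theorem spread_injective (hG : IsHopfGalois H P)
    (hS : Function.Bijective (HopfAlgebra.antipode ℂ : H →ₗ[ℂ] H)) :
    Function.Injective (spread : P ⊗[ℂ] (GaloisTensor H P ⊗[ℂ] Pᵐᵒᵖ) →ₗ[ℂ] _) := by
  refine (TensorProduct.assoc ℂ P P (P ⊗[ℂ] H)).symm.injective.comp
    (Module.Flat.lTensor_preserves_injective_linearMap _ ?_)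
  refine (Module.Flat.lTensor_preserves_injective_linearMap _ (coactMul_injective hS)).comp
    ((TensorProduct.assoc ℂ P H P).injective.comp ?_)
  exact (TensorProduct.congr (LinearEquiv.ofBijective (canonicalMap H P) hG)
    (opLinearEquiv ℂ).symm).injective

theorem spread_joinMiddle (z w : P ⊗[ℂ] Pᵐᵒᵖ) :
    spread (joinMiddle H P (z ⊗ₜ w)) =
      (mulLast P P ∘ₗ TensorProduct.mk ℂ (P ⊗[ℂ] P) P (unopRight P z)).rTensor (P ⊗[ℂ] H)
        (diag (coactLin H P) (unopRight P w)) := by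
  induction z with
  | zero => simp
  | add a b ha hb =>
    simp only [TensorProduct.add_tmul, map_add, ha, hb, LinearMap.comp_add, LinearMap.rTensor_add,
      LinearMap.add_apply]
  | tmul p q =>
  induction w with
  | zero => simp
  | add a b ha hb => simp only [TensorProduct.tmul_add, map_add, ha, hb]
  | tmul r u =>
    have h1 : ∀ c d : P ⊗[ℂ] H, (TensorProduct.assoc ℂ P P (P ⊗[ℂ] H)).symm
        (p ⊗ₜ (((LinearMap.mul' ℂ H).lTensor P ∘ₗ (TensorProduct.leftComm ℂ H P H).toLinearMap ∘ₗ
          LinearMap.id).lTensor P (TensorProduct.assoc ℂ P H (P ⊗[ℂ] H)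
            (((unop q ⊗ₜ 1) * c) ⊗ₜ d)))) =
        (mulLast P P ∘ₗ TensorProduct.mk ℂ (P ⊗[ℂ] P) P (p ⊗ₜ unop q)).rTensor (P ⊗[ℂ] H)
          (diagMul H P P (c ⊗ₜ d)) := by
      intro c d
      induction c with
      | zero => simp
      | add a b ha hb =>
        simp only [mul_add, TensorProduct.add_tmul, TensorProduct.tmul_add, map_add, ha, hb]
      | tmul x h =>
      induction d with
      | zero => simp
      | add a b ha hb => simp only [TensorProduct.tmul_add, map_add, ha, hb]
      | tmul y k => simp
    have h2 : ∀ c : P ⊗[ℂ] H, coactMul.lTensor P (TensorProduct.assoc ℂ P H P (c ⊗ₜ unop u)) =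
        ((LinearMap.mul' ℂ H).lTensor P ∘ₗ (TensorProduct.leftComm ℂ H P H).toLinearMap ∘ₗ
          LinearMap.id).lTensor P (TensorProduct.assoc ℂ P H (P ⊗[ℂ] H)
            (c ⊗ₜ ComoduleAlgebra.coact (unop u))) := by
      intro c
      induction c with
      | zero => simp
      | add a b ha hb => simp only [TensorProduct.add_tmul, map_add, ha, hb]
      | tmul x h => rfl
    refine Eq.trans ?_ (h1 (ComoduleAlgebra.coact r) (ComoduleAlgebra.coact (unop u)))
    rw [← h2]
    rfl

theorem spread_coproductFormula (hG : IsHopfGalois H P) (z : P ⊗[ℂ] Pᵐᵒᵖ) :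
    spread (coproductFormula hG z) = ((TensorProduct.mk ℂ P P).flip 1).rTensor (P ⊗[ℂ] H)
        (diag (coactLin H P) (unopRight P z)) := by
  induction z with
  | zero => simp
  | add a b ha hb => simp only [map_add, ha, hb]
  | tmul p q =>
    have h1 : ∀ c : P ⊗[ℂ] H, spread (TensorProduct.assoc ℂ P (GaloisTensor H P) Pᵐᵒᵖ
        ((translationMap hG).lTensor P c ⊗ₜ q)) = ((TensorProduct.mk ℂ P P).flip 1).rTensor (P ⊗[ℂ] H)
          (diagMul H P P (c ⊗ₜ ComoduleAlgebra.coact (unop q))) := by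
      intro c
      induction c with
      | zero => simp
      | add a b ha hb => simp only [TensorProduct.add_tmul, map_add, ha, hb]
      | tmul x h =>
        change (TensorProduct.assoc ℂ P P (P ⊗[ℂ] H)).symm (x ⊗ₜ (coactMul.lTensor P
          (TensorProduct.assoc ℂ P H P (canonicalMap H P (translationMap hG h) ⊗ₜ unop q)))) = _
        rw [canonicalMap_translationMap]
        change (TensorProduct.assoc ℂ P P (P ⊗[ℂ] H)).symm (x ⊗ₜ (1 ⊗ₜ
          (LinearMap.mul' ℂ H).lTensor P (TensorProduct.leftComm ℂ H P H
            (h ⊗ₜ ComoduleAlgebra.coact (unop q))))) = _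
        generalize ComoduleAlgebra.coact (H := H) (unop q) = d
        induction d with
        | zero => simp
        | add a b ha hb => simp only [TensorProduct.tmul_add, map_add, ha, hb]
        | tmul y k => simp
    exact h1 (ComoduleAlgebra.coact p)

theorem collapseMiddle_joinMiddle_map (d : ehresmannSchauenburg H P ⊗[ℂ] ehresmannSchauenburg H P) :
    collapseMiddle (joinMiddle H P (TensorProduct.map (ehresmannSchauenburg H P).val.toLinearMap
      (ehresmannSchauenburg H P).val.toLinearMap d)) =
      mulMiddle P P (TensorProduct.map (esIncl H P) (esIncl H P) d) := by
  induction d with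
  | zero => simp only [map_zero]
  | add a b ha hb => simp only [map_add, ha, hb]
  | tmul X Y =>
    rw [TensorProduct.map_tmul, TensorProduct.map_tmul, collapseMiddle_joinMiddle]
    rfl

/-- On `L ⊗ L` the coefficient `r₁ u₁` of the second factor `r ⊗ u` is trivial by coinvariance. So
`spread` contains nothing beyond `p ⊗ qr ⊗ u`. -/
theorem spread_joinMiddle_map (d : ehresmannSchauenburg H P ⊗[ℂ] ehresmannSchauenburg H P) :
    spread (joinMiddle H P (TensorProduct.map (ehresmannSchauenburg H P).val.toLinearMap
      (ehresmannSchauenburg H P).val.toLinearMap d)) = (tmulOne H P).lTensor (P ⊗[ℂ] P)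
      (mulMiddle P P (TensorProduct.map (esIncl H P) (esIncl H P) d)) := by
  induction d with
  | zero => simp only [map_zero]
  | add a b ha hb => simp only [map_add, ha, hb]
  | tmul X Y =>
    rw [TensorProduct.map_tmul, TensorProduct.map_tmul, spread_joinMiddle]
    refine (congrArg _ (diag_esIncl H P Y)).trans ?_
    change (mulLast P P ∘ₗ TensorProduct.mk ℂ (P ⊗[ℂ] P) P (esIncl H P X)).rTensor (P ⊗[ℂ] H) _ = _
    generalize esIncl H P X = x
    generalize esIncl H P Y = y
    induction y with
    | zero => simp
    | add a b ha hb => simp only [TensorProduct.tmul_add, map_add, ha, hb]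
    | tmul r u => rfl

/-- The forward direction collapses the middle. For the converse, both sides are compared after the
injective `spread`: it returns the product `p ⊗ qr ⊗ u` with a trivial `H`-leg on the left, and `p₀
⊗ 1 ⊗ q₀ ⊗ p₁ q₁` on the right, which is again trivial in `H` by coinvariance of `X`. -/
theorem joinMiddle_map_eq_iff (hG : IsHopfGalois H P)
    (hS : Function.Bijective (HopfAlgebra.antipode ℂ : H →ₗ[ℂ] H))
    (d : ehresmannSchauenburg H P ⊗[ℂ] ehresmannSchauenburg H P) (X : ehresmannSchauenburg H P) :
    joinMiddle H P (TensorProduct.map (ehresmannSchauenburg H P).val.toLinearMap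
      (ehresmannSchauenburg H P).val.toLinearMap d) = coproductFormula hG X ↔
      mulMiddle P P (TensorProduct.map (esIncl H P) (esIncl H P) d) =
        insertOne P P (esIncl H P X) := by
  constructor
  · intro h
    rw [← collapseMiddle_joinMiddle_map, h, collapseMiddle_coproductFormula, esIncl_apply]
  · intro h
    apply spread_injective hG hS
    rw [spread_joinMiddle_map, h, spread_coproductFormula]
    refine Eq.trans ?_ (congrArg _ (diag_esIncl H P X)).symm
    generalize esIncl H P X = x
    induction x with
    | zero => simp
    | add a b ha hb => simp only [map_add, ha, hb]
    | tmul r u => rfl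

end EhresmannSchauenburg

/-! ### Uniqueness of the structure -/

namespace IsCoinvariantModel

variable {H : Type v} {P : Type u} [Ring H] [HopfAlgebra ℂ H] [Ring P] [Algebra ℂ P]
  [ComoduleAlgebra H P] {L : Type u} [Ring L] [Algebra ℂ L] {j : L →ₗ[ℂ] P ⊗[ℂ] P}
  {𝓛 𝓛' : LeftBialgebroid (coinvariants H P) L}

theorem pairMap_comul_eq (hst : IsCoinvariantModel H P j 𝓛.s 𝓛.t) {X : L}
    (h : ∀ d, BalancedTensor.mk _ _ d = 𝓛.comul X →
      mulMiddle P P (TensorProduct.map j j d) = insertOne P P (j X)) :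
    hst.pairMap (𝓛.comul X) = insertOne P P (j X) := by
  obtain ⟨d, hd⟩ := Submodule.mkQ_surjective _ (𝓛.comul X)
  rw [← hd, pairMap_mk]
  exact h d hd

/-- Source and target are determined because `j` is injective. Once these agree, so do the balanced
products, and injectivity of `pairMap` determines the coproduct. -/
theorem bialgebroid_ext (hst : IsCoinvariantModel H P j 𝓛.s 𝓛.t)
    (hG : IsHopfGalois H P) (hF : IsFaithfullyFlat.{max u v} (coinvariants H P) P)
    (hst' : IsCoinvariantModel H P j 𝓛'.s 𝓛'.t)
    (hΔ : ∀ X, hst.pairMap (𝓛.comul X) = insertOne P P (j X))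
    (hΔ' : ∀ X, hst'.pairMap (𝓛'.comul X) = insertOne P P (j X))
    (hε : 𝓛.counit = 𝓛'.counit) : 𝓛 = 𝓛' := by
  have hs : 𝓛.s = 𝓛'.s :=
    AlgHom.ext fun b => hst.injective ((hst.source b).trans (hst'.source b).symm)
  have ht : 𝓛.t = 𝓛'.t :=
    LinearMap.ext fun b => hst.injective ((hst.target b).trans (hst'.target b).symm)
  cases 𝓛
  cases 𝓛'
  dsimp only at hs ht hε
  subst hs ht hε
  congr
  exact LinearMap.ext fun X =>
    (hst.pairMap_injective_and_range hG hF).1 ((hΔ X).trans (hΔ' X).symm)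

end IsCoinvariantModel

/-! ### The Ehresmann–Schauenburg structure: existence and uniqueness -/

section Existence

variable {H : Type v} {P : Type u} [Ring H] [HopfAlgebra ℂ H] [Ring P] [Algebra ℂ P]
  [ComoduleAlgebra H P]

/-- The source map `b ↦ b ⊗ 1`. -/
def esSource (b : coinvariants H P) : ehresmannSchauenburg H P :=
  ⟨(b : P) ⊗ₜ 1, by
    change diagonalCoact H P _ = _
    rw [diagonalCoact_tmul, (mem_coinvariants H P).1 b.2, unop_one, map_one,
      Algebra.TensorProduct.one_def]
    simp [diagonalMul]⟩

/-- The target map `b ↦ 1 ⊗ b`. -/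
def esTarget (b : coinvariants H P) : ehresmannSchauenburg H P :=
  ⟨1 ⊗ₜ op (b : P), by
    change diagonalCoact H P _ = _
    rw [diagonalCoact_tmul, unop_op, (mem_coinvariants H P).1 b.2, map_one,
      Algebra.TensorProduct.one_def]
    simp [diagonalMul]⟩

variable (H P) in
theorem isCoinvariantModel_esSource_esTarget :
    IsCoinvariantModel H P (esIncl H P) esSource esTarget :=
  isCoinvariantModel_esIncl (fun _ => rfl) (fun _ => rfl)

theorem isEhresmannSchauenburg_bialgebroid
    (hS : Function.Bijective (HopfAlgebra.antipode ℂ : H →ₗ[ℂ] H))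
    (hG : IsHopfGalois H P) (hF : IsFaithfullyFlat.{max u v} (coinvariants H P) P) :
    IsEhresmannSchauenburg hG ((isCoinvariantModel_esSource_esTarget H P).bialgebroid hG hF) where
  source _ := rfl
  target _ := rfl
  counit _ := rfl
  comul X d hd := (joinMiddle_map_eq_iff hG hS d X).2
    (((isCoinvariantModel_esSource_esTarget H P).mk_eq_comul_iff hG hF d X).1 hd)

namespace IsEhresmannSchauenburg

variable {hG : IsHopfGalois H P}
  {𝓛 𝓛' : LeftBialgebroid (coinvariants H P) (ehresmannSchauenburg H P)}

theorem isCoinvariantModel (h : IsEhresmannSchauenburg hG 𝓛) :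
    IsCoinvariantModel H P (esIncl H P) 𝓛.s 𝓛.t :=
  isCoinvariantModel_esIncl h.source h.target

theorem pairMap_comul (h : IsEhresmannSchauenburg hG 𝓛)
    (hS : Function.Bijective (HopfAlgebra.antipode ℂ : H →ₗ[ℂ] H)) (X) :
    h.isCoinvariantModel.pairMap (𝓛.comul X) = insertOne P P (esIncl H P X) :=
  h.isCoinvariantModel.pairMap_comul_eq fun d hd =>
    (joinMiddle_map_eq_iff hG hS d X).1 (h.comul X d hd)

theorem eq (h : IsEhresmannSchauenburg hG 𝓛) (h' : IsEhresmannSchauenburg hG 𝓛')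
    (hS : Function.Bijective (HopfAlgebra.antipode ℂ : H →ₗ[ℂ] H))
    (hF : IsFaithfullyFlat.{max u v} (coinvariants H P) P) : 𝓛 = 𝓛' :=
  h.isCoinvariantModel.bialgebroid_ext hG hF h'.isCoinvariantModel (h.pairMap_comul hS)
    (h'.pairMap_comul hS)
    (LinearMap.ext fun X => Subtype.ext ((h.counit X).trans (h'.counit X).symm))

end IsEhresmannSchauenburg

end Existence

/-! ### The involution and the `*`-Hopf algebroid pair -/

section Star

variable {H : Type v} {P : Type u} [Ring H] [HopfAlgebra ℂ H] [StarRing H] [StarModule ℂ H]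
  [Ring P] [Algebra ℂ P] [StarRing P] [StarModule ℂ P] [ComoduleAlgebra H P]
  [IsUnitaryCoaction H P]

/-- `p ⊗ (q ⊗ h) ↦ q* ⊗ (p* ⊗ h*)`. -/
def starSwapCoact (H P : Type*) [Ring H] [HopfAlgebra ℂ H] [StarRing H] [StarModule ℂ H]
    [Ring P] [Algebra ℂ P] [StarRing P] [StarModule ℂ P] :
    P ⊗[ℂ] (P ⊗[ℂ] H) →ₛₗ[starRingEnd ℂ] P ⊗[ℂ] (P ⊗[ℂ] H) :=
  (TensorProduct.leftComm ℂ P P H).toLinearMap.comp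
    (TensorProduct.map (starLin P) (TensorProduct.map (starLin P) (starLin H)))

theorem starSwapCoact_tmul (p q : P) (h : H) :
    starSwapCoact H P (p ⊗ₜ (q ⊗ₜ h)) = star q ⊗ₜ (star p ⊗ₜ star h) := rfl

/-- Since the coaction is unitary, `q* ⊗ p*` has the coefficient `q₁* p₁*`. This is the star of `p₁
q₁`, so the exchange of legs absorbs the reversal. -/
theorem diag_starSwap (z : P ⊗[ℂ] P) :
    diag (coactLin H P) (starSwap P z) = starSwapCoact H P (diag (coactLin H P) z) := by
  induction z with
  | zero => simp
  | add a b ha hb => simp only [map_add, ha, hb]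
  | tmul p q =>
    rw [starSwap_tmul, diag_tmul, diag_tmul, AlgHom.toLinearMap_apply, AlgHom.toLinearMap_apply,
      IsUnitaryCoaction.coact_star, IsUnitaryCoaction.coact_star]
    generalize ComoduleAlgebra.coact (H := H) p = a
    generalize ComoduleAlgebra.coact (H := H) q = c
    induction a with
    | zero => simp
    | add a b ha hb =>
      simp only [star_add, TensorProduct.add_tmul, TensorProduct.tmul_add, map_add, ha, hb]
    | tmul p h =>
    induction c with
    | zero => simp
    | add a b ha hb =>
      simp only [star_add, TensorProduct.add_tmul, TensorProduct.tmul_add, map_add, ha, hb]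
    | tmul q k => simp [starSwapCoact_tmul]

theorem starSwapCoact_tmulOne (z : P ⊗[ℂ] P) :
    starSwapCoact H P ((tmulOne H P).lTensor P z) = (tmulOne H P).lTensor P (starSwap P z) := by
  induction z with
  | zero => simp
  | add a b ha hb => simp only [map_add, ha, hb]
  | tmul p q => simp [starSwapCoact_tmul]

theorem unopRight_starFlip (z : P ⊗[ℂ] Pᵐᵒᵖ) :
    unopRight P (starFlip P z) = starSwap P (unopRight P z) := by
  induction z with
  | zero => simp
  | add a b ha hb => simp only [map_add, ha, hb]
  | tmul p q => rfl

theorem starFlip_starFlip (z : P ⊗[ℂ] Pᵐᵒᵖ) : starFlip P (starFlip P z) = z :=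
  (unopRight P).injective (by rw [unopRight_starFlip, unopRight_starFlip, starSwap_starSwap])

theorem starFlip_mem {z : P ⊗[ℂ] Pᵐᵒᵖ} (hz : z ∈ ehresmannSchauenburg H P) :
    starFlip P z ∈ ehresmannSchauenburg H P := by
  rw [mem_ehresmannSchauenburg] at hz ⊢
  rw [unopRight_starFlip, diag_starSwap, hz, starSwapCoact_tmulOne]

variable (H P) in
/-- `p ⊗ q ↦ q* ⊗ p*` on `𝓛(P, H)`. -/
def esStar : ehresmannSchauenburg H P ≃ₛₗ[starRingEnd ℂ] ehresmannSchauenburg H P where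
  toFun X := ⟨starFlip P X, starFlip_mem X.2⟩
  invFun X := ⟨starFlip P X, starFlip_mem X.2⟩
  map_add' _ _ := Subtype.ext (map_add (starFlip P) _ _)
  map_smul' c _ := Subtype.ext (map_smulₛₗ (starFlip P) c _)
  left_inv _ := Subtype.ext (starFlip_starFlip _)
  right_inv _ := Subtype.ext (starFlip_starFlip _)

theorem esIncl_esStar (X : ehresmannSchauenburg H P) :
    esIncl H P (esStar H P X) = starSwap P (esIncl H P X) :=
  unopRight_starFlip _

theorem IsEhresmannSchauenburg.isStarHopfAlgebroidPair {hG : IsHopfGalois H P}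
    {𝓛 : LeftBialgebroid (coinvariants H P) (ehresmannSchauenburg H P)}
    (h : IsEhresmannSchauenburg hG 𝓛)
    (hS : Function.Bijective (HopfAlgebra.antipode ℂ : H →ₗ[ℂ] H))
    (hF : IsFaithfullyFlat.{max u v} (coinvariants H P) P) :
    IsStarHopfAlgebroidPair 𝓛 𝓛.op ((esStar H P).trans (opLinearEquiv ℂ :
      ehresmannSchauenburg H P ≃ₗ[ℂ] (ehresmannSchauenburg H P)ᵐᵒᵖ)) (opLinearEquiv ℂ) where
  starRelated := h.isCoinvariantModel.isStarRelated hG hF (h.pairMap_comul hS) h.counit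
    esIncl_esStar
  reflexive := 𝓛.isReflexive_op
  -- Both sides are the involution itself, since `esStar` is defined with the same map in both
  -- directions and `Φ` is the identity.
  compat _ := rfl
  leftHopf := h.isCoinvariantModel.isLeftHopf hG hF (h.pairMap_comul hS)
  antiLeftHopf := h.isCoinvariantModel.isAntiLeftHopf hG hF (h.pairMap_comul hS) esIncl_esStar

end Star

end HopfPair

end

theorem proposition4p7 {P : Type u} {H : Type v}
    [Ring H] [HopfAlgebra ℂ H] [StarRing H] [StarModule ℂ H] [IsHopfStarAlgebra H]
    [Ring P] [Algebra ℂ P] [StarRing P] [StarModule ℂ P]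
    [ComoduleAlgebra H P] [IsUnitaryCoaction H P]
    (hS : Function.Bijective (HopfAlgebra.antipode ℂ : H →ₗ[ℂ] H))
    (hG : IsHopfGalois H P)
    (hF : IsFaithfullyFlat.{max u v} (coinvariants H P) P) :
    (∃! 𝓛 : LeftBialgebroid (coinvariants H P) (ehresmannSchauenburg H P),
      IsEhresmannSchauenburg hG 𝓛) ∧
    ∀ 𝓛 : LeftBialgebroid (coinvariants H P) (ehresmannSchauenburg H P),
      IsEhresmannSchauenburg hG 𝓛 →
      ∃ circ : ehresmannSchauenburg H P ≃ₛₗ[starRingEnd ℂ] (ehresmannSchauenburg H P)ᵐᵒᵖ,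
        (∀ X : ehresmannSchauenburg H P,
          ((circ X).unop : P ⊗[ℂ] Pᵐᵒᵖ) = starFlip P (X : P ⊗[ℂ] Pᵐᵒᵖ)) ∧
        IsStarHopfAlgebroidPair 𝓛 𝓛.op circ (MulOpposite.opLinearEquiv ℂ) :=
  ⟨⟨_, isEhresmannSchauenburg_bialgebroid hS hG hF,
      fun _ h => h.eq (isEhresmannSchauenburg_bialgebroid hS hG hF) hS hF⟩,
    fun _ h => ⟨(esStar H P).trans (opLinearEquiv ℂ), fun _ => rfl,
      h.isStarHopfAlgebroidPair hS hF⟩⟩
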